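/- Let $k$ be a field of characteristic $0$. All vector spaces are over $k$; $\mathrm{DGVec}$ is the closed symmetric monoidal category of $\mathbb{Z}$-graded dg vector spaces (differential of degree $-1$, Koszul sign rule) with internal hom $[V,W]$. Let $\mathrm{DGLA}$ be the category of dg Lie algebras, and $\mathrm{cCDGA}$ the category of conilpotent cocommutative coassociative non-counital dg coalgebras, i.e. coalgebras $C$ such that every $x\in C$ is killed by some iterated comultiplication $\Delta^n$. The tensor product makes $\mathrm{cCDGA}$ a symmetric semi-monoidal category (the structure of a symmetric monoidal category without a unit object). For $C\in\mathrm{cCDGA}$ and $\mathfrak g\in\mathrm{DGLA}$ let $\{C,\mathfrak g\}$ be the convolution Lie algebra: the dg vector space $[C,\mathfrak g]$ with bracket $[f,h]=[-,-]_{\mathfrak g}\circ(f\otimes h)\circ\Delta_C$; this is a functor $\mathrm{cCDGA}^{op}\times\mathrm{DGLA}\to\mathrm{DGLA}$. **Theorem.** The forgetful functor $\mathrm{DGLA}\to\mathrm{DGVec}$ has a left adjoint $T_{\mathrm{Lie}}$ (free dg Lie algebra), the forgetful functor $\mathrm{cCDGA}\to\mathrm{DGVec}$ has a right adjoint $S^{co}$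 (cofree conilpotent cocommutative coalgebra), and there are functors $$\rhd:\mathrm{cCDGA}\times\mathrm{DGLA}\to\mathrm{DGLA},\qquad \overline{\mathrm{DGLA}}(-,-):\mathrm{DGLA}^{op}\times\mathrm{DGLA}\to\mathrm{cCDGA}$$ such that $(\mathrm{DGLA},\rhd,\overline{\mathrm{DGLA}},\{-,-\})$ is a closed semi-module category over $\mathrm{cCDGA}$. That is: - there is a natural isomorphism $\alpha_{C,D,\mathfrak g}:(C\otimes D)\rhd\mathfrak g\to C\rhd(D\rhd\mathfrak g)$ satisfying the pentagon axiom: the two composites $((C\otimes D)\otimes E)\rhd\mathfrak g\to C\rhd(D\rhd(E\rhd\mathfrak g))$ built from $\alpha$ and the associator of $\otimes$ agree; - $\{C,-\}$ is right adjoint to $C\rhd-$, naturally in $C$; - $\overline{\mathrm{DGLA}}(\mathfrak g,-)$ is right adjoint to $-\rhd\mathfrak g$, naturally in $\mathfrak g$. Let $u_{C,\mathfrak g}:C\otimes\mathfrak g\to C\rhd\mathfrak g$ be the universal measuring, i.e. the dg linear map adjoint to the unit $\mathfrak g\to\{C,C\rhd\mathfrak g\}$. Then moreover: - $\alpha$ is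 compatible with universal measurings: $\alpha_{C,D,\mathfrak g}\circ u_{C\otimes D,\mathfrak g}$ equals $u_{C,D\rhd\mathfrak g}\circ(\mathrm{id}_C\otimes u_{D,\mathfrak g})$ under the identification $(C\otimes D)\otimes\mathfrak g\cong C\otimes(D\otimes\mathfrak g)$; - for every $V\in\mathrm{DGVec}$, the canonical maps $T_{\mathrm{Lie}}(C\otimes V)\to C\rhd T_{\mathrm{Lie}}V$ (induced by the universal measuring) and $\overline{\mathrm{DGLA}}(T_{\mathrm{Lie}}V,\mathfrak h)\to S^{co}[V,\mathfrak h]$ (induced by the evaluation $\overline{\mathrm{DGLA}}(T_{\mathrm{Lie}}V,\mathfrak h)\otimes T_{\mathrm{Lie}}V\to\mathfrak h$) are isomorphisms; - for all $C,\mathfrak g,\mathfrak h$, the coequaliser presentation $T_{\mathrm{Lie}}^2\mathfrak g\rightrightarrows T_{\mathrm{Lie}}\mathfrak g\to\mathfrak g$ induces a coequaliser $C\rhd T_{\mathrm{Lie}}^2\mathfrak g\rightrightarrows C\rhd T_{\mathrm{Lie}}\mathfrak g\to C\rhd\mathfrak g$ and an equaliser $\overline{\mathrm{DGLA}}(\mathfrak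 g,\mathfrak h)\to\overline{\mathrm{DGLA}}(T_{\mathrm{Lie}}\mathfrak g,\mathfrak h)\rightrightarrows\overline{\mathrm{DGLA}}(T_{\mathrm{Lie}}^2\mathfrak g,\mathfrak h)$. -/

import Mathlib

open CategoryTheory MonoidalCategory
open scoped TensorProduct DirectSum

universe u v w

set_option linter.unusedVariables false

noncomputable section

/-- A differential graded vector space over `k` (homological grading): a `k`-vector space which is
the direct sum of its homogeneous parts `gr n`, `n : ℤ`, with a differential of degree `-1`. -/
structure DGVec (k : Type u) [Field k] where
  carrier : Type u
  [addCommGroup : AddCommGroup carrier]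
  [module : Module k carrier]
  gr : ℤ → Submodule k carrier
  isInternal : DirectSum.IsInternal gr
  d : carrier →ₗ[k] carrier
  d_mem : ∀ (n : ℤ) (x : carrier), x ∈ gr n → d x ∈ gr (n - 1)
  d_d : ∀ x : carrier, d (d x) = 0

namespace DGVec

variable {k : Type u} [Field k]

attribute [instance] DGVec.addCommGroup DGVec.module

/-- The sign `(-1)^n` as an element of `k`. -/
def sg (k : Type u) [Field k] (n : ℤ) : k := ((n.negOnePow : ℤ) : k)

lemma sg_add (m n : ℤ) : sg k (m + n) = sg k m * sg k n := by
  simp [sg, Int.negOnePow_add]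

@[simp] lemma sg_zero : sg k 0 = 1 := by simp [sg]

@[simp] lemma sg_one : sg k 1 = -1 := by simp [sg]

@[simp] lemma sg_neg (n : ℤ) : sg k (-n) = sg k n := by simp [sg, Int.negOnePow_neg]

lemma sg_mul_self (n : ℤ) : sg k n * sg k n = 1 := by
  rw [← sg_add, ← two_mul]; simp [sg]

lemma sg_sub (m n : ℤ) : sg k (m - n) = sg k m * sg k n := by
  rw [sub_eq_add_neg, sg_add, sg_neg]

/-- The decomposition of `V` into homogeneous parts. -/
def decomp (V : DGVec k) : V.carrier ≃ₗ[k] ⨁ n, V.gr n :=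
  (LinearEquiv.ofBijective (DirectSum.coeLinearMap V.gr) V.isInternal).symm

lemma decomp_of_mem (V : DGVec k) {n : ℤ} {x : V.carrier} (hx : x ∈ V.gr n) :
    V.decomp x = DirectSum.lof k ℤ (fun n => V.gr n) n ⟨x, hx⟩ := by
  rw [decomp, LinearEquiv.symm_apply_eq]
  exact (DirectSum.coeLinearMap_lof V.gr n ⟨x, hx⟩).symm

/-- The linear map on `V` with given restrictions to the homogeneous parts. -/
def lift (V : DGVec k) {M : Type*} [AddCommMonoid M] [Module k M]
    (f : ∀ n, V.gr n →ₗ[k] M) : V.carrier →ₗ[k] M :=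
  DirectSum.toModule k ℤ M f ∘ₗ V.decomp.toLinearMap

lemma lift_of_mem (V : DGVec k) {M : Type*} [AddCommMonoid M] [Module k M]
    (f : ∀ n, V.gr n →ₗ[k] M) {n : ℤ} {x : V.carrier} (hx : x ∈ V.gr n) :
    V.lift f x = f n ⟨x, hx⟩ := by
  simp [lift, decomp_of_mem V hx]

@[elab_as_elim]
lemma induction (V : DGVec k) {P : V.carrier → Prop} (x : V.carrier)
    (hom : ∀ n, ∀ x ∈ V.gr n, P x) (add : ∀ x y, P x → P y → P (x + y)) : P x := by
  have h : x ∈ iSup V.gr := by rw [V.isInternal.submodule_iSup_eq_top]; trivial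
  exact Submodule.iSup_induction V.gr (motive := P) h hom (hom 0 0 (zero_mem _)) add

lemma lin_ext {V : DGVec k} {M : Type*} [AddCommMonoid M] [Module k M]
    {f g : V.carrier →ₗ[k] M} (h : ∀ n, ∀ x ∈ V.gr n, f x = g x) : f = g :=
  LinearMap.ext fun x => V.induction x h fun x y hx hy => by rw [map_add, map_add, hx, hy]

lemma isInternal_of {M : Type*} [AddCommGroup M] [Module k M] (A : ℤ → Submodule k M)
    (f : M →ₗ[k] ⨁ n, A n) (h₁ : DirectSum.coeLinearMap A ∘ₗ f = LinearMap.id)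
    (h₂ : ∀ n, ∀ x, ∀ hx : x ∈ A n, f x = DirectSum.lof k ℤ (fun n => A n) n ⟨x, hx⟩) :
    DirectSum.IsInternal A :=
  (DirectSum.Decomposition.ofLinearMap A f h₁ (by
    ext n x : 2
    simpa using h₂ n x.1 x.2)).isInternal

/-- The projection of `V` onto its part of degree `n`. -/
def proj (V : DGVec k) (n : ℤ) : V.carrier →ₗ[k] V.carrier :=
  V.lift fun m => if m = n then (V.gr m).subtype else 0

lemma proj_mem (V : DGVec k) (n : ℤ) (x : V.carrier) : V.proj n x ∈ V.gr n := by
  refine V.induction x (fun m x hx => ?_) fun x y hx hy => by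
    rw [map_add]; exact add_mem hx hy
  rw [proj, lift_of_mem V _ hx]
  split_ifs with h
  · subst h; exact hx
  · exact zero_mem _

lemma proj_of_mem (V : DGVec k) {n : ℤ} {x : V.carrier} (hx : x ∈ V.gr n) (m : ℤ) :
    V.proj m x = if n = m then x else 0 := by
  rw [proj, lift_of_mem V _ hx]
  split_ifs <;> simp

lemma ext_proj (V : DGVec k) {x y : V.carrier} (h : ∀ n, V.proj n x = V.proj n y) : x = y := by
  rw [← sub_eq_zero]
  have h' : ∀ n, V.proj n (x - y) = 0 := fun n => by rw [map_sub, h, sub_self]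
  revert h'
  generalize x - y = z
  intro hz
  have key : ∀ n, ∀ z : V.carrier, ((V.decomp z n : V.gr n) : V.carrier) = V.proj n z := by
    intro n z
    refine V.induction z (fun m x hx => ?_) fun x y hx hy => by
      rw [map_add, map_add, DirectSum.add_apply, Submodule.coe_add, hx, hy]
    rw [decomp_of_mem V hx, proj_of_mem V hx, DirectSum.lof_eq_of, DirectSum.coe_of_apply]
    split_ifs <;> rfl
  apply V.decomp.injective
  rw [map_zero]
  ext n
  rw [key, hz]; rfl

/-- The operator `x ↦ (-1)^(p |x|) x` on `V`. -/
def sgnPow (V : DGVec k) (p : ℤ) : V.carrier →ₗ[k] V.carrier :=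
  V.lift fun q => sg k (p * q) • (V.gr q).subtype

lemma sgnPow_of_mem (V : DGVec k) (p : ℤ) {q : ℤ} {x : V.carrier} (hx : x ∈ V.gr q) :
    V.sgnPow p x = sg k (p * q) • x := by
  rw [sgnPow, lift_of_mem V _ hx]; rfl

/-- The sign operator `x ↦ (-1)^|x| x` on `V`. -/
def sgn (V : DGVec k) : V.carrier →ₗ[k] V.carrier := V.sgnPow 1

lemma sgn_of_mem (V : DGVec k) {q : ℤ} {x : V.carrier} (hx : x ∈ V.gr q) :
    V.sgn x = sg k q • x := by
  rw [sgn, sgnPow_of_mem V 1 hx, one_mul]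

lemma sgn_sgn (V : DGVec k) (x : V.carrier) : V.sgn (V.sgn x) = x := by
  refine V.induction x (fun m x hx => ?_) fun x y hx hy => by rw [map_add, map_add, hx, hy]
  rw [sgn_of_mem V hx, map_smul, sgn_of_mem V hx, smul_smul, sg_mul_self, one_smul]

lemma sgn_d (V : DGVec k) (x : V.carrier) : V.sgn (V.d x) = - V.d (V.sgn x) := by
  refine V.induction x (fun m x hx => ?_) fun x y hx hy => by
    rw [map_add, map_add, hx, hy, map_add, map_add, neg_add]
  rw [sgn_of_mem V hx, sgn_of_mem V (V.d_mem _ _ hx), map_smul, sg_sub]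
  simp

/-- Morphisms of dg vector spaces: linear maps of degree `0` commuting with the differentials. -/
@[ext]
structure Hom (V W : DGVec k) where
  lin : V.carrier →ₗ[k] W.carrier
  deg : ∀ (n : ℤ) (x : V.carrier), x ∈ V.gr n → lin x ∈ W.gr n
  comm : ∀ x : V.carrier, lin (V.d x) = W.d (lin x)

instance : Category (DGVec k) where
  Hom := Hom
  id V := ⟨LinearMap.id, fun _ _ h => h, fun _ => rfl⟩
  comp f g := ⟨g.lin ∘ₗ f.lin, fun n x h => g.deg n _ (f.deg n x h),
    fun x => by simp [f.comm, g.comm]⟩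

@[ext]
lemma hom_ext {V W : DGVec k} {f g : V ⟶ W} (h : f.lin = g.lin) : f = g := Hom.ext h

@[simp] lemma id_lin (V : DGVec k) : Hom.lin (𝟙 V) = LinearMap.id := rfl

@[simp] lemma comp_lin {U V W : DGVec k} (f : U ⟶ V) (g : V ⟶ W) :
    (f ≫ g).lin = g.lin ∘ₗ f.lin := rfl

section Preadditive

variable (V W : DGVec k)

instance : Zero (V ⟶ W) := ⟨⟨0, fun _ _ _ => zero_mem _, fun _ => by simp⟩⟩
instance : Add (V ⟶ W) :=
  ⟨fun f g => ⟨f.lin + g.lin, fun n x h => add_mem (f.deg n x h) (g.deg n x h),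
    fun _ => by simp [f.comm, g.comm]⟩⟩
instance : Neg (V ⟶ W) :=
  ⟨fun f => ⟨-f.lin, fun n x h => neg_mem (f.deg n x h), fun _ => by simp [f.comm]⟩⟩
instance : Sub (V ⟶ W) :=
  ⟨fun f g => ⟨f.lin - g.lin, fun n x h => sub_mem (f.deg n x h) (g.deg n x h),
    fun _ => by simp [f.comm, g.comm]⟩⟩
instance : SMul ℕ (V ⟶ W) :=
  ⟨fun m f => ⟨m • f.lin, fun n x h => nsmul_mem (f.deg n x h) m,
    fun _ => by simp [f.comm]⟩⟩
instance : SMul ℤ (V ⟶ W) :=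
  ⟨fun m f => ⟨m • f.lin, fun n x h => zsmul_mem (f.deg n x h) m,
    fun _ => by simp [f.comm]⟩⟩

instance : AddCommGroup (V ⟶ W) :=
  Function.Injective.addCommGroup (fun f : V ⟶ W => f.lin) (fun _ _ h => hom_ext h) rfl
    (fun _ _ => rfl) (fun _ => rfl) (fun _ _ => rfl) (fun _ _ => rfl) (fun _ _ => rfl)

instance : Preadditive (DGVec k) where
  add_comp _ _ _ f f' g := hom_ext (by
    ext x; exact map_add g.lin (f.lin x) (f'.lin x))
  comp_add _ _ _ f g g' := rfl

end Preadditive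

@[simp] lemma add_lin {V W : DGVec k} (f g : V ⟶ W) : (f + g).lin = f.lin + g.lin := rfl

@[simp] lemma zero_lin {V W : DGVec k} : Hom.lin (0 : V ⟶ W) = 0 := rfl

@[simp] lemma neg_lin {V W : DGVec k} (f : V ⟶ W) : (-f).lin = -f.lin := rfl

lemma hom_proj {V W : DGVec k} (f : V.carrier →ₗ[k] W.carrier)
    (deg : ∀ (n : ℤ) (x : V.carrier), x ∈ V.gr n → f x ∈ W.gr n) (n : ℤ) (x : V.carrier) :
    f (V.proj n x) = W.proj n (f x) := by
  refine V.induction x (fun m x hx => ?_) fun x y hx hy => by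
    simp only [map_add, hx, hy]
  rw [proj_of_mem V hx, proj_of_mem W (deg _ _ hx)]
  split_ifs <;> simp

/-- A linear equivalence of degree `0` commuting with the differentials is an isomorphism. -/
def isoMk {V W : DGVec k} (e : V.carrier ≃ₗ[k] W.carrier)
    (deg : ∀ (n : ℤ) (x : V.carrier), x ∈ V.gr n → e x ∈ W.gr n)
    (comm : ∀ x : V.carrier, e (V.d x) = W.d (e x)) : V ≅ W where
  hom := ⟨e.toLinearMap, deg, comm⟩
  inv := ⟨e.symm.toLinearMap, fun n y hy => by
      have h : e (V.proj n (e.symm y)) = y := by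
        have := hom_proj e.toLinearMap deg n (e.symm y)
        simp only [LinearEquiv.coe_coe, LinearEquiv.apply_symm_apply] at this
        rw [this, proj_of_mem W hy, if_pos rfl]
      have h' : V.proj n (e.symm y) = e.symm y := e.injective (by rw [h, e.apply_symm_apply])
      rw [LinearEquiv.coe_coe, ← h']
      exact proj_mem V n _,
    fun y => e.injective (by simp [comm])⟩
  hom_inv_id := by ext; simp
  inv_hom_id := by ext; simp

section Tensor

variable (V W : DGVec k)

/-- The part of degree `n` of the tensor product, spanned by the `x ⊗ y` with `|x| + |y| = n`. -/
def tensorGr (n : ℤ) : Submodule k (V.carrier ⊗[k] W.carrier) :=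
  Submodule.span k {t | ∃ p q : ℤ, p + q = n ∧ ∃ x ∈ V.gr p, ∃ y ∈ W.gr q, x ⊗ₜ[k] y = t}

variable {V W} in
lemma tmul_mem {p q n : ℤ} (h : p + q = n) {x : V.carrier} {y : W.carrier} (hx : x ∈ V.gr p)
    (hy : y ∈ W.gr q) : x ⊗ₜ[k] y ∈ tensorGr V W n :=
  Submodule.subset_span ⟨p, q, h, x, hx, y, hy, rfl⟩

variable {V W} in
lemma tensor_lin_ext {M : Type*} [AddCommMonoid M] [Module k M]
    {f g : V.carrier ⊗[k] W.carrier →ₗ[k] M}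
    (h : ∀ p q : ℤ, ∀ x ∈ V.gr p, ∀ y ∈ W.gr q, f (x ⊗ₜ y) = g (x ⊗ₜ y)) : f = g := by
  apply TensorProduct.ext
  refine lin_ext fun p x hx => lin_ext fun q y hy => h p q x hx y hy

/-- Auxiliary: the decomposition of the tensor product into its homogeneous parts. -/
def tensorDecomp : V.carrier ⊗[k] W.carrier →ₗ[k] ⨁ n, tensorGr V W n :=
  TensorProduct.lift (V.lift (M := W.carrier →ₗ[k] ⨁ n, tensorGr V W n) fun p => LinearMap.flip (W.lift fun q => LinearMap.flip
    (LinearMap.mk₂ k (fun (x : V.gr p) (y : W.gr q) =>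
      DirectSum.lof k ℤ (fun n => tensorGr V W n) (p + q) ⟨x.1 ⊗ₜ y.1, tmul_mem rfl x.2 y.2⟩)
      (fun _ _ _ => by rw [← map_add]; congr 1; ext; simp [TensorProduct.add_tmul])
      (fun _ _ _ => by rw [← map_smul]; congr 1)
      (fun _ _ _ => by rw [← map_add]; congr 1; ext; simp [TensorProduct.tmul_add])
      (fun _ _ _ => by rw [← map_smul]; congr 1; ext; simp))))

lemma tensorDecomp_tmul {p q : ℤ} {x : V.carrier} {y : W.carrier} (hx : x ∈ V.gr p)
    (hy : y ∈ W.gr q) : tensorDecomp V W (x ⊗ₜ y) =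
      DirectSum.lof k ℤ (fun n => tensorGr V W n) (p + q) ⟨x ⊗ₜ y, tmul_mem rfl hx hy⟩ := by
  simp only [tensorDecomp, TensorProduct.lift.tmul]
  rw [lift_of_mem V _ hx, LinearMap.flip_apply, lift_of_mem W _ hy]
  rfl

lemma tensor_isInternal : DirectSum.IsInternal (tensorGr V W) := by
  refine isInternal_of _ (tensorDecomp V W) ?_ ?_
  · refine tensor_lin_ext fun p q x hx y hy => ?_
    simp [tensorDecomp_tmul V W hx hy]
  · intro n t ht
    induction ht using Submodule.span_induction with
    | mem t ht =>
      obtain ⟨p, q, rfl, x, hx, y, hy, rfl⟩ := ht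
      exact tensorDecomp_tmul V W hx hy
    | zero => rw [map_zero]; exact (map_zero _).symm
    | add s t hs ht hs' ht' =>
      rw [map_add, hs', ht', ← map_add]; rfl
    | smul a t ht ht' => rw [map_smul, ht', ← map_smul]; rfl

/-- The differential `d(x ⊗ y) = dx ⊗ y + (-1)^|x| x ⊗ dy` of the tensor product. -/
def tensorD : V.carrier ⊗[k] W.carrier →ₗ[k] V.carrier ⊗[k] W.carrier :=
  TensorProduct.map V.d LinearMap.id + TensorProduct.map V.sgn W.d

/-- The tensor product of dg vector spaces. -/
abbrev tensor : DGVec k where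
  carrier := V.carrier ⊗[k] W.carrier
  gr := tensorGr V W
  isInternal := tensor_isInternal V W
  d := tensorD V W
  d_mem n t ht := by
    induction ht using Submodule.span_induction with
    | mem t ht =>
      obtain ⟨p, q, rfl, x, hx, y, hy, rfl⟩ := ht
      simp only [tensorD, LinearMap.add_apply, TensorProduct.map_tmul, LinearMap.id_apply,
        sgn_of_mem V hx]
      exact add_mem (tmul_mem (by ring) (V.d_mem _ _ hx) hy)
        (tmul_mem (by ring) (Submodule.smul_mem _ _ hx) (W.d_mem _ _ hy))
    | zero => simp
    | add s t hs ht hs' ht' => rw [map_add]; exact add_mem hs' ht'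
    | smul a t ht ht' => rw [map_smul]; exact Submodule.smul_mem _ _ ht'
  d_d t := by
    induction t with
    | zero => simp
    | add s t hs ht => rw [map_add, map_add, hs, ht, add_zero]
    | tmul x y => simp [tensorD, V.d_d, W.d_d, sgn_d, TensorProduct.neg_tmul]

end Tensor

@[simp] lemma tensor_d_tmul (V W : DGVec k) (x : V.carrier) (y : W.carrier) :
    (tensor V W).d (x ⊗ₜ[k] y) = V.d x ⊗ₜ[k] y + V.sgn x ⊗ₜ[k] W.d y := rfl

lemma tensor_sgn_tmul (V W : DGVec k) (x : V.carrier) (y : W.carrier) :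
    (tensor V W).sgn (x ⊗ₜ[k] y) = V.sgn x ⊗ₜ[k] W.sgn y := by
  have : (tensor V W).sgn = TensorProduct.map V.sgn W.sgn := by
    refine tensor_lin_ext fun p q x hx y hy => ?_
    have h : x ⊗ₜ[k] y ∈ (tensor V W).gr (p + q) := tmul_mem rfl hx hy
    rw [sgn_of_mem _ h, TensorProduct.map_tmul, sgn_of_mem V hx, sgn_of_mem W hy,
      TensorProduct.smul_tmul_smul, sg_add]
  rw [this, TensorProduct.map_tmul]

lemma Hom.sgn_comm {V W : DGVec k} (f : V ⟶ W) (x : V.carrier) :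
    f.lin (V.sgn x) = W.sgn (f.lin x) := by
  refine V.induction x (fun m x hx => ?_) fun x y hx hy => by simp only [map_add, hx, hy]
  rw [sgn_of_mem V hx, sgn_of_mem W (f.deg _ _ hx), map_smul]

/-- A linear map out of a tensor product is a morphism if it is so on pure tensors. -/
def tensorHomMk {U V W : DGVec k} (f : U.carrier ⊗[k] V.carrier →ₗ[k] W.carrier)
    (deg : ∀ p q : ℤ, ∀ x ∈ U.gr p, ∀ y ∈ V.gr q, f (x ⊗ₜ y) ∈ W.gr (p + q))
    (comm : ∀ p q : ℤ, ∀ x ∈ U.gr p, ∀ y ∈ V.gr q,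
      f (U.d x ⊗ₜ y) + sg k p • f (x ⊗ₜ V.d y) = W.d (f (x ⊗ₜ y))) : tensor U V ⟶ W where
  lin := f
  deg n t ht := by
    change t ∈ tensorGr U V n at ht
    induction ht using Submodule.span_induction with
    | mem t ht =>
      obtain ⟨p, q, rfl, x, hx, y, hy, rfl⟩ := ht
      exact deg p q x hx y hy
    | zero => rw [map_zero]; exact zero_mem _
    | add s t hs ht hs' ht' => rw [map_add]; exact add_mem hs' ht'
    | smul a t ht ht' => rw [map_smul]; exact Submodule.smul_mem _ _ ht'
  comm t := by
    have : f ∘ₗ (tensor U V).d = W.d ∘ₗ f := by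
      refine tensor_lin_ext fun p q x hx y hy => ?_
      simp only [LinearMap.comp_apply]
      rw [tensor_d_tmul, map_add, sgn_of_mem U hx, ← TensorProduct.smul_tmul',
        map_smul]
      exact comm p q x hx y hy
    exact LinearMap.congr_fun this t

/-- The tensor product of two morphisms. -/
def tensorMap {V V' W W' : DGVec k} (f : V ⟶ V') (g : W ⟶ W') : tensor V W ⟶ tensor V' W' :=
  tensorHomMk (TensorProduct.map f.lin g.lin)
    (fun p q x hx y hy => tmul_mem rfl (f.deg p x hx) (g.deg q y hy))
    (fun p q x hx y hy => by
      simp only [TensorProduct.map_tmul]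
      rw [tensor_d_tmul, f.comm, g.comm, sgn_of_mem _ (f.deg p x hx), TensorProduct.smul_tmul'])

@[simp] lemma tensorMap_lin {V V' W W' : DGVec k} (f : V ⟶ V') (g : W ⟶ W') :
    (tensorMap f g).lin = TensorProduct.map f.lin g.lin := rfl

/-- The ground field in degree `0`. -/
abbrev unit (k : Type u) [Field k] : DGVec k where
  carrier := k
  gr n := if n = 0 then ⊤ else ⊥
  isInternal := by
    refine isInternal_of _ (LinearMap.toSpanSingleton k _
      (DirectSum.lof k ℤ (fun n => (if n = 0 then ⊤ else ⊥ : Submodule k k)) 0 ⟨1, by simp⟩))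
      ?_ ?_
    · ext; simp
    · intro n x hx
      by_cases h : n = 0
      · subst h
        rw [LinearMap.toSpanSingleton_apply, ← map_smul]
        congr 1; ext; simp
      · rw [if_neg h, Submodule.mem_bot] at hx
        subst hx
        rw [map_zero]; exact (map_zero _).symm
  d := 0
  d_mem _ _ _ := zero_mem _
  d_d _ := rfl

lemma mem_unit (x : k) : x ∈ (unit k).gr 0 := by simp [unit]

lemma eq_zero_of_mem_unit {n : ℤ} (hn : n ≠ 0) {x : k} (hx : x ∈ (unit k).gr n) : x = 0 := by
  simpa [unit, hn] using hx

/-- The associator of dg vector spaces. -/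
def assoc (U V W : DGVec k) : tensor (tensor U V) W ≅ tensor U (tensor V W) :=
  isoMk (TensorProduct.assoc k U.carrier V.carrier W.carrier)
    (by
      intro n t ht
      change t ∈ tensorGr (tensor U V) W n at ht
      induction ht using Submodule.span_induction with
      | mem t ht =>
        obtain ⟨p, q, rfl, x, hx, y, hy, rfl⟩ := ht
        change x ∈ tensorGr U V p at hx
        induction hx using Submodule.span_induction with
        | mem t ht =>
          obtain ⟨p, q, rfl, x, hx, z, hz, rfl⟩ := ht
          exact tmul_mem (by ring) hx (tmul_mem rfl hz hy)
        | zero => rw [TensorProduct.zero_tmul, map_zero]; exact zero_mem _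
        | add s t hs ht hs' ht' => rw [TensorProduct.add_tmul, map_add]; exact add_mem hs' ht'
        | smul a t ht ht' =>
          rw [← TensorProduct.smul_tmul', map_smul]; exact Submodule.smul_mem _ _ ht'
      | zero => rw [map_zero]; exact zero_mem _
      | add s t hs ht hs' ht' => rw [map_add]; exact add_mem hs' ht'
      | smul a t ht ht' => rw [map_smul]; exact Submodule.smul_mem _ _ ht')
    (by
      intro t
      have : (TensorProduct.assoc k U.carrier V.carrier W.carrier).toLinearMap ∘ₗ
          (tensor (tensor U V) W).d = (tensor U (tensor V W)).d ∘ₗ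
          (TensorProduct.assoc k U.carrier V.carrier W.carrier).toLinearMap := by
        apply TensorProduct.ext_threefold
        intro x y z
        have h : (tensor (tensor U V) W).d ((x ⊗ₜ[k] y) ⊗ₜ[k] z) =
            (U.d x ⊗ₜ[k] y + U.sgn x ⊗ₜ[k] V.d y) ⊗ₜ[k] z +
              (U.sgn x ⊗ₜ[k] V.sgn y) ⊗ₜ[k] W.d z := by
          rw [← tensor_sgn_tmul]; rfl
        have h' : (tensor U (tensor V W)).d (x ⊗ₜ[k] (y ⊗ₜ[k] z)) =
            U.d x ⊗ₜ[k] (y ⊗ₜ[k] z) + U.sgn x ⊗ₜ[k] (V.d y ⊗ₜ[k] z + V.sgn y ⊗ₜ[k] W.d z) := rfl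
        simp only [LinearMap.comp_apply, LinearEquiv.coe_coe]
        erw [h, h']
        simp [TensorProduct.add_tmul, TensorProduct.tmul_add, add_assoc]
      exact LinearMap.congr_fun this t)

/-- Scalar multiplication as a morphism `k ⊗ V ⟶ V`. -/
def lidHom (V : DGVec k) : tensor (unit k) V ⟶ V :=
  tensorHomMk (U := unit k) (TensorProduct.lid k V.carrier).toLinearMap
    (by
      intro p q a ha y hy
      by_cases h : p = 0
      · subst h; rw [zero_add]; exact Submodule.smul_mem _ _ hy
      · rw [eq_zero_of_mem_unit h ha, TensorProduct.zero_tmul, map_zero]; exact zero_mem _)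
    (by
      intro p q a ha y hy
      by_cases h : p = 0
      · subst h; simp
      · rw [eq_zero_of_mem_unit h ha]; simp)

/-- Scalar multiplication as a morphism `V ⊗ k ⟶ V`. -/
def ridHom (V : DGVec k) : tensor V (unit k) ⟶ V :=
  tensorHomMk (V := unit k) (TensorProduct.rid k V.carrier).toLinearMap
    (by
      intro p q y hy a ha
      by_cases h : q = 0
      · subst h; rw [add_zero]; exact Submodule.smul_mem _ _ hy
      · rw [eq_zero_of_mem_unit h ha, TensorProduct.tmul_zero, map_zero]; exact zero_mem _)
    (by intro p q y hy a ha; simp)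

/-- The monoidal structure on dg vector spaces given by the tensor product over `k`. -/
instance : MonoidalCategory (DGVec k) where
  tensorObj V W := tensor V W
  whiskerLeft V _ _ f := tensorMap (𝟙 V) f
  whiskerRight f W := tensorMap f (𝟙 W)
  tensorHom f g := tensorMap f g
  tensorUnit := unit k
  associator := assoc
  leftUnitor V := isoMk (TensorProduct.lid k V.carrier) (lidHom V).deg (lidHom V).comm
  rightUnitor V := isoMk (TensorProduct.rid k V.carrier) (ridHom V).deg (ridHom V).comm
  tensorHom_def f g := hom_ext (TensorProduct.ext' fun x y => rfl)
  id_tensorHom_id V W := hom_ext (TensorProduct.ext' fun x y => rfl)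
  tensorHom_comp_tensorHom f g h i := hom_ext (TensorProduct.ext' fun x y => rfl)
  whiskerLeft_id V W := hom_ext (TensorProduct.ext' fun x y => rfl)
  id_whiskerRight V W := hom_ext (TensorProduct.ext' fun x y => rfl)
  associator_naturality f g h := hom_ext (TensorProduct.ext_threefold fun x y z => rfl)
  leftUnitor_naturality f := hom_ext (TensorProduct.ext' fun a x => (map_smul f.lin a x).symm)
  rightUnitor_naturality f := hom_ext (TensorProduct.ext' fun x a => (map_smul f.lin a x).symm)
  pentagon U V W X := hom_ext (TensorProduct.ext_fourfold fun x y z w => rfl)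
  triangle V W := hom_ext (TensorProduct.ext_threefold fun x a y =>
    (TensorProduct.smul_tmul a x y).symm)

@[simp] lemma whiskerLeft_tmul (U : DGVec k) {V W : DGVec k} (f : V ⟶ W) (x : U.carrier)
    (y : V.carrier) : (U ◁ f).lin (x ⊗ₜ[k] y) = x ⊗ₜ[k] f.lin y := rfl

@[simp] lemma whiskerRight_tmul {U V : DGVec k} (f : U ⟶ V) (W : DGVec k) (x : U.carrier)
    (y : W.carrier) : (f ▷ W).lin (x ⊗ₜ[k] y) = f.lin x ⊗ₜ[k] y := rfl

@[simp] lemma tensorHom_tmul {U V U' V' : DGVec k} (f : U ⟶ U') (g : V ⟶ V') (x : U.carrier)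
    (y : V.carrier) : (f ⊗ₘ g).lin (x ⊗ₜ[k] y) = f.lin x ⊗ₜ[k] g.lin y := rfl

instance : MonoidalPreadditive (DGVec k) where
  whiskerLeft_zero := hom_ext (TensorProduct.ext' fun x y => TensorProduct.tmul_zero _ _)
  zero_whiskerRight := hom_ext (TensorProduct.ext' fun x y => TensorProduct.zero_tmul _ _)
  whiskerLeft_add f g := hom_ext (TensorProduct.ext' fun x y => TensorProduct.tmul_add _ _ _)
  add_whiskerRight f g := hom_ext (TensorProduct.ext' fun x y => TensorProduct.add_tmul _ _ _)

/-- The linear map `x ⊗ y ↦ (-1)^(|x| |y|) y ⊗ x`. -/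
def swapLin (V W : DGVec k) : V.carrier ⊗[k] W.carrier →ₗ[k] W.carrier ⊗[k] V.carrier :=
  TensorProduct.lift (V.lift fun p =>
    (LinearMap.lcomp k (W.carrier ⊗[k] V.carrier) (W.sgnPow p)) ∘ₗ
      (TensorProduct.mk k W.carrier V.carrier).flip ∘ₗ (V.gr p).subtype)

lemma swapLin_tmul {V W : DGVec k} {p q : ℤ} {x : V.carrier} {y : W.carrier} (hx : x ∈ V.gr p)
    (hy : y ∈ W.gr q) : swapLin V W (x ⊗ₜ y) = sg k (p * q) • (y ⊗ₜ[k] x) := by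
  rw [swapLin, TensorProduct.lift.tmul, lift_of_mem V _ hx]
  simp [sgnPow_of_mem W p hy, TensorProduct.smul_tmul']

/-- The braiding `x ⊗ y ↦ (-1)^(|x| |y|) y ⊗ x` as a morphism. -/
def swap (V W : DGVec k) : V ⊗ W ⟶ W ⊗ V :=
  tensorHomMk (W := tensor W V) (swapLin V W)
    (by
      intro p q x hx y hy
      rw [swapLin_tmul hx hy]
      exact Submodule.smul_mem _ _ (tmul_mem (by ring) hy hx))
    (by
      intro p q x hx y hy
      rw [swapLin_tmul hx hy, swapLin_tmul (V.d_mem _ _ hx) hy, swapLin_tmul hx (W.d_mem _ _ hy),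
        map_smul, tensor_d_tmul, sgn_of_mem W hy, smul_add, smul_smul, ← TensorProduct.smul_tmul',
        smul_smul, add_comm]
      congr 2
      · rw [mul_sub, sg_sub, mul_one, mul_comm, mul_assoc, sg_mul_self, mul_one]
      · rw [sub_mul, sg_sub, one_mul])

lemma swap_tmul {V W : DGVec k} {p q : ℤ} {x : V.carrier} {y : W.carrier} (hx : x ∈ V.gr p)
    (hy : y ∈ W.gr q) : (swap V W).lin (x ⊗ₜ[k] y) = sg k (p * q) • (y ⊗ₜ[k] x) :=
  swapLin_tmul hx hy

lemma swap_swap (V W : DGVec k) : swap V W ≫ swap W V = 𝟙 _ := by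
  refine hom_ext (tensor_lin_ext fun p q x hx y hy => ?_)
  rw [comp_lin, LinearMap.comp_apply, swap_tmul hx hy, map_smul, swap_tmul hy hx, smul_smul,
    mul_comm q p, sg_mul_self, one_smul]
  rfl

lemma tensor_lin_ext₃ {U V W : DGVec k} {M : Type*} [AddCommMonoid M] [Module k M]
    {f g : (U.carrier ⊗[k] V.carrier) ⊗[k] W.carrier →ₗ[k] M}
    (h : ∀ p q r : ℤ, ∀ x ∈ U.gr p, ∀ y ∈ V.gr q, ∀ z ∈ W.gr r,
      f ((x ⊗ₜ y) ⊗ₜ z) = g ((x ⊗ₜ y) ⊗ₜ z)) : f = g := by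
  apply TensorProduct.ext
  refine tensor_lin_ext fun p q x hx y hy => lin_ext fun r z hz => h p q r x hx y hy z hz

lemma tensor_lin_ext₃' {U V W : DGVec k} {M : Type*} [AddCommMonoid M] [Module k M]
    {f g : U.carrier ⊗[k] (V.carrier ⊗[k] W.carrier) →ₗ[k] M}
    (h : ∀ p q r : ℤ, ∀ x ∈ U.gr p, ∀ y ∈ V.gr q, ∀ z ∈ W.gr r,
      f (x ⊗ₜ (y ⊗ₜ z)) = g (x ⊗ₜ (y ⊗ₜ z))) : f = g := by
  apply TensorProduct.ext
  refine lin_ext fun p x hx => tensor_lin_ext fun q r y hy z hz => h p q r x hx y hy z hz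

lemma assoc_hom_tmul (U V W : DGVec k) (x : U.carrier) (y : V.carrier) (z : W.carrier) :
    (α_ U V W).hom.lin ((x ⊗ₜ[k] y) ⊗ₜ[k] z) = x ⊗ₜ[k] (y ⊗ₜ[k] z) := rfl

lemma assoc_inv_tmul (U V W : DGVec k) (x : U.carrier) (y : V.carrier) (z : W.carrier) :
    (α_ U V W).inv.lin (x ⊗ₜ[k] (y ⊗ₜ[k] z)) = (x ⊗ₜ[k] y) ⊗ₜ[k] z := rfl

/-- Dg vector spaces form a symmetric monoidal category with the Koszul sign rule. -/
instance : SymmetricCategory (DGVec k) where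
  braiding V W := ⟨swap V W, swap W V, swap_swap V W, swap_swap W V⟩
  braiding_naturality_right V W X f := by
    refine hom_ext (tensor_lin_ext fun p q x hx y hy => ?_)
    have h₁ : (swap V X).lin (x ⊗ₜ[k] f.lin y) = sg k (p * q) • (f.lin y ⊗ₜ[k] x) :=
      swap_tmul hx (f.deg _ _ hy)
    have h₂ : (f ▷ V).lin ((swap V W).lin (x ⊗ₜ[k] y)) = sg k (p * q) • (f.lin y ⊗ₜ[k] x) := by
      rw [swap_tmul hx hy]; exact map_smul _ _ _
    exact h₁.trans h₂.symm
  braiding_naturality_left {V X} f W := by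
    refine hom_ext (tensor_lin_ext fun p q x hx y hy => ?_)
    have h₁ : (swap X W).lin (f.lin x ⊗ₜ[k] y) = sg k (p * q) • (y ⊗ₜ[k] f.lin x) :=
      swap_tmul (f.deg _ _ hx) hy
    have h₂ : (W ◁ f).lin ((swap V W).lin (x ⊗ₜ[k] y)) = sg k (p * q) • (y ⊗ₜ[k] f.lin x) := by
      rw [swap_tmul hx hy]; exact map_smul _ _ _
    exact h₁.trans h₂.symm
  hexagon_forward U V W := by
    refine hom_ext (tensor_lin_ext₃ fun p q r x hx y hy z hz => ?_)
    have h₁ : (swap U (V ⊗ W)).lin (x ⊗ₜ[k] (y ⊗ₜ[k] z)) =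
        sg k (p * (q + r)) • ((y ⊗ₜ[k] z) ⊗ₜ[k] x) := swap_tmul hx (tmul_mem rfl hy hz)
    have h₂ : (α_ V W U).hom.lin ((swap U (V ⊗ W)).lin (x ⊗ₜ[k] (y ⊗ₜ[k] z))) =
        sg k (p * (q + r)) • (y ⊗ₜ[k] (z ⊗ₜ[k] x)) := by rw [h₁]; exact map_smul _ _ _
    have h₃ : (V ◁ swap U W).lin ((α_ V U W).hom.lin ((swap U V).lin (x ⊗ₜ[k] y) ⊗ₜ[k] z)) =
        sg k (p * q) • (y ⊗ₜ[k] (swap U W).lin (x ⊗ₜ[k] z)) := by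
      rw [swap_tmul hx hy, ← TensorProduct.smul_tmul']; rfl
    have h₄ : y ⊗ₜ[k] (swap U W).lin (x ⊗ₜ[k] z) = sg k (p * r) • (y ⊗ₜ[k] (z ⊗ₜ[k] x)) := by
      rw [swap_tmul hx hz]; exact TensorProduct.tmul_smul _ _ _
    rw [h₄, smul_smul, ← sg_add, ← mul_add] at h₃
    exact h₂.trans h₃.symm
  hexagon_reverse U V W := by
    refine hom_ext (tensor_lin_ext₃' fun p q r x hx y hy z hz => ?_)
    have h₁ : (swap (U ⊗ V) W).lin ((x ⊗ₜ[k] y) ⊗ₜ[k] z) =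
        sg k ((p + q) * r) • (z ⊗ₜ[k] (x ⊗ₜ[k] y)) := swap_tmul (tmul_mem rfl hx hy) hz
    have h₂ : (α_ W U V).inv.lin ((swap (U ⊗ V) W).lin ((x ⊗ₜ[k] y) ⊗ₜ[k] z)) =
        sg k ((p + q) * r) • ((z ⊗ₜ[k] x) ⊗ₜ[k] y) := by rw [h₁]; exact map_smul _ _ _
    have h₃ : (swap U W ▷ V).lin ((α_ U W V).inv.lin (x ⊗ₜ[k] (swap V W).lin (y ⊗ₜ[k] z))) =
        sg k (q * r) • ((swap U W).lin (x ⊗ₜ[k] z) ⊗ₜ[k] y) := by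
      rw [swap_tmul hy hz, TensorProduct.tmul_smul]
      exact map_smul ((α_ U W V).inv ≫ swap U W ▷ V).lin (sg k (q * r)) (x ⊗ₜ[k] (z ⊗ₜ[k] y))
    have h₄ : (swap U W).lin (x ⊗ₜ[k] z) ⊗ₜ[k] y = sg k (p * r) • ((z ⊗ₜ[k] x) ⊗ₜ[k] y) := by
      rw [swap_tmul hx hz]; rfl
    rw [h₄, smul_smul, ← sg_add, ← add_mul, add_comm q p] at h₃
    exact h₂.trans h₃.symm
  symmetry V W := swap_swap V W

section InternalHom

variable (V W : DGVec k)

/-- Linear maps of degree `n`. -/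
def homGr (n : ℤ) : Submodule k (V.carrier →ₗ[k] W.carrier) where
  carrier := {f | ∀ (p : ℤ) (x : V.carrier), x ∈ V.gr p → f x ∈ W.gr (p + n)}
  add_mem' hf hg p x hx := add_mem (hf p x hx) (hg p x hx)
  zero_mem' _ _ _ := zero_mem _
  smul_mem' a _ hf p x hx := Submodule.smul_mem _ a (hf p x hx)

/-- The space of finite sums of homogeneous linear maps. -/
def homSpace : Submodule k (V.carrier →ₗ[k] W.carrier) := ⨆ n, homGr V W n

variable {V W} in
lemma mem_homSpace {n : ℤ} {f : V.carrier →ₗ[k] W.carrier} (hf : f ∈ homGr V W n) :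
    f ∈ homSpace V W := Submodule.mem_iSup_of_mem n hf

/-- The part of degree `n` of the internal hom. -/
def ihomGr (n : ℤ) : Submodule k (homSpace V W) := (homGr V W n).comap (homSpace V W).subtype

/-- The differential `f ↦ d f - (-1)^|f| f d` on linear maps, using that `f` followed and preceded
by the sign operator is `(-1)^|f| f`. -/
def homD : (V.carrier →ₗ[k] W.carrier) →ₗ[k] (V.carrier →ₗ[k] W.carrier) where
  toFun f := W.d ∘ₗ f - W.sgn ∘ₗ f ∘ₗ V.sgn ∘ₗ V.d
  map_add' f g := by ext; simp; abel
  map_smul' a f := by ext; simp [smul_sub]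

variable {V W} in
lemma homD_of_mem {n : ℤ} {f : V.carrier →ₗ[k] W.carrier} (hf : f ∈ homGr V W n) :
    homD V W f = W.d ∘ₗ f - sg k n • f ∘ₗ V.d := by
  refine lin_ext fun p x hx => ?_
  simp only [homD, LinearMap.coe_mk, AddHom.coe_mk, LinearMap.sub_apply, LinearMap.comp_apply,
    LinearMap.smul_apply]
  have hd := V.d_mem _ _ hx
  rw [sgn_of_mem V hd, map_smul, map_smul, sgn_of_mem W (hf _ _ hd), smul_smul, sg_add,
    ← mul_assoc, sg_mul_self, one_mul]

variable {V W} in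
lemma homD_mem_homGr {n : ℤ} {f : V.carrier →ₗ[k] W.carrier} (hf : f ∈ homGr V W n) :
    homD V W f ∈ homGr V W (n - 1) := by
  rw [homD_of_mem hf]
  intro p x hx
  refine sub_mem ?_ (Submodule.smul_mem _ _ ?_)
  · rw [← add_sub_assoc]; exact W.d_mem _ _ (hf p x hx)
  · have := hf _ _ (V.d_mem _ _ hx)
    rwa [show p - 1 + n = p + (n - 1) by ring] at this

lemma homD_mem (f : V.carrier →ₗ[k] W.carrier) (hf : f ∈ homSpace V W) :
    homD V W f ∈ homSpace V W := by
  refine Submodule.iSup_induction _ (motive := fun f => homD V W f ∈ homSpace V W) hf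
    (fun n f hf => mem_homSpace (homD_mem_homGr hf)) (by rw [map_zero]; exact zero_mem _)
    (fun f g hf hg => by rw [map_add]; exact add_mem hf hg)

lemma ihom_isInternal : DirectSum.IsInternal (ihomGr V W) := by
  constructor
  · intro f f' hf
    refine DFinsupp.ext fun n => Subtype.ext (Subtype.ext ?_)
    refine lin_ext fun p x hx => ?_
    have key : ∀ g : ⨁ n, ihomGr V W n, W.proj (p + n)
        ((DirectSum.coeAddMonoidHom (ihomGr V W) g).1 x) = (g n).1.1 x := by
      intro g
      induction g using DirectSum.induction_on with
      | zero => simp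
      | of m g =>
        rw [DirectSum.coeAddMonoidHom_of, proj_of_mem W (show g.1.1 x ∈ W.gr (p + m) from g.2 p x hx),
          DirectSum.coe_of_apply]
        by_cases h : m = n
        · subst h; simp
        · rw [if_neg (by simpa using h), if_neg h]; rfl
      | add g h hg hh =>
        rw [map_add, DirectSum.add_apply, Submodule.coe_add, Submodule.coe_add,
          Submodule.coe_add, LinearMap.add_apply, LinearMap.add_apply, map_add, hg, hh]
    have h := key f
    rw [hf, key f'] at h
    exact h.symm
  · rintro ⟨f, hf⟩
    refine Submodule.iSup_induction' (homGr V W)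
      (motive := fun f hf => ∃ g, DirectSum.coeAddMonoidHom (ihomGr V W) g =
        (⟨f, hf⟩ : homSpace V W)) ?_ ?_ ?_ hf
    · intro n f hf
      exact ⟨DirectSum.of (fun n => ihomGr V W n) n ⟨⟨f, mem_homSpace hf⟩, hf⟩,
        DirectSum.coeAddMonoidHom_of _ _ _⟩
    · exact ⟨0, map_zero _⟩
    · rintro f g hf hg ⟨f', hf'⟩ ⟨g', hg'⟩
      exact ⟨f' + g', (map_add _ f' g').trans (by rw [hf', hg']; rfl)⟩

/-- The internal hom of dg vector spaces. -/
abbrev internalHom : DGVec k where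
  carrier := homSpace V W
  gr := ihomGr V W
  isInternal := ihom_isInternal V W
  d := (homD V W).restrict (homD_mem V W)
  d_mem n f hf := homD_mem_homGr hf
  d_d f := by
    apply Subtype.ext
    ext x
    simp [homD, W.d_d, V.d_d, sgn_d, map_sub]

end InternalHom

variable {U V W : DGVec k}

/-- The evaluation `f ⊗ x ↦ f x`. -/
def evHom (V W : DGVec k) : internalHom V W ⊗ V ⟶ W :=
  tensorHomMk (U := internalHom V W) (TensorProduct.lift (homSpace V W).subtype)
    (by
      intro p q f hf x hx
      rw [add_comm]
      exact hf q x hx)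
    (by
      intro p q f hf x hx
      have : ((internalHom V W).d f).1 = W.d ∘ₗ f.1 - sg k p • f.1 ∘ₗ V.d := homD_of_mem hf
      simp [this])

/-- Currying: `u ↦ (x ↦ f (u ⊗ x))`. -/
def curryHom (f : U ⊗ V ⟶ W) : U ⟶ internalHom V W where
  lin := LinearMap.codRestrict (homSpace V W) (TensorProduct.curry f.lin) (fun u => by
    refine U.induction u (fun n u hu => mem_homSpace (n := n) fun p x hx => ?_)
      fun u v hu hv => by rw [map_add]; exact add_mem hu hv
    rw [add_comm]
    exact f.deg _ _ (tmul_mem rfl hu hx))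
  deg n u hu := fun p x hx => by
    rw [add_comm]
    exact f.deg _ _ (tmul_mem rfl hu hx)
  comm u := by
    apply Subtype.ext
    refine U.induction u (fun n u hu => ?_) fun u v hu hv => by
      simp only [map_add, Submodule.coe_add, hu, hv]
    have h : TensorProduct.curry f.lin u ∈ homGr V W n := fun p x hx => by
      rw [add_comm]
      exact f.deg _ _ (tmul_mem rfl hu hx)
    change TensorProduct.curry f.lin (U.d u) = homD V W (TensorProduct.curry f.lin u)
    rw [homD_of_mem h]
    ext x
    have h2 := f.comm (u ⊗ₜ[k] x)
    have h3 : (U ⊗ V).d (u ⊗ₜ[k] x) = U.d u ⊗ₜ[k] x + U.sgn u ⊗ₜ[k] V.d x := rfl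
    rw [h3, map_add, sgn_of_mem U hu, ← TensorProduct.smul_tmul', map_smul] at h2
    simp only [LinearMap.sub_apply, LinearMap.comp_apply, LinearMap.smul_apply]
    exact eq_sub_of_add_eq h2

/-- The tensor-hom adjunction for dg vector spaces. -/
def tensorHomAdj (V : DGVec k) : tensorRight V ⊣ (Adjunction.rightAdjointOfEquiv
    (F := tensorRight V) (G_obj := fun W => internalHom V W) (fun U W =>
      { toFun := fun f => curryHom f
        invFun := fun g => (g ▷ V) ≫ evHom V W
        left_inv := fun f => hom_ext (TensorProduct.ext' fun u x => rfl)
        right_inv := fun g => rfl }) (fun _ _ _ _ _ => rfl)) :=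
  Adjunction.adjunctionOfEquivRight _ _

/-- Dg vector spaces form a closed symmetric monoidal category. -/
instance : MonoidalClosed (DGVec k) where
  closed V := 
    { rightAdj := _
      adj := (tensorHomAdj V).ofNatIsoLeft (BraidedCategory.tensorLeftIsoTensorRight V).symm }

end DGVec

section SymmetricMonoidal

variable {𝒱 : Type w} [Category.{v} 𝒱] [MonoidalCategory 𝒱] [SymmetricCategory 𝒱]

/-- The cyclic permutation `(x ⊗ y) ⊗ z ↦ ± (y ⊗ z) ⊗ x`. -/
def cyc (X : 𝒱) : (X ⊗ X) ⊗ X ⟶ (X ⊗ X) ⊗ X := (α_ X X X).hom ≫ (β_ X (X ⊗ X)).hom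

lemma tensorμ_braiding (A B X Y : 𝒱) :
    tensorμ A B X Y ≫ (β_ (A ⊗ X) (B ⊗ Y)).hom =
      ((β_ A B).hom ⊗ₘ (β_ X Y).hom) ≫ tensorμ B A Y X := by
  simp [tensorμ, SymmetricCategory.braiding_swap_eq_inv_braiding X B,
    MonoidalCategory.tensorHom_def]

/-- The comultiplication of the tensor product of two coalgebras. -/
def tensorComul {X Y : 𝒱} (Δ : X ⟶ X ⊗ X) (Δ' : Y ⟶ Y ⊗ Y) :
    X ⊗ Y ⟶ (X ⊗ Y) ⊗ (X ⊗ Y) :=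
  (Δ ⊗ₘ Δ') ≫ tensorμ X X Y Y

lemma tensorComul_coassoc {X Y : 𝒱} (Δ : X ⟶ X ⊗ X) (Δ' : Y ⟶ Y ⊗ Y)
    (h : Δ ≫ Δ ▷ X ≫ (α_ X X X).hom = Δ ≫ X ◁ Δ)
    (h' : Δ' ≫ Δ' ▷ Y ≫ (α_ Y Y Y).hom = Δ' ≫ Y ◁ Δ') :
    tensorComul Δ Δ' ≫ tensorComul Δ Δ' ▷ (X ⊗ Y) ≫ (α_ _ _ _).hom =
      tensorComul Δ Δ' ≫ (X ⊗ Y) ◁ tensorComul Δ Δ' := by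
  have e₁ : tensorμ X X Y Y ≫ (Δ ⊗ₘ Δ') ▷ (X ⊗ Y) =
      (Δ ▷ X ⊗ₘ Δ' ▷ Y) ≫ tensorμ (X ⊗ X) X (Y ⊗ Y) Y := by
    have := tensorμ_natural Δ (𝟙 X) Δ' (𝟙 Y)
    simpa using this.symm
  have e₂ : tensorμ X X Y Y ≫ (X ⊗ Y) ◁ (Δ ⊗ₘ Δ') =
      (X ◁ Δ ⊗ₘ Y ◁ Δ') ≫ tensorμ X (X ⊗ X) Y (Y ⊗ Y) := by
    have := tensorμ_natural (𝟙 X) Δ (𝟙 Y) Δ'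
    simpa using this.symm
  have e₃ := associator_monoidal X X X Y Y Y
  simp only [tensorComul, comp_whiskerRight, MonoidalCategory.whiskerLeft_comp, Category.assoc]
  rw [reassoc_of% e₁, reassoc_of% e₂, e₃, tensorHom_comp_tensorHom_assoc,
    tensorHom_comp_tensorHom_assoc, tensorHom_comp_tensorHom_assoc, Category.assoc,
    Category.assoc, h, h']

lemma tensorComul_cocomm {X Y : 𝒱} (Δ : X ⟶ X ⊗ X) (Δ' : Y ⟶ Y ⊗ Y)
    (h : Δ ≫ (β_ X X).hom = Δ) (h' : Δ' ≫ (β_ Y Y).hom = Δ') :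
    tensorComul Δ Δ' ≫ (β_ _ _).hom = tensorComul Δ Δ' := by
  rw [tensorComul, Category.assoc, tensorμ_braiding, tensorHom_comp_tensorHom_assoc, h, h']

lemma tensorComul_map {X Y X' Y' : 𝒱} {Δ : X ⟶ X ⊗ X} {Δ' : Y ⟶ Y ⊗ Y} {Γ : X' ⟶ X' ⊗ X'}
    {Γ' : Y' ⟶ Y' ⊗ Y'} {f : X ⟶ X'} {g : Y ⟶ Y'} (hf : f ≫ Γ = Δ ≫ (f ⊗ₘ f))
    (hg : g ≫ Γ' = Δ' ≫ (g ⊗ₘ g)) :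
    (f ⊗ₘ g) ≫ tensorComul Γ Γ' = tensorComul Δ Δ' ≫ ((f ⊗ₘ g) ⊗ₘ (f ⊗ₘ g)) := by
  rw [tensorComul, tensorComul, tensorHom_comp_tensorHom_assoc, hf, hg,
    ← tensorHom_comp_tensorHom, Category.assoc, Category.assoc, tensorμ_natural]

lemma associator_tensorComul {X Y Z : 𝒱} (Δ : X ⟶ X ⊗ X) (Δ' : Y ⟶ Y ⊗ Y) (Γ : Z ⟶ Z ⊗ Z) :
    (α_ X Y Z).hom ≫ tensorComul Δ (tensorComul Δ' Γ) =
      tensorComul (tensorComul Δ Δ') Γ ≫ ((α_ X Y Z).hom ⊗ₘ (α_ X Y Z).hom) := by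
  have h := tensor_associativity X X Y Y Z Z
  have h₁ : (tensorComul Δ Δ' ⊗ₘ Γ) = ((Δ ⊗ₘ Δ') ⊗ₘ Γ) ≫ tensorμ X X Y Y ▷ (Z ⊗ Z) := by
    rw [tensorComul, ← tensorHom_id, tensorHom_comp_tensorHom, Category.comp_id]
  have h₂ : (Δ ⊗ₘ tensorComul Δ' Γ) = (Δ ⊗ₘ (Δ' ⊗ₘ Γ)) ≫ (X ⊗ X) ◁ tensorμ Y Y Z Z := by
    rw [tensorComul, ← id_tensorHom, tensorHom_comp_tensorHom, Category.comp_id]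
  change (α_ X Y Z).hom ≫ (Δ ⊗ₘ tensorComul Δ' Γ) ≫ tensorμ X X (Y ⊗ Z) (Y ⊗ Z) =
    ((tensorComul Δ Δ' ⊗ₘ Γ) ≫ tensorμ (X ⊗ Y) (X ⊗ Y) Z Z) ≫ _
  rw [h₁, h₂]
  simp only [Category.assoc]
  rw [h, associator_naturality_assoc]

lemma braiding_tensorμ (X X' Y Y' : 𝒱) :
    (β_ (X ⊗ X') (Y ⊗ Y')).hom ≫ tensorμ Y Y' X X' =
      tensorμ X X' Y Y' ≫ ((β_ X Y).hom ⊗ₘ (β_ X' Y').hom) := by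
  have e : Y ◁ (β_ X Y').hom ▷ X' ≫ Y ◁ (β_ Y' X).hom ▷ X' = 𝟙 _ := by
    rw [← MonoidalCategory.whiskerLeft_comp, ← comp_whiskerRight, SymmetricCategory.symmetry]
    simp
  simp [reassoc_of% e, tensorμ, SymmetricCategory.braiding_swap_eq_inv_braiding Y X',
    SymmetricCategory.braiding_swap_eq_inv_braiding Y X,
    MonoidalCategory.tensorHom_def]

lemma braiding_tensorComul {X Y : 𝒱} (Δ : X ⟶ X ⊗ X) (Δ' : Y ⟶ Y ⊗ Y) :
    (β_ X Y).hom ≫ tensorComul Δ' Δ = tensorComul Δ Δ' ≫ ((β_ X Y).hom ⊗ₘ (β_ X Y).hom) := by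
  rw [tensorComul, tensorComul, Category.assoc, ← braiding_tensorμ,
    BraidedCategory.braiding_naturality_assoc]

variable [MonoidalClosed 𝒱]

/-- The convolution pairing `f ⊗ g ↦ (f ⊗ g) ∘ Δ` on internal homs out of `C`. -/
def convPairing {C : 𝒱} (Δ : C ⟶ C ⊗ C) (X Y : 𝒱) :
    (ihom C).obj X ⊗ (ihom C).obj Y ⟶ (ihom C).obj (X ⊗ Y) :=
  MonoidalClosed.curry (Δ ▷ _ ≫ tensorμ C C _ _ ≫ ((ihom.ev C).app X ⊗ₘ (ihom.ev C).app Y))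

section

variable {C : 𝒱} (Δ : C ⟶ C ⊗ C)

lemma uncurry_convPairing (X Y : 𝒱) : MonoidalClosed.uncurry (convPairing Δ X Y) =
    Δ ▷ _ ≫ tensorμ C C _ _ ≫ ((ihom.ev C).app X ⊗ₘ (ihom.ev C).app Y) :=
  MonoidalClosed.uncurry_curry _

lemma uncurry_tensorHom_convPairing {X Y P Q : 𝒱} (f : P ⟶ (ihom C).obj X)
    (g : Q ⟶ (ihom C).obj Y) :
    MonoidalClosed.uncurry ((f ⊗ₘ g) ≫ convPairing Δ X Y) =
      Δ ▷ _ ≫ tensorμ C C P Q ≫ (MonoidalClosed.uncurry f ⊗ₘ MonoidalClosed.uncurry g) := by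
  rw [MonoidalClosed.uncurry_natural_left, uncurry_convPairing, whisker_exchange_assoc,
    tensorμ_natural_right_assoc, MonoidalClosed.uncurry_eq, MonoidalClosed.uncurry_eq,
    tensorHom_comp_tensorHom]

lemma convPairing_natural {X Y X' Y' : 𝒱} (f : X ⟶ X') (g : Y ⟶ Y') :
    ((ihom C).map f ⊗ₘ (ihom C).map g) ≫ convPairing Δ X' Y' =
      convPairing Δ X Y ≫ (ihom C).map (f ⊗ₘ g) := by
  apply MonoidalClosed.uncurry_injective
  rw [uncurry_tensorHom_convPairing, MonoidalClosed.uncurry_natural_right, uncurry_convPairing,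
    MonoidalClosed.uncurry_ihom_map, MonoidalClosed.uncurry_ihom_map, ← tensorHom_comp_tensorHom]
  simp only [Category.assoc]

lemma convPairing_braiding (h : Δ ≫ (β_ C C).hom = Δ) (X Y : 𝒱) :
    (β_ _ _).hom ≫ convPairing Δ Y X = convPairing Δ X Y ≫ (ihom C).map (β_ X Y).hom := by
  apply MonoidalClosed.uncurry_injective
  rw [MonoidalClosed.uncurry_natural_left, MonoidalClosed.uncurry_natural_right,
    uncurry_convPairing, uncurry_convPairing]
  have h₁ : ((ihom.ev C).app X ⊗ₘ (ihom.ev C).app Y) ≫ (β_ X Y).hom =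
      (β_ _ _).hom ≫ ((ihom.ev C).app Y ⊗ₘ (ihom.ev C).app X) :=
    BraidedCategory.braiding_naturality _ _
  simp only [Category.assoc]
  rw [h₁, whisker_exchange_assoc]
  conv_lhs => rw [← h, comp_whiskerRight_assoc]
  congr 1
  have h₂ := tensorμ_braiding C C ((ihom C).obj X) ((ihom C).obj Y)
  rw [MonoidalCategory.tensorHom_def, Category.assoc] at h₂
  exact ((reassoc_of% h₂) ((ihom.ev C).app Y ⊗ₘ (ihom.ev C).app X)).symm

lemma convPairing_assoc (h : Δ ≫ Δ ▷ C ≫ (α_ C C C).hom = Δ ≫ C ◁ Δ) (X Y Z : 𝒱) :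
    convPairing Δ X Y ▷ _ ≫ convPairing Δ (X ⊗ Y) Z ≫ (ihom C).map (α_ X Y Z).hom =
      (α_ _ _ _).hom ≫ _ ◁ convPairing Δ Y Z ≫ convPairing Δ X (Y ⊗ Z) := by
  apply MonoidalClosed.uncurry_injective
  have e₁ : MonoidalClosed.uncurry (convPairing Δ X Y ▷ ((ihom C).obj Z) ≫
      convPairing Δ (X ⊗ Y) Z) = Δ ▷ _ ≫ tensorμ C C _ _ ≫
        ((Δ ▷ _ ≫ tensorμ C C _ _ ≫ ((ihom.ev C).app X ⊗ₘ (ihom.ev C).app Y)) ⊗ₘ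
          (ihom.ev C).app Z) := by
    rw [← tensorHom_id, uncurry_tensorHom_convPairing, MonoidalClosed.uncurry_id_eq_ev,
      uncurry_convPairing]
  have e₂ : MonoidalClosed.uncurry (((ihom C).obj X) ◁ convPairing Δ Y Z ≫
      convPairing Δ X (Y ⊗ Z)) = Δ ▷ _ ≫ tensorμ C C _ _ ≫ ((ihom.ev C).app X ⊗ₘ
        (Δ ▷ _ ≫ tensorμ C C _ _ ≫ ((ihom.ev C).app Y ⊗ₘ (ihom.ev C).app Z))) := by
    rw [← id_tensorHom, uncurry_tensorHom_convPairing, MonoidalClosed.uncurry_id_eq_ev,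
      uncurry_convPairing]
  rw [← Category.assoc, MonoidalClosed.uncurry_natural_right, e₁,
    MonoidalClosed.uncurry_natural_left, e₂]
  set H := (ihom C).obj X
  set K := (ihom C).obj Y
  set L := (ihom C).obj Z
  set a : C ⊗ H ⟶ X := (ihom.ev C).app X
  set b : C ⊗ K ⟶ Y := (ihom.ev C).app Y
  set c : C ⊗ L ⟶ Z := (ihom.ev C).app Z
  have h₁ : ((Δ ▷ (H ⊗ K) ≫ tensorμ C C H K ≫ (a ⊗ₘ b)) ⊗ₘ c) =
      ((Δ ▷ (H ⊗ K)) ▷ (C ⊗ L)) ≫ (tensorμ C C H K ▷ (C ⊗ L)) ≫ ((a ⊗ₘ b) ⊗ₘ c) := by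
    simp only [← tensorHom_id, tensorHom_comp_tensorHom, Category.id_comp]
  have h₂ : (a ⊗ₘ (Δ ▷ (K ⊗ L) ≫ tensorμ C C K L ≫ (b ⊗ₘ c))) =
      ((C ⊗ H) ◁ (Δ ▷ (K ⊗ L))) ≫ ((C ⊗ H) ◁ tensorμ C C K L) ≫ (a ⊗ₘ (b ⊗ₘ c)) := by
    simp only [← id_tensorHom, tensorHom_comp_tensorHom, Category.id_comp]
  have h₃ : tensorμ C C (H ⊗ K) L ≫ ((Δ ▷ (H ⊗ K)) ▷ (C ⊗ L)) =
      (Δ ▷ C) ▷ _ ≫ tensorμ (C ⊗ C) C (H ⊗ K) L := by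
    have := tensorμ_natural Δ (𝟙 C) (𝟙 (H ⊗ K)) (𝟙 L)
    simpa using this.symm
  have h₄ : tensorμ C C H (K ⊗ L) ≫ ((C ⊗ H) ◁ (Δ ▷ (K ⊗ L))) =
      (C ◁ Δ) ▷ _ ≫ tensorμ C (C ⊗ C) H (K ⊗ L) := by
    have := tensorμ_natural (𝟙 C) Δ (𝟙 H) (𝟙 (K ⊗ L))
    simpa using this.symm
  have h₅ := associator_monoidal C C C H K L
  rw [h₁, h₂]
  simp only [Category.assoc]
  rw [reassoc_of% h₃, reassoc_of% h₄, associator_naturality, reassoc_of% h₅,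
    MonoidalCategory.tensorHom_def, Category.assoc, whisker_exchange_assoc,
    whisker_exchange_assoc]
  have h₆ : Δ ▷ ((H ⊗ K) ⊗ L) ≫ (Δ ▷ C) ▷ ((H ⊗ K) ⊗ L) ≫ (α_ C C C).hom ▷ ((H ⊗ K) ⊗ L) =
      Δ ▷ ((H ⊗ K) ⊗ L) ≫ (C ◁ Δ) ▷ ((H ⊗ K) ⊗ L) := by
    simp only [← comp_whiskerRight, h]
  exact (reassoc_of% h₆) _

end

lemma convPairing_pre {C D : 𝒱} (Δ : C ⟶ C ⊗ C) (Δ' : D ⟶ D ⊗ D) (f : C ⟶ D)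
    (h : f ≫ Δ' = Δ ≫ (f ⊗ₘ f)) (X Y : 𝒱) :
    convPairing Δ' X Y ≫ (MonoidalClosed.pre f).app (X ⊗ Y) =
      ((MonoidalClosed.pre f).app X ⊗ₘ (MonoidalClosed.pre f).app Y) ≫ convPairing Δ X Y := by
  apply MonoidalClosed.uncurry_injective
  rw [uncurry_tensorHom_convPairing, MonoidalClosed.uncurry_pre_app, uncurry_convPairing,
    ← comp_whiskerRight_assoc, h, comp_whiskerRight_assoc, tensorμ_natural_left_assoc,
    MonoidalClosed.uncurry_pre, MonoidalClosed.uncurry_pre, tensorHom_comp_tensorHom]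

end SymmetricMonoidal

section Lie

variable (𝒱 : Type w) [Category.{v} 𝒱] [MonoidalCategory 𝒱] [SymmetricCategory 𝒱] [Preadditive 𝒱]

/-- A Lie algebra object: an object with a bracket satisfying antisymmetry and the Jacobi identity
`[[x, y], z] ± [[y, z], x] ± [[z, x], y] = 0`. -/
structure LieObj where
  X : 𝒱
  bracket : X ⊗ X ⟶ X
  antisymm : (β_ X X).hom ≫ bracket = -bracket
  jacobi : bracket ▷ X ≫ bracket + cyc X ≫ bracket ▷ X ≫ bracket +
    cyc X ≫ cyc X ≫ bracket ▷ X ≫ bracket = 0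

namespace LieObj

variable {𝒱}

/-- Morphisms of Lie algebra objects preserve the bracket. -/
@[ext]
structure Hom (L M : LieObj 𝒱) where
  hom : L.X ⟶ M.X
  bracket_hom : L.bracket ≫ hom = (hom ⊗ₘ hom) ≫ M.bracket

instance : Category (LieObj 𝒱) where
  Hom := Hom
  id L := ⟨𝟙 L.X, by simp⟩
  comp f g := ⟨f.hom ≫ g.hom, by
    rw [← Category.assoc, f.bracket_hom, Category.assoc, g.bracket_hom, tensorHom_comp_tensorHom_assoc]⟩

@[ext]
lemma hom_ext {L M : LieObj 𝒱} {f g : L ⟶ M} (h : f.hom = g.hom) : f = g := Hom.ext h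

@[simp] lemma id_hom (L : LieObj 𝒱) : Hom.hom (𝟙 L) = 𝟙 L.X := rfl

@[simp] lemma comp_hom {L M N : LieObj 𝒱} (f : L ⟶ M) (g : M ⟶ N) :
    (f ≫ g).hom = f.hom ≫ g.hom := rfl

variable (𝒱) in
/-- The underlying object of a Lie algebra object. -/
@[simps]
def forget : LieObj 𝒱 ⥤ 𝒱 where
  obj L := L.X
  map f := f.hom

variable [MonoidalPreadditive 𝒱] [MonoidalClosed 𝒱]

/-- The convolution Lie algebra `[C, L]` of a cocommutative coassociative `C`: its bracket sends
`f ⊗ g` to the composite of `Δ : C ⟶ C ⊗ C`, `f ⊗ g` and the bracket of `L`. -/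
abbrev convolution {C : 𝒱} (Δ : C ⟶ C ⊗ C) (coassoc : Δ ≫ Δ ▷ C ≫ (α_ C C C).hom = Δ ≫ C ◁ Δ)
    (cocomm : Δ ≫ (β_ C C).hom = Δ) (L : LieObj 𝒱) : LieObj 𝒱 where
  X := (ihom C).obj L.X
  bracket := convPairing Δ L.X L.X ≫ (ihom C).map L.bracket
  antisymm := by
    have : (ihom C).Additive := (ihom.adjunction C).right_adjoint_additive
    rw [← Category.assoc, convPairing_braiding Δ cocomm, Category.assoc, ← Functor.map_comp,
      L.antisymm, Functor.map_neg, Preadditive.comp_neg]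
  jacobi := by
    have : (ihom C).Additive := (ihom.adjunction C).right_adjoint_additive
    set H := (ihom C).obj L.X with hH
    set m := convPairing Δ L.X L.X ▷ H ≫ convPairing Δ (L.X ⊗ L.X) L.X with hm
    have h₁ : (convPairing Δ L.X L.X ≫ (ihom C).map L.bracket) ▷ H ≫ convPairing Δ L.X L.X ≫
        (ihom C).map L.bracket = m ≫ (ihom C).map (L.bracket ▷ L.X ≫ L.bracket) := by
      have := convPairing_natural Δ L.bracket (𝟙 L.X)
      rw [CategoryTheory.Functor.map_id, tensorHom_id, tensorHom_id] at this
      rw [comp_whiskerRight, Category.assoc, reassoc_of% this, hm, Category.assoc,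
        Functor.map_comp]
    have h₂ : cyc H ≫ m = m ≫ (ihom C).map (cyc L.X) := by
      have e₁ := convPairing_assoc Δ coassoc L.X L.X L.X
      have e₂ := convPairing_braiding Δ cocomm L.X (L.X ⊗ L.X)
      have e₃ : (β_ H (H ⊗ H)).hom ≫ convPairing Δ L.X L.X ▷ H =
        H ◁ convPairing Δ L.X L.X ≫ (β_ H _).hom :=
        (BraidedCategory.braiding_naturality_right H (convPairing Δ L.X L.X)).symm
      rw [cyc, cyc, hm, Functor.map_comp, Category.assoc, Category.assoc, reassoc_of% e₃,
        e₂, reassoc_of% e₁]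
    have h₃ : cyc H ≫ m ≫ (ihom C).map (L.bracket ▷ L.X ≫ L.bracket) =
        m ≫ (ihom C).map (cyc L.X ≫ L.bracket ▷ L.X ≫ L.bracket) := by
      rw [reassoc_of% h₂, ← Functor.map_comp]
    have h₄ : cyc H ≫ m ≫ (ihom C).map (cyc L.X ≫ L.bracket ▷ L.X ≫ L.bracket) =
        m ≫ (ihom C).map (cyc L.X ≫ cyc L.X ≫ L.bracket ▷ L.X ≫ L.bracket) := by
      rw [reassoc_of% h₂, ← Functor.map_comp]
    rw [h₁, h₃, h₄, ← Preadditive.comp_add, ← Preadditive.comp_add,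
      ← Functor.map_add, ← Functor.map_add, L.jacobi, Functor.map_zero, Limits.comp_zero]

/-- Functoriality of the convolution Lie algebra in the Lie algebra, by postcomposition. -/
def convolutionMap {C : 𝒱} (Δ : C ⟶ C ⊗ C) (h₁ : Δ ≫ Δ ▷ C ≫ (α_ C C C).hom = Δ ≫ C ◁ Δ)
    (h₂ : Δ ≫ (β_ C C).hom = Δ) {L M : LieObj 𝒱} (f : L ⟶ M) :
    convolution Δ h₁ h₂ L ⟶ convolution Δ h₁ h₂ M where
  hom := (ihom C).map f.hom
  bracket_hom := by
    have h := convPairing_natural Δ f.hom f.hom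
    rw [reassoc_of% h, Category.assoc, ← Functor.map_comp, ← Functor.map_comp, f.bracket_hom]

/-- Functoriality of the convolution Lie algebra in the coalgebra, by precomposition. -/
def convolutionPre {C D : 𝒱} {Δ : C ⟶ C ⊗ C} {Δ' : D ⟶ D ⊗ D}
    {h₁ : Δ ≫ Δ ▷ C ≫ (α_ C C C).hom = Δ ≫ C ◁ Δ} {h₂ : Δ ≫ (β_ C C).hom = Δ}
    {h₁' : Δ' ≫ Δ' ▷ D ≫ (α_ D D D).hom = Δ' ≫ D ◁ Δ'} {h₂' : Δ' ≫ (β_ D D).hom = Δ'}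
    (f : C ⟶ D) (h : f ≫ Δ' = Δ ≫ (f ⊗ₘ f)) (L : LieObj 𝒱) :
    convolution Δ' h₁' h₂' L ⟶ convolution Δ h₁ h₂ L where
  hom := (MonoidalClosed.pre f).app L.X
  bracket_hom := by
    have h' := convPairing_pre Δ Δ' f h L.X L.X
    rw [← reassoc_of% h', Category.assoc, NatTrans.naturality]

end LieObj

end Lie

section Iterated

variable {𝒱 : Type w} [Category.{v} 𝒱] [MonoidalCategory 𝒱]

/-- The tensor power with `n + 1` factors. -/
@[reducible]
def tensorPow (X : 𝒱) : ℕ → 𝒱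
  | 0 => X
  | n + 1 => tensorPow X n ⊗ X

/-- The iterated comultiplication `Δ^n` with values in the tensor power with `n + 1` factors. -/
def iterComul {X : 𝒱} (Δ : X ⟶ X ⊗ X) : (n : ℕ) → (X ⟶ tensorPow X n)
  | 0 => 𝟙 X
  | n + 1 => Δ ≫ iterComul Δ n ▷ X

lemma iterComul_succ {X : 𝒱} (Δ : X ⟶ X ⊗ X) (n : ℕ) :
    iterComul Δ (n + 1) = Δ ≫ iterComul Δ n ▷ X := rfl

lemma exists_iterComul_succ {X : 𝒱} (Δ : X ⟶ X ⊗ X) (n : ℕ) :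
    ∃ t : tensorPow X n ⟶ tensorPow X (n + 1), iterComul Δ (n + 1) = iterComul Δ n ≫ t := by
  induction n with
  | zero => exact ⟨Δ, by change Δ ≫ 𝟙 X ▷ X = 𝟙 X ≫ Δ; simp⟩
  | succ n ih =>
    obtain ⟨t, ht⟩ := ih
    refine ⟨t ▷ X, ?_⟩
    change Δ ≫ iterComul Δ (n + 1) ▷ X = (Δ ≫ iterComul Δ n ▷ X) ≫ t ▷ X
    rw [ht, comp_whiskerRight, Category.assoc]

lemma exists_iterComul_tensor [BraidedCategory 𝒱] {X Y : 𝒱} (Δ : X ⟶ X ⊗ X) (Δ' : Y ⟶ Y ⊗ Y)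
    (n : ℕ) : ∃ s : tensorPow X n ⊗ tensorPow Y n ⟶ tensorPow (X ⊗ Y) n,
      iterComul ((Δ ⊗ₘ Δ') ≫ tensorμ X X Y Y) n = (iterComul Δ n ⊗ₘ iterComul Δ' n) ≫ s := by
  induction n with
  | zero => exact ⟨𝟙 _, by change 𝟙 (X ⊗ Y) = (𝟙 X ⊗ₘ 𝟙 Y) ≫ 𝟙 _; simp⟩
  | succ n ih =>
    obtain ⟨s, hs⟩ := ih
    refine ⟨tensorμ _ _ _ _ ≫ s ▷ (X ⊗ Y), ?_⟩
    have h := tensorμ_natural (iterComul Δ n) (𝟙 X) (iterComul Δ' n) (𝟙 Y)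
    change ((Δ ⊗ₘ Δ') ≫ tensorμ X X Y Y) ≫
        iterComul ((Δ ⊗ₘ Δ') ≫ tensorμ X X Y Y) n ▷ (X ⊗ Y) =
      ((Δ ≫ iterComul Δ n ▷ X) ⊗ₘ (Δ' ≫ iterComul Δ' n ▷ Y)) ≫ tensorμ _ _ _ _ ≫ s ▷ (X ⊗ Y)
    rw [hs, comp_whiskerRight, Category.assoc, ← tensorHom_comp_tensorHom, Category.assoc]
    simp only [tensorHom_id, id_whiskerRight] at h
    rw [reassoc_of% h]

end Iterated

/-- A conilpotent cocommutative coassociative non-counital dg coalgebra: every element is killed by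
some iterated comultiplication. -/
structure cCDGA (k : Type u) [Field k] where
  X : DGVec k
  comul : X ⟶ X ⊗ X
  coassoc : comul ≫ comul ▷ X ≫ (α_ X X X).hom = comul ≫ X ◁ comul
  cocomm : comul ≫ (β_ X X).hom = comul
  conilp : ∀ x : X.carrier, ∃ n : ℕ, (iterComul comul n).lin x = 0

namespace cCDGA

variable {k : Type u} [Field k]

/-- Morphisms of coalgebras preserve the comultiplication. -/
@[ext]
structure Hom (C D : cCDGA k) where
  hom : C.X ⟶ D.X
  hom_comul : hom ≫ D.comul = C.comul ≫ (hom ⊗ₘ hom)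

instance : Category (cCDGA k) where
  Hom := Hom
  id C := ⟨𝟙 C.X, by simp⟩
  comp f g := ⟨f.hom ≫ g.hom, by
    rw [Category.assoc, g.hom_comul, reassoc_of% f.hom_comul, tensorHom_comp_tensorHom]⟩

@[ext]
lemma hom_ext {C D : cCDGA k} {f g : C ⟶ D} (h : f.hom = g.hom) : f = g := Hom.ext h

@[simp] lemma id_hom (C : cCDGA k) : Hom.hom (𝟙 C) = 𝟙 C.X := rfl

@[simp] lemma comp_hom {C D E : cCDGA k} (f : C ⟶ D) (g : D ⟶ E) :
    (f ≫ g).hom = f.hom ≫ g.hom := rfl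

variable (k) in
/-- The underlying dg vector space of a coalgebra. -/
@[simps]
def forget : cCDGA k ⥤ DGVec k where
  obj C := C.X
  map f := f.hom

/-- An isomorphism of the underlying dg vector spaces preserving the comultiplications. -/
def isoMk {C D : cCDGA k} (e : C.X ≅ D.X) (h : e.hom ≫ D.comul = C.comul ≫ (e.hom ⊗ₘ e.hom)) :
    C ≅ D where
  hom := ⟨e.hom, h⟩
  inv := ⟨e.inv, by
    rw [← cancel_epi e.hom, e.hom_inv_id_assoc, reassoc_of% h, tensorHom_comp_tensorHom,
      e.hom_inv_id, id_tensorHom_id, Category.comp_id]⟩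
  hom_inv_id := hom_ext e.hom_inv_id
  inv_hom_id := hom_ext e.inv_hom_id

lemma iterComul_eq_zero_of_le (C : cCDGA k) (x : C.X.carrier) {m n : ℕ} (hmn : m ≤ n)
    (h : (iterComul C.comul m).lin x = 0) : (iterComul C.comul n).lin x = 0 := by
  induction n, hmn using Nat.le_induction with
  | base => exact h
  | succ n _ ih =>
    obtain ⟨t, ht⟩ := exists_iterComul_succ C.comul n
    rw [ht, DGVec.comp_lin, LinearMap.comp_apply, ih, map_zero]

/-- The tensor product of two coalgebras. -/
abbrev tensorObj (C D : cCDGA k) : cCDGA k where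
  X := C.X ⊗ D.X
  comul := tensorComul C.comul D.comul
  coassoc := tensorComul_coassoc _ _ C.coassoc D.coassoc
  cocomm := tensorComul_cocomm _ _ C.cocomm D.cocomm
  conilp t := by
    change C.X.carrier ⊗[k] D.X.carrier at t
    have key : ∃ m : ℕ, ∀ n, m ≤ n →
        (iterComul C.comul n ⊗ₘ iterComul D.comul n).lin t = 0 := by
      induction t with
      | zero => exact ⟨0, fun n _ => map_zero _⟩
      | tmul x y =>
        obtain ⟨m, hm⟩ := C.conilp x
        refine ⟨m, fun n hn => ?_⟩
        have h := C.iterComul_eq_zero_of_le x hn hm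
        have h' : (iterComul C.comul n ⊗ₘ iterComul D.comul n).lin (x ⊗ₜ[k] y) =
          (iterComul C.comul n).lin x ⊗ₜ[k] (iterComul D.comul n).lin y := rfl
        rw [h', h]
        exact TensorProduct.zero_tmul _ _
      | add s t hs ht =>
        obtain ⟨m, hm⟩ := hs
        obtain ⟨m', hm'⟩ := ht
        refine ⟨max m m', fun n hn => ?_⟩
        have h := hm n (le_of_max_le_left hn)
        have h' := hm' n (le_of_max_le_right hn)
        exact (map_add _ s t).trans (by rw [h, h', add_zero])
    obtain ⟨m, hm⟩ := key
    obtain ⟨s, hs⟩ := exists_iterComul_tensor C.comul D.comul m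
    refine ⟨m, ?_⟩
    have h := congrArg (fun f => DGVec.Hom.lin f t) hs
    refine h.trans ?_
    change s.lin ((iterComul C.comul m ⊗ₘ iterComul D.comul m).lin t) = 0
    rw [hm m le_rfl, map_zero]

/-- The tensor product of two morphisms of coalgebras. -/
def tensorMap {C C' D D' : cCDGA k} (f : C ⟶ C') (g : D ⟶ D') :
    tensorObj C D ⟶ tensorObj C' D' where
  hom := f.hom ⊗ₘ g.hom
  hom_comul := tensorComul_map f.hom_comul g.hom_comul

@[simp] lemma tensorMap_hom {C C' D D' : cCDGA k} (f : C ⟶ C') (g : D ⟶ D') :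
    (tensorMap f g).hom = f.hom ⊗ₘ g.hom := rfl

lemma tensorMap_id (C D : cCDGA k) : tensorMap (𝟙 C) (𝟙 D) = 𝟙 (tensorObj C D) :=
  hom_ext (id_tensorHom_id _ _)

lemma tensorMap_comp {C C' C'' D D' D'' : cCDGA k} (f : C ⟶ C') (f' : C' ⟶ C'') (g : D ⟶ D')
    (g' : D' ⟶ D'') : tensorMap f g ≫ tensorMap f' g' = tensorMap (f ≫ f') (g ≫ g') :=
  hom_ext (tensorHom_comp_tensorHom _ _ _ _)

variable (k) in
/-- The tensor product of coalgebras as a bifunctor. -/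
@[simps]
def tensorBifunctor : cCDGA k ⥤ cCDGA k ⥤ cCDGA k where
  obj C :=
    { obj := fun D => tensorObj C D
      map := fun g => tensorMap (𝟙 C) g
      map_id := fun D => tensorMap_id C D
      map_comp := fun f g => by rw [tensorMap_comp, Category.id_comp] }
  map f :=
    { app := fun D => tensorMap f (𝟙 D)
      naturality := fun D D' g => by simp [tensorMap_comp] }
  map_id C := NatTrans.ext (funext fun D => tensorMap_id C D)
  map_comp f g := NatTrans.ext (funext fun D => by simp [tensorMap_comp])

/-- The associator of coalgebras, with underlying map `(x ⊗ y) ⊗ z ↦ x ⊗ (y ⊗ z)`. -/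
def assoc (C D E : cCDGA k) : tensorObj (tensorObj C D) E ≅ tensorObj C (tensorObj D E) :=
  isoMk (α_ C.X D.X E.X) (associator_tensorComul _ _ _)

@[simp] lemma assoc_hom_hom (C D E : cCDGA k) :
    Hom.hom (assoc C D E).hom = (α_ C.X D.X E.X).hom := rfl

/-- The symmetry of coalgebras, with underlying map `x ⊗ y ↦ (-1)^(|x| |y|) y ⊗ x`. -/
def braid (C D : cCDGA k) : tensorObj C D ≅ tensorObj D C :=
  isoMk (β_ C.X D.X) (braiding_tensorComul _ _)

@[simp] lemma braid_hom_hom (C D : cCDGA k) :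
    Hom.hom (braid C D).hom = (β_ C.X D.X).hom := rfl

lemma assoc_natural {C C' D D' E E' : cCDGA k} (f : C ⟶ C') (g : D ⟶ D') (h : E ⟶ E') :
    tensorMap (tensorMap f g) h ≫ (assoc C' D' E').hom =
      (assoc C D E).hom ≫ tensorMap f (tensorMap g h) :=
  hom_ext (associator_naturality f.hom g.hom h.hom)

lemma braid_natural {C C' D D' : cCDGA k} (f : C ⟶ C') (g : D ⟶ D') :
    tensorMap f g ≫ (braid C' D').hom = (braid C D).hom ≫ tensorMap g f :=
  hom_ext (BraidedCategory.braiding_naturality f.hom g.hom)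

variable (k) in
/-- The associator as a natural isomorphism. -/
def assocIso : bifunctorComp₁₂ (tensorBifunctor k) (tensorBifunctor k) ≅
    bifunctorComp₂₃ (tensorBifunctor k) (tensorBifunctor k) :=
  NatIso.ofComponents (fun C => NatIso.ofComponents (fun D => NatIso.ofComponents
    (fun E => assoc C D E)
      (fun {E E'} h => by
        have := assoc_natural (𝟙 C) (𝟙 D) h
        rwa [tensorMap_id] at this))
      (fun {D D'} g => NatTrans.ext (funext fun E => assoc_natural (𝟙 C) g (𝟙 E))))
      (fun {C C'} f => NatTrans.ext (funext fun D => NatTrans.ext (funext fun E => by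
        have := assoc_natural f (𝟙 D) (𝟙 E)
        rwa [tensorMap_id D E] at this)))

variable (k) in
/-- The symmetry as a natural isomorphism. -/
def braidIso : tensorBifunctor k ≅ (tensorBifunctor k).flip :=
  NatIso.ofComponents (fun C => NatIso.ofComponents (fun D => braid C D)
      (fun {D D'} g => braid_natural (𝟙 C) g))
      (fun {C C'} f => NatTrans.ext (funext fun D => braid_natural f (𝟙 D)))

end cCDGA

section SemiModules

/-- A symmetric semi-monoidal category: the structure of a symmetric monoidal category without a
unit object. -/
class SymmetricSemiMonoidal (V : Type w) [Category.{v} V] where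
  tensor : V ⥤ V ⥤ V
  assoc : bifunctorComp₁₂ tensor tensor ≅ bifunctorComp₂₃ tensor tensor
  braiding : tensor ≅ tensor.flip
  pentagon (W X Y Z : V) :
    (tensor.map (((assoc.hom.app W).app X).app Y)).app Z ≫
        ((assoc.hom.app W).app ((tensor.obj X).obj Y)).app Z ≫
          (tensor.obj W).map (((assoc.hom.app X).app Y).app Z) =
      ((assoc.hom.app ((tensor.obj W).obj X)).app Y).app Z ≫
        ((assoc.hom.app W).app X).app ((tensor.obj Y).obj Z)
  symmetry (X Y : V) :
    (braiding.hom.app X).app Y ≫ (braiding.hom.app Y).app X = 𝟙 ((tensor.obj X).obj Y)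
  hexagon (X Y Z : V) :
    ((assoc.hom.app X).app Y).app Z ≫ (braiding.hom.app X).app ((tensor.obj Y).obj Z) ≫
        ((assoc.hom.app Y).app Z).app X =
      (tensor.map ((braiding.hom.app X).app Y)).app Z ≫ ((assoc.hom.app Y).app X).app Z ≫
        (tensor.obj Y).map ((braiding.hom.app X).app Z)

/-- A (semi-)module category `C` over a symmetric semi-monoidal category `V`: an action
`act : V × C ⥤ C` with a natural isomorphism `(X ⊗ Y) ▷ A ≅ X ▷ (Y ▷ A)` satisfying the pentagon
axiom. -/
structure SemiModule (V : Type*) [Category V] [SymmetricSemiMonoidal V] (C : Type*)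
    [Category C] where
  act : V ⥤ C ⥤ C
  assoc : bifunctorComp₁₂ (SymmetricSemiMonoidal.tensor (V := V)) act ≅ bifunctorComp₂₃ act act
  pentagon (X Y Z : V) (A : C) :
    (act.map (((SymmetricSemiMonoidal.assoc.hom.app X).app Y).app Z)).app A ≫
        ((assoc.hom.app X).app ((SymmetricSemiMonoidal.tensor.obj Y).obj Z)).app A ≫
          (act.obj X).map (((assoc.hom.app Y).app Z).app A) =
      ((assoc.hom.app ((SymmetricSemiMonoidal.tensor.obj X).obj Y)).app Z).app A ≫
        ((assoc.hom.app X).app Y).app ((act.obj Z).obj A)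

/-- Data exhibiting a module `C` over `V` as closed with cotensoring functor `cot` and enrichment
functor `enr`: `cot X` is right adjoint to `X ▷ -`, naturally in `X`, and `enr A` is right adjoint
to `- ▷ A`, naturally in `A`. -/
structure SemiModule.Closed {V : Type*} [Category V] [SymmetricSemiMonoidal V] {C : Type*}
    [Category C] (M : SemiModule V C) (enr : Cᵒᵖ ⥤ C ⥤ V) (cot : Vᵒᵖ ⥤ C ⥤ C) where
  cotAdj : M.act ⊣₂ cot
  enrAdj : M.act.flip ⊣₂ enr

end SemiModules

section Convolution

open Opposite

variable {k : Type u} [Field k]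

/-- Conilpotent cocommutative coalgebras form a symmetric semi-monoidal category. -/
instance : SymmetricSemiMonoidal (cCDGA k) where
  tensor := cCDGA.tensorBifunctor k
  assoc := cCDGA.assocIso k
  braiding := cCDGA.braidIso k
  pentagon W X Y Z := cCDGA.hom_ext (by
    change ((α_ W.X X.X Y.X).hom ⊗ₘ 𝟙 Z.X) ≫ (α_ W.X (X.X ⊗ Y.X) Z.X).hom ≫
      (𝟙 W.X ⊗ₘ (α_ X.X Y.X Z.X).hom) = (α_ (W.X ⊗ X.X) Y.X Z.X).hom ≫ (α_ W.X X.X (Y.X ⊗ Z.X)).hom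
    simp)
  symmetry X Y := cCDGA.hom_ext (SymmetricCategory.symmetry X.X Y.X)
  hexagon X Y Z := cCDGA.hom_ext (by
    change (α_ X.X Y.X Z.X).hom ≫ (β_ X.X (Y.X ⊗ Z.X)).hom ≫ (α_ Y.X Z.X X.X).hom =
      ((β_ X.X Y.X).hom ⊗ₘ 𝟙 Z.X) ≫ (α_ Y.X X.X Z.X).hom ≫ (𝟙 Y.X ⊗ₘ (β_ X.X Z.X).hom)
    rw [tensorHom_id, id_tensorHom, BraidedCategory.hexagon_forward])

/-- The category of dg Lie algebras. -/
abbrev DGLA (k : Type u) [Field k] := LieObj (DGVec k)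

/-- The convolution Lie algebra `{C, g}` on the internal hom of `C` and `g`. -/
abbrev convAlg (C : cCDGA k) (g : DGLA k) : DGLA k :=
  LieObj.convolution C.comul C.coassoc C.cocomm g

/-- Postcomposition with a morphism of dg Lie algebras. -/
abbrev convMap (C : cCDGA k) {g h : DGLA k} (f : g ⟶ h) : convAlg C g ⟶ convAlg C h :=
  LieObj.convolutionMap C.comul C.coassoc C.cocomm f

/-- Precomposition with a morphism of coalgebras. -/
abbrev convPre {C D : cCDGA k} (f : C ⟶ D) (g : DGLA k) : convAlg D g ⟶ convAlg C g :=
  LieObj.convolutionPre f.hom f.hom_comul g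

variable (k) in
/-- The convolution Lie algebra functor: morphisms act by pre- and postcomposition. -/
@[simps]
def convFunctor : (cCDGA k)ᵒᵖ ⥤ DGLA k ⥤ DGLA k where
  obj C :=
    { obj := fun g => convAlg C.unop g
      map := fun f => convMap C.unop f
      map_id := fun g => LieObj.hom_ext ((ihom C.unop.X).map_id g.X)
      map_comp := fun f g => LieObj.hom_ext ((ihom C.unop.X).map_comp f.hom g.hom) }
  map f :=
    { app := fun g => convPre f.unop g
      naturality := fun g h l =>
        LieObj.hom_ext ((MonoidalClosed.pre f.unop.hom).naturality l.hom) }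
  map_id C := NatTrans.ext (funext fun g => LieObj.hom_ext
    (congrArg (fun t => NatTrans.app t g.X) (MonoidalClosed.pre_id C.unop.X)))
  map_comp f f' := NatTrans.ext (funext fun g => LieObj.hom_ext
    (congrArg (fun t => NatTrans.app t g.X) (MonoidalClosed.pre_map f'.unop.hom f.unop.hom)))

end Convolution

section Presentations

open Opposite Limits

variable {k : Type u} [Field k]

/-- The structure map `T g ⟶ g` for a left adjoint `T` of the forgetful functor (that is, for the
free dg Lie algebra functor). -/
def freeCounit {T : DGVec k ⥤ DGLA k} (adjT : T ⊣ LieObj.forget (DGVec k)) (g : DGLA k) :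
    T.obj g.X ⟶ g :=
  adjT.counit.app g

lemma freeCounit_condition {T : DGVec k ⥤ DGLA k} (adjT : T ⊣ LieObj.forget (DGVec k))
    (g : DGLA k) : freeCounit adjT (T.obj g.X) ≫ freeCounit adjT g =
      T.map (freeCounit adjT g).hom ≫ freeCounit adjT g :=
  (adjT.counit_naturality (adjT.counit.app g)).symm

variable (M : SemiModule (cCDGA k) (DGLA k))

/-- The diagram `C ▷ T² g ⇉ C ▷ T g ⟶ C ▷ g`. -/
def tensorPresentation {T : DGVec k ⥤ DGLA k} (adjT : T ⊣ LieObj.forget (DGVec k)) (C : cCDGA k)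
    (g : DGLA k) : Cofork ((M.act.obj C).map (freeCounit adjT (T.obj g.X)))
      ((M.act.obj C).map (T.map (freeCounit adjT g).hom)) :=
  Cofork.ofπ ((M.act.obj C).map (freeCounit adjT g)) (by
    rw [← Functor.map_comp, freeCounit_condition, Functor.map_comp])

/-- The diagram `enr(g, h) ⟶ enr(T g, h) ⇉ enr(T² g, h)`. -/
def enrPresentation (enr : (DGLA k)ᵒᵖ ⥤ DGLA k ⥤ cCDGA k) {T : DGVec k ⥤ DGLA k}
    (adjT : T ⊣ LieObj.forget (DGVec k)) (g h : DGLA k) :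
    Fork ((enr.map (freeCounit adjT (T.obj g.X)).op).app h)
      ((enr.map (T.map (freeCounit adjT g).hom).op).app h) :=
  Fork.ofι ((enr.map (freeCounit adjT g).op).app h) (by
    rw [← NatTrans.comp_app, ← NatTrans.comp_app, ← Functor.map_comp, ← Functor.map_comp,
      ← op_comp, ← op_comp, freeCounit_condition])

variable {M} {enr : (DGLA k)ᵒᵖ ⥤ DGLA k ⥤ cCDGA k}

/-- The universal measuring `C ⊗ g ⟶ C ▷ g`: it corresponds to the unit `g ⟶ {C, C ▷ g}` of the
adjunction between tensoring and cotensoring. -/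
def universalMeasuring (cl : M.Closed enr (convFunctor k)) (C : cCDGA k) (g : DGLA k) :
    C.X ⊗ g.X ⟶ ((M.act.obj C).obj g).X :=
  MonoidalClosed.uncurry (((cl.cotAdj.adj C).unit.app g).hom)

/-- The universal measuring `enr(g, h) ⊗ g ⟶ h`, evaluation: the universal measuring out of
`enr(g, h) ⊗ g` followed by the counit `enr(g, h) ▷ g ⟶ h`. -/
def evalMeasuring (cl : M.Closed enr (convFunctor k)) (g h : DGLA k) :
    ((enr.obj (op g)).obj h).X ⊗ g.X ⟶ h.X :=
  universalMeasuring cl ((enr.obj (op g)).obj h) g ≫ ((cl.enrAdj.adj g).counit.app h).hom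

/-- The canonical map `T (C ⊗ V) ⟶ C ▷ T V`, given on generators by the universal measuring. -/
def tensorFreeComparison (cl : M.Closed enr (convFunctor k)) {T : DGVec k ⥤ DGLA k}
    (adjT : T ⊣ LieObj.forget (DGVec k)) (C : cCDGA k) (V : DGVec k) :
    T.obj (C.X ⊗ V) ⟶ (M.act.obj C).obj (T.obj V) :=
  (adjT.homEquiv _ _).symm (C.X ◁ adjT.unit.app V ≫ universalMeasuring cl C (T.obj V))

/-- The canonical map `enr(T V, h) ⟶ S [V, h]`, the coalgebra map corresponding to the restriction
of the evaluation `enr(T V, h) ⊗ T V ⟶ h` along `V ⟶ T V`. -/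
def enrFreeComparison (cl : M.Closed enr (convFunctor k)) {T : DGVec k ⥤ DGLA k}
    (adjT : T ⊣ LieObj.forget (DGVec k)) {S : DGVec k ⥤ cCDGA k} (adjS : cCDGA.forget k ⊣ S)
    (V : DGVec k) (h : DGLA k) :
    (enr.obj (op (T.obj V))).obj h ⟶ S.obj ((ihom V).obj h.X) :=
  adjS.homEquiv _ _ (MonoidalClosed.curry ((β_ V ((enr.obj (op (T.obj V))).obj h).X).hom ≫
    ((enr.obj (op (T.obj V))).obj h).X ◁ adjT.unit.app V ≫ evalMeasuring cl (T.obj V) h))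

end Presentations

end

/-! The whole structure is governed by measurings: dg maps m : C ⊗ g ⟶ h with m(c ⊗ [x, y]) = Σ ±
[m(c' ⊗ x), m(c'' ⊗ y)]. Currying turns them into Lie morphisms g ⟶ {C, h}
(`isMeasuring_uncurry_iff`). What remains is to represent measurings in the other two variables: C ▷
g is the universal target and enr(g, h) the universal source. Then Hom(C ▷ g, h), Hom(g, {C, h}) and
Hom(C, enr(g, h)) are all the set of measurings, and every naturality statement is checked on the
universal ones.

Representability rests on `measuringDefect`, the difference of the two sides of the condition. It is
quadratic in m, yet natural along Lie morphisms out of h and coalgebra morphisms into C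
(`measuringDefect_comp`, `measuringDefect_pre`). So C ▷ g is the quotient of the free Lie algebra on
C ⊗ g by the ideal generated by the defect of its generators, and enr(g, h) is the largest
subcoalgebra of the cofree coalgebra on [g, h] on which the defect of the tautological map vanishes
(`exists_universal_measuring`, `exists_couniversal_measuring`).

Free and cofree objects come from one scheme and its dual. The sum of the tensor powers of V over
binary trees carries a product (grafting) and a coproduct (pruning at the root). Dividing by the
ideal generated by the antisymmetry and Jacobi defects gives the free Lie algebra; the largest
subcoalgebra killed by the coassociativity and cocommutativity defects is the cofree coalgebra.
Conilpotence makes the universal map land in the direct sum: its component at a tree with n + 1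
leaves factors through Δ^n (`exists_treeCoeval`). The ground field enters through flatness: a tensor
product of injections is injective, so subcoalgebras have comultiplications of their own.

For associativity, measurings by D and then by C compose to one by C ⊗ D; conversely a measuring by
C ⊗ D with values in h curries to one by D with values in {C, h}. Both facts follow from
`measuringDefect_tensor`, so (C ⊗ D) ▷ g and C ▷ (D ▷ g) represent the same functor, and the
pentagon reduces to that of dg vector spaces.

On a free Lie algebra TV, measurings out of C ⊗ TV are arbitrary dg maps out of C ⊗ V, which gives
both comparison isomorphisms by Yoneda. Finally T²g ⇉ Tg ⟶ g splits on underlying dg vector spaces,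
hence is a coequaliser of Lie algebras; C ▷ - preserves it as a left adjoint, and transposing gives
the equaliser. -/

noncomputable section

namespace DGVec

variable {k : Type u} [Field k]

/-! ### Sub and quotient dg vector spaces; lifting and descent of dg maps. -/

section Graded

/-- Independence holds because p n fixes A n and kills every other A j, hence their sum. In this
form gradings on quotients, subspaces and direct sums only need the induced projections. -/
lemma isInternal_of_proj {M : Type*} [AddCommGroup M] [Module k M] (A : ℤ → Submodule k M)
    (p : ℤ → M →ₗ[k] M) (hp : ∀ m n : ℤ, ∀ x ∈ A m, p n x = if m = n then x else 0)
    (h : ∀ x, x ∈ iSup A) : DirectSum.IsInternal A := by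
  rw [DirectSum.isInternal_submodule_iff_iSupIndep_and_iSup_eq_top]
  refine ⟨fun n => ?_, (Submodule.eq_top_iff').2 h⟩
  rw [Submodule.disjoint_def]
  intro x hx hx'
  have hle : ⨆ j, ⨆ (_ : j ≠ n), A j ≤ LinearMap.ker (p n) :=
    iSup₂_le fun j hj y hy => by rw [LinearMap.mem_ker, hp j n y hy, if_neg hj]
  have h₁ := hle hx'
  rwa [LinearMap.mem_ker, hp n n x hx, if_pos rfl] at h₁

/-- For a subspace stable under the projections, this writes each of its elements as a finite sum of
homogeneous elements of the same subspace. -/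
lemma exists_sum_proj (V : DGVec k) (x : V.carrier) :
    ∃ s : Finset ℤ, x = ∑ n ∈ s, V.proj n x := by
  have h : ∃ s : Finset ℤ, ∀ n ∉ s, V.proj n x = 0 := by
    refine V.induction x (fun m x hx => ⟨{m}, fun n hn => ?_⟩) ?_
    · rw [V.proj_of_mem hx, if_neg (by simpa [eq_comm] using hn)]
    · rintro x y ⟨s, hs⟩ ⟨t, ht⟩
      refine ⟨s ∪ t, fun n hn => ?_⟩
      rw [Finset.notMem_union] at hn
      rw [map_add, hs n hn.1, ht n hn.2, add_zero]
  obtain ⟨s, hs⟩ := h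
  refine ⟨s, V.ext_proj fun m => ?_⟩
  rw [map_sum, Finset.sum_congr rfl fun n _ => V.proj_of_mem (V.proj_mem n x) m,
    Finset.sum_ite_eq']
  split_ifs with hm
  · rfl
  · exact hs m hm

lemma Hom.proj_comm {V W : DGVec k} (f : V ⟶ W) (n : ℤ) (x : V.carrier) :
    f.lin (V.proj n x) = W.proj n (f.lin x) := hom_proj f.lin f.deg n x

/-- Submodules stable under the projections to the homogeneous parts and under the differential. -/
structure IsDGSubmodule (V : DGVec k) (D : Submodule k V.carrier) : Prop where
  proj_mem : ∀ n, ∀ x ∈ D, V.proj n x ∈ D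
  d_mem : ∀ x ∈ D, V.d x ∈ D

lemma isDGSubmodule_range {V W : DGVec k} (f : V ⟶ W) :
    IsDGSubmodule W (LinearMap.range f.lin) where
  proj_mem := by
    rintro n _ ⟨x, rfl⟩
    exact ⟨V.proj n x, f.proj_comm n x⟩
  d_mem := by
    rintro _ ⟨x, rfl⟩
    exact ⟨V.d x, f.comm x⟩

lemma isDGSubmodule_ker {V W : DGVec k} (f : V ⟶ W) : IsDGSubmodule V (LinearMap.ker f.lin) where
  proj_mem n x hx := by
    rw [LinearMap.mem_ker] at hx ⊢
    rw [f.proj_comm, hx, map_zero]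
  d_mem x hx := by
    rw [LinearMap.mem_ker] at hx ⊢
    rw [f.comm, hx, map_zero]

lemma isDGSubmodule_sSup (V : DGVec k) (S : Set (Submodule k V.carrier))
    (h : ∀ D ∈ S, IsDGSubmodule V D) : IsDGSubmodule V (sSup S) where
  proj_mem n := by
    change sSup S ≤ (sSup S).comap (V.proj n)
    exact sSup_le fun D hD x hx => le_sSup hD ((h D hD).proj_mem n x hx)
  d_mem := by
    change sSup S ≤ (sSup S).comap V.d
    exact sSup_le fun D hD x hx => le_sSup hD ((h D hD).d_mem x hx)

lemma isDGSubmodule_sInf (V : DGVec k) (S : Set (Submodule k V.carrier))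
    (h : ∀ D ∈ S, IsDGSubmodule V D) : IsDGSubmodule V (sInf S) where
  proj_mem n x hx := by
    rw [Submodule.mem_sInf] at hx ⊢
    exact fun D hD => (h D hD).proj_mem n x (hx D hD)
  d_mem x hx := by
    rw [Submodule.mem_sInf] at hx ⊢
    exact fun D hD => (h D hD).d_mem x (hx D hD)

variable {V : DGVec k} {D : Submodule k V.carrier}

/-- The quotient of a dg vector space. -/
abbrev quot (h : IsDGSubmodule V D) : DGVec k where
  carrier := V.carrier ⧸ D
  gr n := (V.gr n).map D.mkQ
  isInternal := by
    refine isInternal_of_proj _ (fun n => D.mapQ D (V.proj n) (h.proj_mem n)) ?_ ?_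
    · rintro m n _ ⟨x, hx, rfl⟩
      rw [Submodule.mkQ_apply, Submodule.mapQ_apply, V.proj_of_mem hx]
      split_ifs <;> rfl
    · intro y
      obtain ⟨x, rfl⟩ := D.mkQ_surjective y
      refine V.induction x (fun n x hx => ?_) fun x y hx hy => by rw [map_add]; exact add_mem hx hy
      exact Submodule.mem_iSup_of_mem n ⟨x, hx, rfl⟩
  d := D.mapQ D V.d h.d_mem
  d_mem := by
    rintro n _ ⟨x, hx, rfl⟩
    exact ⟨V.d x, V.d_mem n x hx, rfl⟩
  d_d y := by
    obtain ⟨x, rfl⟩ := D.mkQ_surjective y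
    simp [V.d_d]

/-- The quotient map. -/
def quotπ (h : IsDGSubmodule V D) : V ⟶ quot h where
  lin := D.mkQ
  deg n x hx := ⟨x, hx, rfl⟩
  comm x := rfl

lemma quotπ_surjective (h : IsDGSubmodule V D) : Function.Surjective (quotπ h).lin :=
  D.mkQ_surjective

lemma ker_quotπ (h : IsDGSubmodule V D) : LinearMap.ker (quotπ h).lin = D :=
  D.ker_mkQ

/-- A sub dg vector space. -/
abbrev sub (h : IsDGSubmodule V D) : DGVec k where
  carrier := D
  gr n := (V.gr n).comap D.subtype
  isInternal := by
    refine isInternal_of_proj _ (fun n => (V.proj n).restrict (h.proj_mem n)) ?_ ?_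
    · rintro m n x hx
      apply Subtype.ext
      rw [LinearMap.coe_restrict_apply, V.proj_of_mem (x := x.1) hx]
      split_ifs <;> rfl
    · intro x
      obtain ⟨s, hs⟩ := V.exists_sum_proj x.1
      have : x = ∑ n ∈ s, (V.proj n).restrict (h.proj_mem n) x := by
        apply Subtype.ext
        rw [Submodule.coe_sum]
        exact hs
      rw [this]
      exact Submodule.sum_mem _ fun n _ => Submodule.mem_iSup_of_mem n (V.proj_mem n x.1)
  d := V.d.restrict h.d_mem
  d_mem n x hx := V.d_mem n x.1 hx
  d_d x := Subtype.ext (V.d_d x.1)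

/-- The inclusion of a sub dg vector space. -/
def subι (h : IsDGSubmodule V D) : sub h ⟶ V where
  lin := D.subtype
  deg n x hx := hx
  comm x := rfl

lemma subι_injective (h : IsDGSubmodule V D) : Function.Injective (subι h).lin :=
  D.subtype_injective

/-- The linear lift automatically respects degrees and differentials, because i commutes with the
projections and with d, and injectivity reflects the resulting equations. -/
lemma exists_lift_of_injective {U V W : DGVec k} (i : V ⟶ W) (hi : Function.Injective i.lin)
    (f : U ⟶ W) (h : ∀ x, f.lin x ∈ LinearMap.range i.lin) : ∃ g : U ⟶ V, g ≫ i = f := by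
  let g : U.carrier →ₗ[k] V.carrier :=
    (LinearEquiv.ofInjective i.lin hi).symm.toLinearMap ∘ₗ f.lin.codRestrict _ h
  have hg : ∀ x, i.lin (g x) = f.lin x := fun x =>
    LinearEquiv.ofInjective_symm_apply (h := hi) (f := i.lin) (f.lin.codRestrict _ h x)
  refine ⟨⟨g, fun n x hx => ?_, fun x => hi ?_⟩, hom_ext (LinearMap.ext hg)⟩
  · have : V.proj n (g x) = g x := hi (by
      rw [i.proj_comm, hg, W.proj_of_mem (f.deg n x hx), if_pos rfl])
    rw [← this]
    exact V.proj_mem n _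
  · rw [hg, f.comm, i.comm, hg]

/-- The descended map preserves degree because a homogeneous element of V has a homogeneous
preimage: project any preimage to the right degree. -/
lemma exists_desc_of_surjective {U V W : DGVec k} (p : U ⟶ V) (hp : Function.Surjective p.lin)
    (f : U ⟶ W) (h : ∀ x, p.lin x = 0 → f.lin x = 0) : ∃ g : V ⟶ W, p ≫ g = f := by
  let g : V.carrier →ₗ[k] W.carrier :=
    (LinearMap.ker p.lin).liftQ f.lin h ∘ₗ (p.lin.quotKerEquivOfSurjective hp).symm.toLinearMap
  have hg : ∀ x, g (p.lin x) = f.lin x := fun x => by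
    have : (p.lin.quotKerEquivOfSurjective hp).symm (p.lin x) = (LinearMap.ker p.lin).mkQ x := by
      rw [LinearEquiv.symm_apply_eq]; rfl
    change (LinearMap.ker p.lin).liftQ f.lin h _ = _
    rw [LinearEquiv.coe_coe, this]
    rfl
  refine ⟨⟨g, fun n y hy => ?_, fun y => ?_⟩, hom_ext (LinearMap.ext hg)⟩
  · obtain ⟨x, rfl⟩ := hp y
    have : p.lin x = p.lin (U.proj n x) := by
      rw [p.proj_comm, V.proj_of_mem hy, if_pos rfl]
    rw [this, hg]
    exact f.deg n _ (U.proj_mem n x)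
  · obtain ⟨x, rfl⟩ := hp y
    rw [← p.comm, hg, hg, f.comm]

lemma cancel_injective {U V W : DGVec k} {i : V ⟶ W} (hi : Function.Injective i.lin)
    {f g : U ⟶ V} (h : f ≫ i = g ≫ i) : f = g :=
  hom_ext (LinearMap.ext fun x => hi (LinearMap.congr_fun (congrArg Hom.lin h) x))

lemma cancel_surjective {U V W : DGVec k} {p : U ⟶ V} (hp : Function.Surjective p.lin)
    {f g : V ⟶ W} (h : p ≫ f = p ≫ g) : f = g :=
  hom_ext (LinearMap.ext fun y => by
    obtain ⟨x, rfl⟩ := hp y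
    exact LinearMap.congr_fun (congrArg Hom.lin h) x)

/-- Flatness over a field. All the subcoalgebra arguments depend on it. -/
lemma tensorHom_injective {V V' W W' : DGVec k} {i : V ⟶ V'} {j : W ⟶ W'}
    (hi : Function.Injective i.lin) (hj : Function.Injective j.lin) :
    Function.Injective (i ⊗ₘ j).lin :=
  TensorProduct.map_injective_of_flat_flat i.lin j.lin hi hj

lemma tensorHom_surjective {V V' W W' : DGVec k} {i : V ⟶ V'} {j : W ⟶ W'}
    (hi : Function.Surjective i.lin) (hj : Function.Surjective j.lin) :
    Function.Surjective (i ⊗ₘ j).lin :=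
  TensorProduct.map_surjective hi hj

end Graded

/-! ### Direct sums of dg vector spaces and their tensor products. -/

section DirectSum

variable {ι : Type} [DecidableEq ι] (P : ι → DGVec k)

/-- The direct sum of a family of dg vector spaces. -/
abbrev bigSum : DGVec k where
  carrier := ⨁ i, (P i).carrier
  gr n := ⨅ i, ((P i).gr n).comap (DirectSum.component k ι (fun i => (P i).carrier) i)
  isInternal := by
    refine isInternal_of_proj _ (fun n => DirectSum.lmap fun i => (P i).proj n) ?_ ?_
    · intro m n x hx
      simp only [Submodule.mem_iInf, Submodule.mem_comap] at hx
      refine DFinsupp.ext fun i => ?_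
      have h := (P i).proj_of_mem (hx i) n
      change (P i).proj n (x i) = _
      refine h.trans ?_
      split_ifs <;> rfl
    · intro x
      induction x using DirectSum.induction_on with
      | zero => exact zero_mem _
      | of i x =>
        refine (P i).induction x (fun n x hx => Submodule.mem_iSup_of_mem n ?_)
          fun x y hx hy => by rw [map_add]; exact add_mem hx hy
        simp only [Submodule.mem_iInf, Submodule.mem_comap]
        intro j
        by_cases h : i = j
        · subst h
          have : (DirectSum.component k ι (fun i => (P i).carrier) i)
            (DirectSum.of (fun i => (P i).carrier) i x) = x := DirectSum.of_eq_same _ _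
          rwa [this]
        · have : (DirectSum.component k ι (fun i => (P i).carrier) j)
            (DirectSum.of (fun i => (P i).carrier) i x) = 0 := DirectSum.of_eq_of_ne _ _ _ (Ne.symm h)
          rw [this]
          exact zero_mem _
      | add x y hx hy => exact add_mem hx hy
  d := DirectSum.lmap fun i => (P i).d
  d_mem n x hx := by
    simp only [Submodule.mem_iInf, Submodule.mem_comap] at hx ⊢
    exact fun i => (P i).d_mem n _ (hx i)
  d_d x := DFinsupp.ext fun i => (P i).d_d (x i)

/-- The projections of a direct sum. -/
def sumπ (i : ι) : bigSum P ⟶ P i where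
  lin := DirectSum.component k ι (fun i => (P i).carrier) i
  deg n x hx := by
    have hx' := (Submodule.mem_iInf _).1 hx
    exact hx' i
  comm x := rfl

lemma sum_ext {x y : (bigSum P).carrier} (h : ∀ i, (sumπ P i).lin x = (sumπ P i).lin y) : x = y :=
  DFinsupp.ext h

lemma sum_mem {n : ℤ} {x : (bigSum P).carrier} (h : ∀ i, (sumπ P i).lin x ∈ (P i).gr n) :
    x ∈ (bigSum P).gr n := by
  exact (Submodule.mem_iInf _).2 h

lemma sumπ_of_same (i : ι) (x : (P i).carrier) :
    (sumπ P i).lin (DirectSum.lof k ι (fun i => (P i).carrier) i x) = x :=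
  DirectSum.of_eq_same _ _

lemma sumπ_of_ne {i j : ι} (h : i ≠ j) (x : (P i).carrier) :
    (sumπ P j).lin (DirectSum.lof k ι (fun i => (P i).carrier) i x) = 0 :=
  DirectSum.of_eq_of_ne _ _ _ h.symm

/-- The inclusions into a direct sum. -/
def sumι (i : ι) : P i ⟶ bigSum P where
  lin := DirectSum.lof k ι (fun i => (P i).carrier) i
  deg n x hx := sum_mem P fun j => by
    by_cases h : i = j
    · subst h; rwa [sumπ_of_same]
    · rw [sumπ_of_ne P h]; exact zero_mem _
  comm x := sum_ext P fun j => by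
    rw [(sumπ P j).comm]
    by_cases h : i = j
    · subst h; rw [sumπ_of_same, sumπ_of_same]
    · rw [sumπ_of_ne P h, sumπ_of_ne P h, map_zero]

lemma sumι_π_same (i : ι) : sumι P i ≫ sumπ P i = 𝟙 _ :=
  hom_ext (LinearMap.ext fun x => sumπ_of_same P i x)

lemma sumι_π_ne {i j : ι} (h : i ≠ j) : sumι P i ≫ sumπ P j = 0 :=
  hom_ext (LinearMap.ext fun x => sumπ_of_ne P h x)

variable {P}

lemma sum_hom_ext {W : DGVec k} {f g : bigSum P ⟶ W} (h : ∀ i, sumι P i ≫ f = sumι P i ≫ g) :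
    f = g :=
  hom_ext (DirectSum.linearMap_ext k fun i => congrArg Hom.lin (h i))

lemma exists_sum_sumι (x : (bigSum P).carrier) :
    ∃ s : Finset ι, x = ∑ i ∈ s, (sumι P i).lin ((sumπ P i).lin x) := by
  classical
  refine ⟨DFinsupp.support x, sum_ext P fun j => ?_⟩
  rw [map_sum]
  by_cases hj : (sumπ P j).lin x = 0
  · rw [hj, Finset.sum_eq_zero]
    intro i _
    by_cases h : i = j
    · subst h; rw [hj, map_zero, map_zero]
    · exact sumπ_of_ne P h _
  · rw [Finset.sum_eq_single j]
    · exact (sumπ_of_same P j _).symm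
    · exact fun i _ h => sumπ_of_ne P h _
    · exact fun h => absurd (DFinsupp.mem_support_iff.2 hj) h

/-- The morphism out of a direct sum with given components. -/
def sumDesc {W : DGVec k} (f : ∀ i, P i ⟶ W) : bigSum P ⟶ W where
  lin := DirectSum.toModule k ι W.carrier fun i => (f i).lin
  deg n x hx := by
    obtain ⟨s, hs⟩ := exists_sum_sumι x
    rw [hs, map_sum]
    refine Submodule.sum_mem _ fun i _ => ?_
    have : DirectSum.toModule k ι W.carrier (fun i => (f i).lin)
        ((sumι P i).lin ((sumπ P i).lin x)) = (f i).lin ((sumπ P i).lin x) :=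
      DirectSum.toModule_lof k i _
    rw [this]
    exact (f i).deg n _ ((sumπ P i).deg n x hx)
  comm x := by
    have : DirectSum.toModule k ι W.carrier (fun i => (f i).lin) ∘ₗ (bigSum P).d =
        W.d ∘ₗ DirectSum.toModule k ι W.carrier (fun i => (f i).lin) := by
      refine DirectSum.linearMap_ext k fun i => LinearMap.ext fun y => ?_
      have h₁ : (bigSum P).d (DirectSum.lof k ι (fun i => (P i).carrier) i y) =
        DirectSum.lof k ι (fun i => (P i).carrier) i ((P i).d y) := ((sumι P i).comm y).symm
      simp only [LinearMap.comp_apply]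
      rw [h₁, DirectSum.toModule_lof, DirectSum.toModule_lof, (f i).comm]
    exact LinearMap.congr_fun this x

lemma sumι_desc {W : DGVec k} (f : ∀ i, P i ⟶ W) (i : ι) : sumι P i ≫ sumDesc f = f i :=
  hom_ext (LinearMap.ext fun x => DirectSum.toModule_lof (φ := fun i => (f i).lin) k i x)

/-- The morphism into a direct sum with given components, of which only finitely many are nonzero
on each element. -/
def sumLift {W : DGVec k} (f : ∀ i, W ⟶ P i) (h : ∀ x, {i | (f i).lin x ≠ 0}.Finite) :
    W ⟶ bigSum P :=
  have key : ∀ x i, (DFinsupp.mk (h x).toFinset fun i => (f i).lin x : ⨁ i, (P i).carrier) i =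
      (f i).lin x := fun x i => by
    rw [DFinsupp.mk_apply]
    split_ifs with hi
    · rfl
    · simpa using Eq.symm (by simpa using hi)
  { lin :=
      { toFun := fun x => DFinsupp.mk (h x).toFinset fun i => (f i).lin x
        map_add' := fun x y => DFinsupp.ext fun i => by
          rw [DFinsupp.add_apply, key, key, key, map_add]
        map_smul' := fun a x => DFinsupp.ext fun i => by
          rw [DFinsupp.smul_apply, key, key, map_smul]; rfl }
    deg := fun n x hx => sum_mem P fun i => by
      have : _ = (f i).lin x := key x i
      exact this ▸ (f i).deg n x hx
    comm := fun x => DFinsupp.ext fun i =>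
      (key (W.d x) i).trans (((f i).comm x).trans (congrArg (P i).d (key x i).symm)) }

lemma sumLift_π {W : DGVec k} (f : ∀ i, W ⟶ P i) (h : ∀ x, {i | (f i).lin x ≠ 0}.Finite) (i : ι) :
    sumLift f h ≫ sumπ P i = f i :=
  hom_ext (LinearMap.ext fun x => by
    change (DFinsupp.mk (h x).toFinset fun i => (f i).lin x : ⨁ i, (P i).carrier) i = _
    rw [DFinsupp.mk_apply]
    split_ifs with hi
    · rfl
    · simpa using Eq.symm (by simpa using hi))

lemma hom_sum_ext {W : DGVec k} {f g : W ⟶ bigSum P} (h : ∀ i, f ≫ sumπ P i = g ≫ sumπ P i) :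
    f = g :=
  hom_ext (LinearMap.ext fun x => sum_ext P fun i =>
    LinearMap.congr_fun (congrArg Hom.lin (h i)) x)

variable {κ : Type} [DecidableEq κ] {Q : κ → DGVec k}

/-- Tensor products distribute over direct sums in each variable, so an element of the tensor
product is determined by its (i, j) components. This is how maps into the tree coalgebra are
compared. -/
lemma hom_tensor_sum_ext {W : DGVec k} {f g : W ⟶ bigSum P ⊗ bigSum Q}
    (h : ∀ i j, f ≫ (sumπ P i ⊗ₘ sumπ Q j) = g ≫ (sumπ P i ⊗ₘ sumπ Q j)) : f = g := by
  have key : ∀ i j, ∀ t : (⨁ i, (P i).carrier) ⊗[k] (⨁ j, (Q j).carrier),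
      TensorProduct.directSumRight k k (P i).carrier (fun j => (Q j).carrier)
        (TensorProduct.directSumLeft k k (fun i => (P i).carrier) (⨁ j, (Q j).carrier) t i) j =
        (sumπ P i ⊗ₘ sumπ Q j).lin t := by
    intro i j t
    induction t with
    | zero => simp
    | add s t hs ht =>
      rw [map_add, DirectSum.add_apply, map_add, DirectSum.add_apply, hs, ht]
      exact (map_add _ s t).symm
    | tmul x y =>
      rw [TensorProduct.directSumLeft_tmul, TensorProduct.directSumRight_tmul]
      rfl
  refine hom_ext (LinearMap.ext fun x => ?_)
  apply (TensorProduct.directSumLeft k k (fun i => (P i).carrier) (⨁ j, (Q j).carrier)).injective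
  refine DFinsupp.ext fun i => ?_
  apply (TensorProduct.directSumRight k k (P i).carrier (fun j => (Q j).carrier)).injective
  refine DFinsupp.ext fun j => ?_
  exact (key i j _).trans
    ((LinearMap.congr_fun (congrArg Hom.lin (h i j)) x).trans (key i j _).symm)

lemma tensor_sum_hom_ext {W : DGVec k} {f g : bigSum P ⊗ bigSum Q ⟶ W}
    (h : ∀ i j, (sumι P i ⊗ₘ sumι Q j) ≫ f = (sumι P i ⊗ₘ sumι Q j) ≫ g) : f = g := by
  refine hom_ext (TensorProduct.ext (DirectSum.linearMap_ext k fun i => LinearMap.ext fun x =>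
    DirectSum.linearMap_ext k fun j => LinearMap.ext fun y => ?_))
  exact LinearMap.congr_fun (congrArg Hom.lin (h i j)) (x ⊗ₜ y)

/-- The morphism out of a tensor product of direct sums with given components. -/
def sumDesc₂ {W : DGVec k} (f : ∀ i j, P i ⊗ Q j ⟶ W) : bigSum P ⊗ bigSum Q ⟶ W :=
  -- Currying treats the two sums one variable at a time; the braidings exchange the roles of the
  -- variables.
  MonoidalClosed.uncurry (sumDesc fun j => MonoidalClosed.curry ((β_ _ _).hom ≫
    MonoidalClosed.uncurry (sumDesc fun i => MonoidalClosed.curry ((β_ _ _).hom ≫ f i j))))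

lemma sumι_desc₂ {W : DGVec k} (f : ∀ i j, P i ⊗ Q j ⟶ W) (i : ι) (j : κ) :
    (sumι P i ⊗ₘ sumι Q j) ≫ sumDesc₂ f = f i j := by
  rw [MonoidalCategory.tensorHom_def, Category.assoc, sumDesc₂,
    ← MonoidalClosed.uncurry_natural_left, sumι_desc, MonoidalClosed.uncurry_curry,
    BraidedCategory.braiding_naturality_left_assoc, ← MonoidalClosed.uncurry_natural_left,
    sumι_desc, MonoidalClosed.uncurry_curry, SymmetricCategory.symmetry_assoc]

end DirectSum

end DGVec

end

/-! ### Antisymmetry and Jacobi defects, ideals, and the free product on trees. -/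

noncomputable section

lemma cyc_natural {𝒱 : Type w} [Category.{v} 𝒱] [MonoidalCategory 𝒱] [SymmetricCategory 𝒱]
    {X Y : 𝒱} (f : X ⟶ Y) :
    ((f ⊗ₘ f) ⊗ₘ f) ≫ cyc Y = cyc X ≫ ((f ⊗ₘ f) ⊗ₘ f) := by
  rw [cyc, cyc, associator_naturality_assoc, BraidedCategory.braiding_naturality, Category.assoc]

section Magma

variable {𝒱 : Type w} [Category.{v} 𝒱] [MonoidalCategory 𝒱] [SymmetricCategory 𝒱] [Preadditive 𝒱]

/-- The left hand side of the Jacobi identity of a product. -/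
def jacobiator {X : 𝒱} (m : X ⊗ X ⟶ X) : (X ⊗ X) ⊗ X ⟶ X :=
  m ▷ X ≫ m + cyc X ≫ m ▷ X ≫ m + cyc X ≫ cyc X ≫ m ▷ X ≫ m

/-- The left hand side of the antisymmetry condition of a product. -/
def antisymmetrizer {X : 𝒱} (m : X ⊗ X ⟶ X) : X ⊗ X ⟶ X := (β_ X X).hom ≫ m + m

variable {X Y : 𝒱} {m : X ⊗ X ⟶ X} {m' : Y ⊗ Y ⟶ Y} {f : X ⟶ Y}

/-- This and `jacobiator_natural` serve twice: a quotient by an ideal containing the defects is a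
Lie algebra, and a multiplicative map to a Lie algebra kills the defects of its source. -/
lemma antisymmetrizer_natural (h : m ≫ f = (f ⊗ₘ f) ≫ m') : (f ⊗ₘ f) ≫ antisymmetrizer m' = antisymmetrizer m ≫ f := by
  rw [antisymmetrizer, antisymmetrizer, Preadditive.comp_add, Preadditive.add_comp,
    BraidedCategory.braiding_naturality_assoc, Category.assoc, h]

lemma jacobiator_natural (h : m ≫ f = (f ⊗ₘ f) ≫ m') : ((f ⊗ₘ f) ⊗ₘ f) ≫ jacobiator m' = jacobiator m ≫ f := by
  have h₁ : ((f ⊗ₘ f) ⊗ₘ f) ≫ m' ▷ Y ≫ m' = m ▷ X ≫ m ≫ f := by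
    rw [h, ← tensorHom_id, ← tensorHom_id, tensorHom_comp_tensorHom_assoc,
      tensorHom_comp_tensorHom_assoc, h, Category.comp_id, Category.id_comp]
  have h₂ : ((f ⊗ₘ f) ⊗ₘ f) ≫ cyc Y ≫ m' ▷ Y ≫ m' = cyc X ≫ m ▷ X ≫ m ≫ f := by
    rw [reassoc_of% (cyc_natural f), h₁]
  have h₃ : ((f ⊗ₘ f) ⊗ₘ f) ≫ cyc Y ≫ cyc Y ≫ m' ▷ Y ≫ m' =
      cyc X ≫ cyc X ≫ m ▷ X ≫ m ≫ f := by
    rw [reassoc_of% (cyc_natural f), h₂]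
  simp only [jacobiator, Preadditive.comp_add, Preadditive.add_comp, Category.assoc, h₁, h₂, h₃]

end Magma

namespace DGVec

variable {k : Type u} [Field k]

/-- A morphism out of `V ⊗ V` descends along a surjection `p ⊗ p` if it vanishes on the pure tensors
with one factor in the kernel of `p`. -/
lemma exists_tensor_desc {V V' W : DGVec k} (p : V ⟶ V') (hp : Function.Surjective p.lin)
    (f : V ⊗ V ⟶ W) (h : ∀ x y : V.carrier, p.lin x = 0 →
      f.lin (x ⊗ₜ[k] y) = 0 ∧ f.lin (y ⊗ₜ[k] x) = 0) : ∃ g : V' ⊗ V' ⟶ W, (p ⊗ₘ p) ≫ g = f := by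
  refine exists_desc_of_surjective _ (tensorHom_surjective hp hp) f fun t ht => ?_
  have hex := LinearMap.exact_subtype_ker_map p.lin
  -- Right exactness: the kernel of p ⊗ p is the sum of the images of V ⊗ ker p and ker p ⊗ V.
  have hk := TensorProduct.map_ker hex hp hex hp
  have ht' : t ∈ LinearMap.ker (TensorProduct.map p.lin p.lin) := ht
  rw [hk] at ht'
  obtain ⟨_, ⟨a, rfl⟩, _, ⟨b, rfl⟩, rfl⟩ := Submodule.mem_sup.1 ht'
  have ha : f.lin ∘ₗ LinearMap.lTensor V.carrier (LinearMap.ker p.lin).subtype = 0 :=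
    TensorProduct.ext' fun y x => (h x.1 y x.2).2
  have hb : f.lin ∘ₗ LinearMap.rTensor V.carrier (LinearMap.ker p.lin).subtype = 0 :=
    TensorProduct.ext' fun x y => (h x.1 y x.2).1
  refine (map_add f.lin _ _).trans ?_
  have ha' := LinearMap.congr_fun ha a
  have hb' := LinearMap.congr_fun hb b
  exact (congrArg₂ (· + ·) ha' hb').trans (add_zero _)

/-- Two-sided ideals of a dg vector space with a product. -/
structure IsDGIdeal {X : DGVec k} (m : X ⊗ X ⟶ X) (I : Submodule k X.carrier) : Prop where
  isDGSubmodule : IsDGSubmodule X I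
  mul_mem : ∀ x ∈ I, ∀ y : X.carrier, m.lin (x ⊗ₜ[k] y) ∈ I ∧ m.lin (y ⊗ₜ[k] x) ∈ I

/-- The ideal generated by a set. -/
def idealSpan {X : DGVec k} (m : X ⊗ X ⟶ X) (S : Set X.carrier) : Submodule k X.carrier :=
  sInf {I | IsDGIdeal m I ∧ S ⊆ I}

section Ideal

variable {X : DGVec k} (m : X ⊗ X ⟶ X) (S : Set X.carrier)

lemma idealSpan_isDGIdeal : IsDGIdeal m (idealSpan m S) where
  isDGSubmodule := isDGSubmodule_sInf _ _ fun I hI => hI.1.isDGSubmodule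
  mul_mem x hx y := by
    rw [idealSpan, Submodule.mem_sInf] at hx
    constructor <;> rw [idealSpan, Submodule.mem_sInf]
    · exact fun I hI => (hI.1.mul_mem x (hx I hI) y).1
    · exact fun I hI => (hI.1.mul_mem x (hx I hI) y).2

lemma subset_idealSpan : S ⊆ idealSpan m S := fun x hx => by
  rw [SetLike.mem_coe, idealSpan, Submodule.mem_sInf]
  exact fun I hI => hI.2 hx

variable {m S}

/-- The kernel of a multiplicative dg map is itself a dg ideal, so it competes in the intersection
defining `idealSpan`. -/
lemma idealSpan_le_ker {Y : DGVec k} {m' : Y ⊗ Y ⟶ Y} {f : X ⟶ Y}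
    (h : m ≫ f = (f ⊗ₘ f) ≫ m') (hS : ∀ x ∈ S, f.lin x = 0) :
    idealSpan m S ≤ LinearMap.ker f.lin := by
  refine sInf_le ⟨⟨isDGSubmodule_ker f, fun x hx y => ?_⟩, hS⟩
  rw [LinearMap.mem_ker] at hx
  have h' : ∀ a b : X.carrier, f.lin (m.lin (a ⊗ₜ[k] b)) = m'.lin (f.lin a ⊗ₜ[k] f.lin b) :=
    fun a b => LinearMap.congr_fun (congrArg Hom.lin h) (a ⊗ₜ[k] b)
  rw [LinearMap.mem_ker, LinearMap.mem_ker, h', h', hx, TensorProduct.zero_tmul,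
    TensorProduct.tmul_zero, map_zero]
  exact ⟨rfl, rfl⟩

end Ideal

/-- Absorption on both sides is exactly the vanishing needed by `exists_tensor_desc`. -/
lemma exists_quot_mul {X : DGVec k} (m : X ⊗ X ⟶ X) {I : Submodule k X.carrier}
    (hI : IsDGIdeal m I) : ∃ μ : quot hI.isDGSubmodule ⊗ quot hI.isDGSubmodule ⟶
      quot hI.isDGSubmodule, (quotπ hI.isDGSubmodule ⊗ₘ quotπ hI.isDGSubmodule) ≫ μ =
        m ≫ quotπ hI.isDGSubmodule := by
  have hmem : ∀ x, (quotπ hI.isDGSubmodule).lin x = 0 ↔ x ∈ I := fun x => by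
    rw [← LinearMap.mem_ker, ker_quotπ]
  refine exists_tensor_desc _ (quotπ_surjective _) _ fun x y hx => ?_
  have := hI.mul_mem x ((hmem x).1 hx) y
  exact ⟨(hmem _).2 this.1, (hmem _).2 this.2⟩

/-- The quotient of a dg vector space with a product by an ideal containing the defects of
antisymmetry and of the Jacobi identity. -/
def quotLie {X : DGVec k} (m : X ⊗ X ⟶ X) {I : Submodule k X.carrier} (hI : IsDGIdeal m I)
    (ha : ∀ t, (antisymmetrizer m).lin t ∈ I) (hj : ∀ t, (jacobiator m).lin t ∈ I) : DGLA k where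
  X := quot hI.isDGSubmodule
  bracket := (exists_quot_mul m hI).choose
  antisymm := by
    have hs := quotπ_surjective hI.isDGSubmodule
    have h := (exists_quot_mul m hI).choose_spec
    rw [eq_neg_iff_add_eq_zero]
    refine cancel_surjective (tensorHom_surjective hs hs) ?_
    refine (antisymmetrizer_natural h.symm).trans ?_
    rw [Limits.comp_zero]
    refine hom_ext (LinearMap.ext fun t => ?_)
    exact LinearMap.mem_ker.1 ((ker_quotπ hI.isDGSubmodule).ge (ha t))
  jacobi := by
    have hs := quotπ_surjective hI.isDGSubmodule
    have h := (exists_quot_mul m hI).choose_spec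
    refine cancel_surjective (tensorHom_surjective (tensorHom_surjective hs hs) hs) ?_
    refine (jacobiator_natural h.symm).trans ?_
    rw [Limits.comp_zero]
    refine hom_ext (LinearMap.ext fun t => ?_)
    exact LinearMap.mem_ker.1 ((ker_quotπ hI.isDGSubmodule).ge (hj t))

section QuotLie

variable {X : DGVec k} {m : X ⊗ X ⟶ X} {I : Submodule k X.carrier} (hI : IsDGIdeal m I)
    (ha : ∀ t, (antisymmetrizer m).lin t ∈ I) (hj : ∀ t, (jacobiator m).lin t ∈ I)

/-- The quotient map to `quotLie`. -/
def quotLieπ : X ⟶ (quotLie m hI ha hj).X := quotπ hI.isDGSubmodule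

lemma quotLieπ_surjective : Function.Surjective (quotLieπ hI ha hj).lin :=
  quotπ_surjective hI.isDGSubmodule

lemma quotLieπ_eq_zero {x : X.carrier} : (quotLieπ hI ha hj).lin x = 0 ↔ x ∈ I := by
  rw [← LinearMap.mem_ker]
  exact (ker_quotπ hI.isDGSubmodule).symm ▸ Iff.rfl

lemma quotLieπ_mul : m ≫ quotLieπ hI ha hj =
    (quotLieπ hI ha hj ⊗ₘ quotLieπ hI ha hj) ≫ (quotLie m hI ha hj).bracket :=
  (exists_quot_mul m hI).choose_spec.symm

lemma exists_quotLie_desc {h : DGLA k} (f : X ⟶ h.X) (hf : m ≫ f = (f ⊗ₘ f) ≫ h.bracket)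
    (hIf : I ≤ LinearMap.ker f.lin) : ∃ g : quotLie m hI ha hj ⟶ h,
      quotLieπ hI ha hj ≫ g.hom = f := by
  have hs := quotLieπ_surjective hI ha hj
  obtain ⟨g, hg⟩ := exists_desc_of_surjective (quotLieπ hI ha hj) hs f
    fun x hx => hIf ((quotLieπ_eq_zero hI ha hj).1 hx)
  refine ⟨⟨g, cancel_surjective (tensorHom_surjective hs hs) ?_⟩, hg⟩
  rw [← Category.assoc, ← quotLieπ_mul, Category.assoc, hg, hf, tensorHom_comp_tensorHom_assoc, hg]

end QuotLie

/-- The tensor power of `V` with factors indexed by the leaves of a binary tree. -/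
@[reducible]
def treePow (V : DGVec k) : FreeMagma Unit → DGVec k
  | .of _ => V
  | .mul a b => treePow V a ⊗ treePow V b

/-- The free product on `V`: the sum of the tensor powers over all binary trees. -/
abbrev freeMag (V : DGVec k) : DGVec k := bigSum (treePow V)

/-- Grafting of trees. -/
def freeMul (V : DGVec k) : freeMag V ⊗ freeMag V ⟶ freeMag V :=
  sumDesc₂ fun a b => sumι (treePow V) (.mul a b)

/-- Extension of `f : V ⟶ X` to the tensor powers of `V`, given a product on `X`. -/
def treeEval {V X : DGVec k} (m : X ⊗ X ⟶ X) (f : V ⟶ X) : (t : FreeMagma Unit) → (treePow V t ⟶ X)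
  | .of _ => f
  | .mul a b => (treeEval m f a ⊗ₘ treeEval m f b) ≫ m

lemma freeMul_treeEval {V X : DGVec k} (m : X ⊗ X ⟶ X) (f : V ⟶ X) :
    freeMul V ≫ sumDesc (treeEval m f) = (sumDesc (treeEval m f) ⊗ₘ sumDesc (treeEval m f)) ≫ m := by
  refine tensor_sum_hom_ext fun a b => ?_
  rw [freeMul, ← Category.assoc, sumι_desc₂, sumι_desc, tensorHom_comp_tensorHom_assoc, sumι_desc,
    sumι_desc]
  rfl

/-- Every tree is grafted from single leaves, and a multiplicative map on the summand of a graft is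
determined by its values on the two subtrees. -/
lemma freeMag_hom_ext {V X : DGVec k} {m : X ⊗ X ⟶ X} {f g : freeMag V ⟶ X}
    (hf : freeMul V ≫ f = (f ⊗ₘ f) ≫ m) (hg : freeMul V ≫ g = (g ⊗ₘ g) ≫ m)
    (h : sumι (treePow V) (.of ()) ≫ f = sumι (treePow V) (.of ()) ≫ g) : f = g := by
  refine sum_hom_ext fun t => ?_
  induction t with
  | ih1 t => exact h
  | ih2 a b iha ihb =>
    have key : ∀ φ : freeMag V ⟶ X, freeMul V ≫ φ = (φ ⊗ₘ φ) ≫ m →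
        sumι (treePow V) (.mul a b) ≫ φ =
          ((sumι (treePow V) a ≫ φ) ⊗ₘ (sumι (treePow V) b ≫ φ)) ≫ m := by
      intro φ hφ
      rw [← tensorHom_comp_tensorHom, Category.assoc, ← hφ, freeMul, ← Category.assoc, sumι_desc₂]
    exact (key f hf).trans ((by rw [iha, ihb] : _ = _).trans (key g hg).symm)

end DGVec

/-! ### Quotients of dg Lie algebras and the free dg Lie algebra. -/

section Quotient

variable {k : Type u} [Field k]

open DGVec

/-- Every set of relations on a dg Lie algebra has a universal quotient. -/
lemma DGLA.exists_quotient (L : DGLA k) (S : Set L.X.carrier) :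
    ∃ (Q : DGLA k) (π : L ⟶ Q), Function.Surjective π.hom.lin ∧ (∀ x ∈ S, π.hom.lin x = 0) ∧
      ∀ (h : DGLA k) (f : L ⟶ h), (∀ x ∈ S, f.hom.lin x = 0) → ∃ g : Q ⟶ h, π ≫ g = f := by
  have hI := idealSpan_isDGIdeal L.bracket S
  -- Since L is already a Lie algebra, both defects are zero and lie in any ideal.
  have ha : ∀ t, (antisymmetrizer L.bracket).lin t ∈ idealSpan L.bracket S := fun t => by
    rw [antisymmetrizer, L.antisymm, neg_add_cancel]
    exact zero_mem _
  have hj : ∀ t, (jacobiator L.bracket).lin t ∈ idealSpan L.bracket S := fun t => by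
    rw [jacobiator, L.jacobi]
    exact zero_mem _
  refine ⟨quotLie L.bracket hI ha hj, ⟨quotLieπ hI ha hj, quotLieπ_mul hI ha hj⟩,
    quotLieπ_surjective hI ha hj,
    fun x hx => (quotLieπ_eq_zero hI ha hj).2 (subset_idealSpan _ _ hx), fun h f hf => ?_⟩
  obtain ⟨g, hg⟩ := exists_quotLie_desc hI ha hj f.hom f.bracket_hom
    (idealSpan_le_ker f.bracket_hom hf)
  exact ⟨g, LieObj.hom_ext hg⟩

/-- Every dg vector space generates a free dg Lie algebra. -/
lemma DGLA.exists_free (V : DGVec k) : ∃ (L : DGLA k) (η : V ⟶ L.X),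
    ∀ (h : DGLA k) (f : V ⟶ h.X), ∃! g : L ⟶ h, η ≫ g.hom = f := by
  let S : Set (freeMag V).carrier :=
    Set.range (antisymmetrizer (freeMul V)).lin ∪ Set.range (jacobiator (freeMul V)).lin
  have hI := idealSpan_isDGIdeal (freeMul V) S
  have hS := subset_idealSpan (freeMul V) S
  have ha : ∀ t, (antisymmetrizer (freeMul V)).lin t ∈ idealSpan (freeMul V) S :=
    fun t => hS (Or.inl ⟨t, rfl⟩)
  have hj : ∀ t, (jacobiator (freeMul V)).lin t ∈ idealSpan (freeMul V) S :=
    fun t => hS (Or.inr ⟨t, rfl⟩)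
  refine ⟨quotLie (freeMul V) hI ha hj, sumι (treePow V) (.of ()) ≫ quotLieπ hI ha hj,
    fun h f => ?_⟩
  have hm := freeMul_treeEval h.bracket f
  obtain ⟨g, hg⟩ := exists_quotLie_desc hI ha hj (sumDesc (treeEval h.bracket f)) hm
    (idealSpan_le_ker hm (by
      rintro _ (⟨t, rfl⟩ | ⟨t, rfl⟩)
      -- Evaluation of trees sends the defect of grafting to the defect of the bracket of h, which
      -- vanishes.
      · have h₁ := antisymmetrizer_natural hm
        rw [antisymmetrizer, h.antisymm, neg_add_cancel, Limits.comp_zero] at h₁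
        exact (LinearMap.congr_fun (congrArg Hom.lin h₁) t).symm
      · have h₁ := jacobiator_natural hm
        rw [jacobiator, h.jacobi, Limits.comp_zero] at h₁
        exact (LinearMap.congr_fun (congrArg Hom.lin h₁) t).symm))
  refine ⟨g, ?_, fun g' hg' => LieObj.hom_ext
    (cancel_surjective (quotLieπ_surjective hI ha hj) ?_)⟩
  · change (_ ≫ _) ≫ g.hom = f
    rw [Category.assoc, hg, sumι_desc]
    rfl
  -- Uniqueness: pulled back along the quotient map, Lie morphisms become multiplicative maps on the
  -- tree sum, so agreement on the one-leaf tree suffices.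
  · have key : ∀ φ : quotLie (freeMul V) hI ha hj ⟶ h, freeMul V ≫ quotLieπ hI ha hj ≫ φ.hom =
        ((quotLieπ hI ha hj ≫ φ.hom) ⊗ₘ (quotLieπ hI ha hj ≫ φ.hom)) ≫ h.bracket := fun φ => by
      rw [← tensorHom_comp_tensorHom, Category.assoc, ← φ.bracket_hom, ← Category.assoc,
        quotLieπ_mul, Category.assoc]
    refine freeMag_hom_ext (key g') (key g) ?_
    rw [hg, sumι_desc, ← Category.assoc]
    exact hg'

/-- The free dg Lie algebra on a dg vector space. -/
def freeLie (V : DGVec k) : DGLA k := (DGLA.exists_free V).choose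

/-- The inclusion of the generators. -/
def freeLieι (V : DGVec k) : V ⟶ (freeLie V).X := (DGLA.exists_free V).choose_spec.choose

lemma freeLie_existsUnique {V : DGVec k} {h : DGLA k} (f : V ⟶ h.X) :
    ∃! g : freeLie V ⟶ h, freeLieι V ≫ g.hom = f :=
  (DGLA.exists_free V).choose_spec.choose_spec h f

/-- The universal property of the free dg Lie algebra. -/
def freeLieEquiv (V : DGVec k) (h : DGLA k) :
    (freeLie V ⟶ h) ≃ (V ⟶ (LieObj.forget (DGVec k)).obj h) :=
  Equiv.ofBijective (fun g => freeLieι V ≫ g.hom)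
    (Function.bijective_iff_existsUnique _ |>.2 fun f => freeLie_existsUnique f)

/-- The adjunction between free dg Lie algebras and the forgetful functor. -/
def freeLieAdj : Adjunction.leftAdjointOfEquiv (F_obj := freeLie (k := k))
    (G := LieObj.forget (DGVec k)) freeLieEquiv (fun V h h' f g =>
      (Category.assoc (freeLieι V) g.hom f.hom).symm) ⊣ LieObj.forget (DGVec k) :=
  Adjunction.adjunctionOfEquivLeft _ _

end Quotient

end

/-! ### Iterated comultiplications, subcoalgebras, and pruning of trees. -/

noncomputable section

section Iterated

variable {𝒱 : Type w} [Category.{v} 𝒱] [MonoidalCategory 𝒱]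

/-- The tensor power of a morphism. -/
def tensorPowMap {X Y : 𝒱} (f : X ⟶ Y) : (n : ℕ) → (tensorPow X n ⟶ tensorPow Y n)
  | 0 => f
  | n + 1 => tensorPowMap f n ⊗ₘ f

/-- Applied to the inclusion of a subcoalgebra, this transfers conilpotence from the ambient
coproduct. -/
lemma iterComul_natural {X Y : 𝒱} {Δ : X ⟶ X ⊗ X} {Δ' : Y ⟶ Y ⊗ Y} {f : X ⟶ Y}
    (h : f ≫ Δ' = Δ ≫ (f ⊗ₘ f)) (n : ℕ) :
    f ≫ iterComul Δ' n = iterComul Δ n ≫ tensorPowMap f n := by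
  induction n with
  | zero => exact (Category.comp_id f).trans (Category.id_comp f).symm
  | succ n ih =>
    change f ≫ Δ' ≫ iterComul Δ' n ▷ Y = (Δ ≫ iterComul Δ n ▷ X) ≫ (tensorPowMap f n ⊗ₘ f)
    rw [reassoc_of% h, Category.assoc, ← tensorHom_id, ← tensorHom_id, tensorHom_comp_tensorHom,
      tensorHom_comp_tensorHom, ih, Category.comp_id, Category.id_comp]

/-- By coassociativity, iterating a comultiplication on both factors is iterating it on one. -/
lemma exists_comul_iterComul_tensor {X : 𝒱} {Δ : X ⟶ X ⊗ X}
    (h : Δ ≫ Δ ▷ X ≫ (α_ X X X).hom = Δ ≫ X ◁ Δ) (m n : ℕ) :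
    ∃ s : tensorPow X (m + n + 1) ⟶ tensorPow X m ⊗ tensorPow X n,
      Δ ≫ (iterComul Δ m ⊗ₘ iterComul Δ n) = iterComul Δ (m + n + 1) ≫ s := by
  induction n with
  | zero =>
    refine ⟨𝟙 _, ?_⟩
    change Δ ≫ (iterComul Δ m ⊗ₘ 𝟙 X) = (Δ ≫ iterComul Δ m ▷ X) ≫ 𝟙 _
    rw [tensorHom_id, Category.comp_id]
  | succ n ih =>
    obtain ⟨s, hs⟩ := ih
    refine ⟨s ▷ X ≫ (α_ _ _ _).hom, ?_⟩
    change Δ ≫ (iterComul Δ m ⊗ₘ (Δ ≫ iterComul Δ n ▷ X)) =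
      (Δ ≫ iterComul Δ (m + n + 1) ▷ X) ≫ s ▷ X ≫ (α_ _ _ _).hom
    -- Isolating the extra Δ on the right factor lets coassociativity move it to the left factor,
    -- where the induction hypothesis applies.
    have h₁ : (iterComul Δ m ⊗ₘ (Δ ≫ iterComul Δ n ▷ X)) =
        X ◁ Δ ≫ (iterComul Δ m ⊗ₘ (iterComul Δ n ⊗ₘ 𝟙 X)) := by
      rw [← id_tensorHom, tensorHom_comp_tensorHom, Category.id_comp, tensorHom_id]
    rw [h₁, ← reassoc_of% h, ← associator_naturality, Category.assoc, ← comp_whiskerRight_assoc,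
      ← hs, comp_whiskerRight_assoc, tensorHom_id]

end Iterated

/-- There is a single kind of leaf, and a graft with at most n + 1 leaves has both subtrees with at
most n, since each subtree has a leaf. -/
lemma FreeMagma.finite_length_le (n : ℕ) : {t : FreeMagma Unit | t.length ≤ n}.Finite := by
  induction n with
  | zero =>
    refine Set.Finite.subset Set.finite_empty fun t ht => ?_
    have := FreeMagma.length_pos t
    simp only [Set.mem_ofPred_eq] at ht
    omega
  | succ n ih =>
    refine ((Set.finite_singleton (FreeMagma.of ())).union (ih.image2 FreeMagma.mul ih)).subset ?_
    rintro (_ | ⟨a, b⟩) ht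
    · exact Or.inl rfl
    · have ha := FreeMagma.length_pos a
      have hb := FreeMagma.length_pos b
      have hab : a.length + b.length ≤ n + 1 := ht
      exact Or.inr ⟨a, by simp only [Set.mem_ofPred_eq]; omega, b,
        by simp only [Set.mem_ofPred_eq]; omega, rfl⟩

namespace DGVec

variable {k : Type u} [Field k]

lemma tensorPowMap_injective {V W : DGVec k} {f : V ⟶ W} (hf : Function.Injective f.lin) (n : ℕ) :
    Function.Injective (tensorPowMap f n).lin := by
  induction n with
  | zero => exact hf
  | succ n ih => exact tensorHom_injective ih hf

/-- Submodules stable under a comultiplication. -/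
structure IsDGSubcoalgebra {X : DGVec k} (Δ : X ⟶ X ⊗ X) (D : Submodule k X.carrier) : Prop where
  isDGSubmodule : IsDGSubmodule X D
  comul_mem : ∀ x ∈ D, Δ.lin x ∈ LinearMap.range (TensorProduct.map D.subtype D.subtype)

section Subcoalgebra

variable {X : DGVec k} {Δ : X ⟶ X ⊗ X}

/-- Subcoalgebras are closed under sums because D ⊗ D maps into the tensor square of any larger
subspace. Hence a largest one inside a given subspace exists. -/
lemma isDGSubcoalgebra_sSup (S : Set (Submodule k X.carrier))
    (h : ∀ D ∈ S, IsDGSubcoalgebra Δ D) : IsDGSubcoalgebra Δ (sSup S) where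
  isDGSubmodule := isDGSubmodule_sSup _ _ fun D hD => (h D hD).isDGSubmodule
  comul_mem := by
    change sSup S ≤ (LinearMap.range (TensorProduct.map (sSup S).subtype (sSup S).subtype)).comap
      Δ.lin
    refine sSup_le fun D hD x hx => ?_
    obtain ⟨t, ht⟩ := (h D hD).comul_mem x hx
    have hle := le_sSup hD
    refine ⟨TensorProduct.map (Submodule.inclusion hle) (Submodule.inclusion hle) t, ?_⟩
    rw [← ht, ← LinearMap.comp_apply, ← TensorProduct.map_comp]
    rfl

lemma isDGSubcoalgebra_range {Y : DGVec k} {Δ' : Y ⟶ Y ⊗ Y} {f : Y ⟶ X}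
    (h : f ≫ Δ = Δ' ≫ (f ⊗ₘ f)) : IsDGSubcoalgebra Δ (LinearMap.range f.lin) where
  isDGSubmodule := isDGSubmodule_range f
  comul_mem := by
    rintro _ ⟨y, rfl⟩
    have h' : Δ.lin (f.lin y) = (f ⊗ₘ f).lin (Δ'.lin y) :=
      LinearMap.congr_fun (congrArg Hom.lin h) y
    refine ⟨TensorProduct.map f.lin.rangeRestrict f.lin.rangeRestrict (Δ'.lin y), ?_⟩
    rw [h', ← LinearMap.comp_apply, ← TensorProduct.map_comp]
    rfl

variable (Δ) in
/-- The largest subcoalgebra contained in a submodule. -/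
def largestSub (K : Submodule k X.carrier) : Submodule k X.carrier :=
  sSup {D | IsDGSubcoalgebra Δ D ∧ D ≤ K}

lemma largestSub_isDGSubcoalgebra (K : Submodule k X.carrier) :
    IsDGSubcoalgebra Δ (largestSub Δ K) := isDGSubcoalgebra_sSup _ fun D hD => hD.1

lemma largestSub_le (K : Submodule k X.carrier) : largestSub Δ K ≤ K := sSup_le fun D hD => hD.2

/-- The image of a comultiplicative map is a subcoalgebra, so a merely linear condition on its
values already forces it into the largest subcoalgebra of K. -/
lemma range_le_largestSub {K : Submodule k X.carrier} {Y : DGVec k} {Δ' : Y ⟶ Y ⊗ Y} {f : Y ⟶ X}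
    (h : f ≫ Δ = Δ' ≫ (f ⊗ₘ f)) (hK : ∀ y, f.lin y ∈ K) (y : Y.carrier) :
    f.lin y ∈ largestSub Δ K :=
  have hle : LinearMap.range f.lin ≤ largestSub Δ K :=
    le_sSup ⟨isDGSubcoalgebra_range h, by rintro _ ⟨y, rfl⟩; exact hK y⟩
  hle ⟨y, rfl⟩

/-- Over a field D ⊗ D embeds in X ⊗ X, so the restricted comultiplication lifts to it as a dg map.
-/
lemma exists_sub_comul {D : Submodule k X.carrier} (hD : IsDGSubcoalgebra Δ D) :
    ∃ δ : sub hD.isDGSubmodule ⟶ sub hD.isDGSubmodule ⊗ sub hD.isDGSubmodule,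
      δ ≫ (subι hD.isDGSubmodule ⊗ₘ subι hD.isDGSubmodule) = subι hD.isDGSubmodule ≫ Δ :=
  exists_lift_of_injective _ (tensorHom_injective (subι_injective _) (subι_injective _)) _
    fun x => hD.comul_mem x.1 x.2

/-- A subcoalgebra on which the comultiplication is coassociative, cocommutative and conilpotent, as
an object of `cCDGA`. -/
def subCoalgebra {D : Submodule k X.carrier} (hD : IsDGSubcoalgebra Δ D)
    (ha : subι hD.isDGSubmodule ≫ Δ ≫ Δ ▷ X ≫ (α_ X X X).hom =
      subι hD.isDGSubmodule ≫ Δ ≫ X ◁ Δ)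
    (hc : subι hD.isDGSubmodule ≫ Δ ≫ (β_ X X).hom = subι hD.isDGSubmodule ≫ Δ)
    (hn : ∀ x, ∃ n, (iterComul Δ n).lin x = 0) : cCDGA k where
  X := sub hD.isDGSubmodule
  comul := (exists_sub_comul hD).choose
  coassoc := by
    have hi := subι_injective hD.isDGSubmodule
    have h := (exists_sub_comul hD).choose_spec
    -- The identity is tested in the tensor cube of X, into which that of D embeds; there it is the
    -- assumption `ha`.
    refine cancel_injective (tensorHom_injective hi (tensorHom_injective hi hi)) ?_
    rw [Category.assoc, Category.assoc, Category.assoc, ← associator_naturality, ← id_tensorHom,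
      ← tensorHom_id, tensorHom_comp_tensorHom_assoc, tensorHom_comp_tensorHom, h]
    have h₁ : ((subι hD.isDGSubmodule ≫ Δ) ⊗ₘ (𝟙 _ ≫ subι hD.isDGSubmodule)) =
        (subι hD.isDGSubmodule ⊗ₘ subι hD.isDGSubmodule) ≫ Δ ▷ X := by
      rw [← tensorHom_id, tensorHom_comp_tensorHom, Category.id_comp, Category.comp_id]
    have h₂ : ((𝟙 _ ≫ subι hD.isDGSubmodule) ⊗ₘ (subι hD.isDGSubmodule ≫ Δ)) =
        (subι hD.isDGSubmodule ⊗ₘ subι hD.isDGSubmodule) ≫ X ◁ Δ := by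
      rw [← id_tensorHom, tensorHom_comp_tensorHom, Category.id_comp, Category.comp_id]
    rw [h₁, h₂, Category.assoc, reassoc_of% h, reassoc_of% h, ha]
  cocomm := by
    have hi := subι_injective hD.isDGSubmodule
    have h := (exists_sub_comul hD).choose_spec
    refine cancel_injective (tensorHom_injective hi hi) ?_
    rw [Category.assoc, ← BraidedCategory.braiding_naturality, reassoc_of% h, hc, h]
  conilp x := by
    have h := (exists_sub_comul hD).choose_spec
    obtain ⟨n, hn⟩ := hn x.1
    -- The same n works as in X, because the tensor powers of the inclusion are injective.
    refine ⟨n, tensorPowMap_injective (subι_injective hD.isDGSubmodule) n ?_⟩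
    rw [map_zero]
    have h' := iterComul_natural h.symm n
    exact (LinearMap.congr_fun (congrArg Hom.lin h') x).symm.trans hn

section Inclusion

variable {D : Submodule k X.carrier} (hD : IsDGSubcoalgebra Δ D)
    (ha : subι hD.isDGSubmodule ≫ Δ ≫ Δ ▷ X ≫ (α_ X X X).hom =
      subι hD.isDGSubmodule ≫ Δ ≫ X ◁ Δ)
    (hc : subι hD.isDGSubmodule ≫ Δ ≫ (β_ X X).hom = subι hD.isDGSubmodule ≫ Δ)
    (hn : ∀ x, ∃ n, (iterComul Δ n).lin x = 0)

/-- The inclusion of `subCoalgebra`. -/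
def subCoalgebraι : (subCoalgebra hD ha hc hn).X ⟶ X := subι hD.isDGSubmodule

lemma subCoalgebraι_injective : Function.Injective (subCoalgebraι hD ha hc hn).lin :=
  subι_injective hD.isDGSubmodule

lemma subCoalgebraι_mem (x : (subCoalgebra hD ha hc hn).X.carrier) :
    (subCoalgebraι hD ha hc hn).lin x ∈ D := Subtype.property x

lemma subCoalgebraι_comul : subCoalgebraι hD ha hc hn ≫ Δ = (subCoalgebra hD ha hc hn).comul ≫
    (subCoalgebraι hD ha hc hn ⊗ₘ subCoalgebraι hD ha hc hn) :=
  (exists_sub_comul hD).choose_spec.symm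

lemma exists_subCoalgebra_lift {C : cCDGA k} (f : C.X ⟶ X) (hf : f ≫ Δ = C.comul ≫ (f ⊗ₘ f))
    (hfD : ∀ x, f.lin x ∈ D) : ∃ g : C ⟶ subCoalgebra hD ha hc hn,
      g.hom ≫ subCoalgebraι hD ha hc hn = f := by
  have hi := subCoalgebraι_injective hD ha hc hn
  obtain ⟨g, hg⟩ := exists_lift_of_injective (subCoalgebraι hD ha hc hn) hi f
    fun x => ⟨(⟨f.lin x, hfD x⟩ : D), rfl⟩
  refine ⟨⟨g, cancel_injective (tensorHom_injective hi hi) ?_⟩, hg⟩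
  rw [Category.assoc, Category.assoc, tensorHom_comp_tensorHom, hg, ← hf, ← hg,
    Category.assoc, subCoalgebraι_comul]

end Inclusion

end Subcoalgebra

/-- Pruning of trees at the root. -/
def freeComul (V : DGVec k) : freeMag V ⟶ freeMag V ⊗ freeMag V :=
  sumDesc fun
    | .of _ => 0
    | .mul a b => sumι (treePow V) a ⊗ₘ sumι (treePow V) b

/-- Each iteration prunes the left factor, whose tree is strictly shorter, and a leaf has
comultiplication zero. Every tree has at least one leaf, so the case n = 0 is vacuous. -/
lemma sumι_iterComul_freeComul (V : DGVec k) (n : ℕ) : ∀ t : FreeMagma Unit, t.length ≤ n →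
    sumι (treePow V) t ≫ iterComul (freeComul V) n = 0 := by
  induction n with
  | zero =>
    intro t ht
    have := FreeMagma.length_pos t
    omega
  | succ n ih =>
    rintro (_ | ⟨a, b⟩) ht
    · rw [iterComul_succ, freeComul, ← Category.assoc, sumι_desc]
      exact Limits.zero_comp
    · have hb := FreeMagma.length_pos b
      have hab : a.length + b.length ≤ n + 1 := ht
      have h : sumι (treePow V) (.mul a b) ≫ freeComul V =
        sumι (treePow V) a ⊗ₘ sumι (treePow V) b := sumι_desc _ _
      rw [iterComul_succ, reassoc_of% h, ← tensorHom_id, tensorHom_comp_tensorHom,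
        ih a (by omega)]
      exact MonoidalPreadditive.zero_tensor _

lemma freeComul_conilp (V : DGVec k) (x : (freeMag V).carrier) :
    ∃ n, (iterComul (freeComul V) n).lin x = 0 := by
  obtain ⟨s, hs⟩ := exists_sum_sumι x
  -- The longest of the finitely many trees involved bounds the order of nilpotence.
  refine ⟨s.sup FreeMagma.length, ?_⟩
  rw [hs, map_sum]
  refine Finset.sum_eq_zero fun t ht => ?_
  exact LinearMap.congr_fun (congrArg Hom.lin (sumι_iterComul_freeComul V _ t
    (Finset.le_sup (f := FreeMagma.length) ht))) _

/-- Pruning described by its components rather than on summands, the form needed for maps into the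
tree sum. -/
lemma freeComul_π (V : DGVec k) (a b : FreeMagma Unit) :
    freeComul V ≫ (sumπ (treePow V) a ⊗ₘ sumπ (treePow V) b) = sumπ (treePow V) (.mul a b) := by
  refine sum_hom_ext fun t => ?_
  rw [freeComul, ← Category.assoc, sumι_desc]
  rcases t with _ | ⟨a', b'⟩
  · rw [sumι_π_ne _ (by simp)]
    exact Limits.zero_comp
  · change (sumι (treePow V) a' ⊗ₘ sumι (treePow V) b') ≫ _ = _
    rw [tensorHom_comp_tensorHom]
    by_cases ha : a' = a
    · by_cases hb : b' = b
      · subst ha hb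
        rw [sumι_π_same, sumι_π_same, sumι_π_same, id_tensorHom_id]
      · have hne : FreeMagma.mul a' b' ≠ .mul a b := fun h => by injection h; exact hb ‹_›
        rw [sumι_π_ne _ hb, sumι_π_ne _ hne]
        exact MonoidalPreadditive.tensor_zero _
    · have hne : FreeMagma.mul a' b' ≠ .mul a b := fun h => by injection h; exact ha ‹_›
      rw [sumι_π_ne _ ha, sumι_π_ne _ hne]
      exact MonoidalPreadditive.zero_tensor _

/-- The component at a tree of the extension of `f : X ⟶ V` to the cofree coproduct. -/
def treeCoeval {V X : DGVec k} (Δ : X ⟶ X ⊗ X) (f : X ⟶ V) :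
    (t : FreeMagma Unit) → (X ⟶ treePow V t)
  | .of _ => f
  | .mul a b => Δ ≫ (treeCoeval Δ f a ⊗ₘ treeCoeval Δ f b)

/-- By coassociativity the shape of the tree does not matter for the factorisation, only the number
of leaves: n + 1 leaves correspond to n comultiplications. -/
lemma exists_treeCoeval {V X : DGVec k} {Δ : X ⟶ X ⊗ X} (f : X ⟶ V)
    (h : Δ ≫ Δ ▷ X ≫ (α_ X X X).hom = Δ ≫ X ◁ Δ) (t : FreeMagma Unit) :
    ∃ n, t.length = n + 1 ∧ ∃ s : tensorPow X n ⟶ treePow V t,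
      treeCoeval Δ f t = iterComul Δ n ≫ s := by
  induction t with
  | ih1 t => exact ⟨0, rfl, f, (Category.id_comp f).symm⟩
  | ih2 a b iha ihb =>
    obtain ⟨m, hm, s, hs⟩ := iha
    obtain ⟨n, hn, s', hs'⟩ := ihb
    obtain ⟨r, hr⟩ := exists_comul_iterComul_tensor h m n
    refine ⟨m + n + 1, ?_, r ≫ (s ⊗ₘ s'), ?_⟩
    · change a.length + b.length = _
      omega
    · change Δ ≫ (treeCoeval Δ f a ⊗ₘ treeCoeval Δ f b) = _
      rw [hs, hs', ← tensorHom_comp_tensorHom, reassoc_of% hr]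

/-- This is where conilpotence is used. If Δ^N kills x, then a tree with more than N leaves has n +
1 > N leaves, so its component factors through Δ^n with n ≥ N and kills x too; only finitely many
trees are left. -/
lemma treeCoeval_finite {V : DGVec k} (C : cCDGA k) (f : C.X ⟶ V) (x : C.X.carrier) :
    {t | (treeCoeval C.comul f t).lin x ≠ 0}.Finite := by
  obtain ⟨N, hN⟩ := C.conilp x
  refine (FreeMagma.finite_length_le N).subset fun t ht => ?_
  by_contra hlt
  simp only [Set.mem_ofPred_eq] at hlt
  obtain ⟨n, hn, s, hs⟩ := exists_treeCoeval f C.coassoc t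
  refine ht ?_
  rw [hs, comp_lin, LinearMap.comp_apply, C.iterComul_eq_zero_of_le x (by omega) hN, map_zero]

lemma treeCoeval_comul {V : DGVec k} (C : cCDGA k) (f : C.X ⟶ V) :
    sumLift (treeCoeval C.comul f) (treeCoeval_finite C f) ≫ freeComul V =
      C.comul ≫ (sumLift (treeCoeval C.comul f) (treeCoeval_finite C f) ⊗ₘ
        sumLift (treeCoeval C.comul f) (treeCoeval_finite C f)) := by
  refine hom_tensor_sum_ext fun a b => ?_
  rw [Category.assoc, Category.assoc, freeComul_π, sumLift_π, tensorHom_comp_tensorHom, sumLift_π,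
    sumLift_π]
  rfl

/-- Dual to `freeMag_hom_ext`: the component at a graft is determined by those at the two subtrees.
-/
lemma hom_freeMag_ext {V X : DGVec k} {Δ : X ⟶ X ⊗ X} {f g : X ⟶ freeMag V}
    (hf : f ≫ freeComul V = Δ ≫ (f ⊗ₘ f)) (hg : g ≫ freeComul V = Δ ≫ (g ⊗ₘ g))
    (h : f ≫ sumπ (treePow V) (.of ()) = g ≫ sumπ (treePow V) (.of ())) : f = g := by
  refine hom_sum_ext fun t => ?_
  induction t with
  | ih1 t => exact h
  | ih2 a b iha ihb =>
    have key : ∀ φ : X ⟶ freeMag V, φ ≫ freeComul V = Δ ≫ (φ ⊗ₘ φ) →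
        φ ≫ sumπ (treePow V) (.mul a b) =
          Δ ≫ ((φ ≫ sumπ (treePow V) a) ⊗ₘ (φ ≫ sumπ (treePow V) b)) := by
      intro φ hφ
      rw [← tensorHom_comp_tensorHom, ← reassoc_of% hφ, freeComul_π]
    exact (key f hf).trans ((by rw [iha, ihb] : _ = _).trans (key g hg).symm)

end DGVec

/-! ### Universal subcoalgebras and the cofree conilpotent cocommutative coalgebra. -/

section Cofree

variable {k : Type u} [Field k]

open DGVec

/-- Every linear condition on a coalgebra defines a universal subcoalgebra. -/
lemma cCDGA.exists_largest_sub (C : cCDGA k) {W : DGVec k} (r : C.X ⟶ W) :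
    ∃ (E : cCDGA k) (i : E ⟶ C), Function.Injective i.hom.lin ∧ i.hom ≫ r = 0 ∧
      ∀ (D : cCDGA k) (f : D ⟶ C), f.hom ≫ r = 0 → ∃ g : D ⟶ E, g ≫ i = f := by
  have hD := largestSub_isDGSubcoalgebra (Δ := C.comul) (LinearMap.ker r.lin)
  have ha := congrArg (subι hD.isDGSubmodule ≫ ·) C.coassoc
  have hc := congrArg (subι hD.isDGSubmodule ≫ ·) C.cocomm
  refine ⟨subCoalgebra hD ha hc C.conilp,
    ⟨subCoalgebraι hD ha hc C.conilp, subCoalgebraι_comul hD ha hc C.conilp⟩,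
    subCoalgebraι_injective hD ha hc C.conilp, DGVec.hom_ext (LinearMap.ext fun x => ?_),
    fun D f hf => ?_⟩
  · exact largestSub_le (LinearMap.ker r.lin) (subCoalgebraι_mem hD ha hc C.conilp x)
  · obtain ⟨g, hg⟩ := exists_subCoalgebra_lift hD ha hc C.conilp f.hom f.hom_comul
      (range_le_largestSub f.hom_comul
        fun y => LinearMap.congr_fun (congrArg Hom.lin hf) y)
    exact ⟨g, cCDGA.hom_ext hg⟩

/-- Every dg vector space cogenerates a cofree conilpotent cocommutative coalgebra. -/
lemma cCDGA.exists_cofree (V : DGVec k) : ∃ (E : cCDGA k) (ε : E.X ⟶ V),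
    ∀ (C : cCDGA k) (f : C.X ⟶ V), ∃! g : C ⟶ E, g.hom ≫ ε = f := by
  set Δ := freeComul V with hΔ
  -- Pruning need not be coassociative or cocommutative; the cofree object is the largest
  -- subcoalgebra on which both defects vanish. No description by symmetric tensors is needed.
  let ra := Δ ≫ Δ ▷ freeMag V ≫ (α_ _ _ _).hom - Δ ≫ freeMag V ◁ Δ
  let rc := Δ ≫ (β_ _ _).hom - Δ
  have hD := largestSub_isDGSubcoalgebra (Δ := Δ) (LinearMap.ker ra.lin ⊓ LinearMap.ker rc.lin)
  have hle := largestSub_le (Δ := Δ) (LinearMap.ker ra.lin ⊓ LinearMap.ker rc.lin)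
  have ha : subι hD.isDGSubmodule ≫ ra = 0 :=
    DGVec.hom_ext (LinearMap.ext fun x => LinearMap.mem_ker.1 (hle x.2).1)
  have hc : subι hD.isDGSubmodule ≫ rc = 0 :=
    DGVec.hom_ext (LinearMap.ext fun x => LinearMap.mem_ker.1 (hle x.2).2)
  rw [Preadditive.comp_sub, sub_eq_zero] at ha hc
  have hn := freeComul_conilp V
  refine ⟨subCoalgebra hD ha hc hn,
    subCoalgebraι hD ha hc hn ≫ sumπ (treePow V) (.of ()), fun C f => ?_⟩
  set φ := sumLift (treeCoeval C.comul f) (treeCoeval_finite C f) with hφ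
  have hφΔ : φ ≫ Δ = C.comul ≫ (φ ⊗ₘ φ) := treeCoeval_comul C f
  -- The defects are natural along comultiplicative maps, and those of C are zero; hence φ factors
  -- through the subcoalgebra.
  have hφa : φ ≫ ra = 0 := by
    have h₁ : (φ ⊗ₘ φ) ≫ Δ ▷ freeMag V = C.comul ▷ C.X ≫ ((φ ⊗ₘ φ) ⊗ₘ φ) := by
      rw [← tensorHom_id, ← tensorHom_id, tensorHom_comp_tensorHom, tensorHom_comp_tensorHom, hφΔ,
        Category.id_comp, Category.comp_id]
    have h₂ : (φ ⊗ₘ φ) ≫ freeMag V ◁ Δ = C.X ◁ C.comul ≫ (φ ⊗ₘ (φ ⊗ₘ φ)) := by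
      rw [← id_tensorHom, ← id_tensorHom, tensorHom_comp_tensorHom, tensorHom_comp_tensorHom, hφΔ,
        Category.id_comp, Category.comp_id]
    rw [Preadditive.comp_sub, sub_eq_zero, reassoc_of% hφΔ, reassoc_of% hφΔ, reassoc_of% h₁, h₂,
      associator_naturality, reassoc_of% C.coassoc]
  have hφc : φ ≫ rc = 0 := by
    rw [Preadditive.comp_sub, sub_eq_zero, reassoc_of% hφΔ, BraidedCategory.braiding_naturality,
      reassoc_of% C.cocomm, hφΔ]
  have hφK : ∀ y, φ.lin y ∈ LinearMap.ker ra.lin ⊓ LinearMap.ker rc.lin := fun y =>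
    Submodule.mem_inf.2 ⟨LinearMap.congr_fun (congrArg Hom.lin hφa) y,
      LinearMap.congr_fun (congrArg Hom.lin hφc) y⟩
  obtain ⟨g, hg⟩ := exists_subCoalgebra_lift hD ha hc hn φ hφΔ (range_le_largestSub hφΔ hφK)
  refine ⟨g, ?_, fun g' hg' => cCDGA.hom_ext
    (cancel_injective (subCoalgebraι_injective hD ha hc hn) ?_)⟩
  · change g.hom ≫ _ ≫ _ = f
    rw [← Category.assoc, hg, hφ, sumLift_π]
    rfl
  -- Any competing morphism becomes comultiplicative into the tree sum after inclusion, so its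
  -- component at the one-leaf tree determines it.
  · refine (hom_freeMag_ext (Δ := C.comul) ?_ hφΔ ?_).trans hg.symm
    · rw [Category.assoc, ← hΔ, subCoalgebraι_comul, reassoc_of% g'.hom_comul,
        tensorHom_comp_tensorHom]
    · rw [hφ, sumLift_π, Category.assoc]
      exact hg'

/-- The cofree conilpotent cocommutative coalgebra on a dg vector space. -/
def cofree (V : DGVec k) : cCDGA k := (cCDGA.exists_cofree V).choose

/-- The projection to the cogenerators. -/
def cofreeπ (V : DGVec k) : (cofree V).X ⟶ V := (cCDGA.exists_cofree V).choose_spec.choose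

lemma cofree_existsUnique {V : DGVec k} {C : cCDGA k} (f : C.X ⟶ V) :
    ∃! g : C ⟶ cofree V, g.hom ≫ cofreeπ V = f :=
  (cCDGA.exists_cofree V).choose_spec.choose_spec C f

/-- The universal property of the cofree coalgebra. -/
def cofreeEquiv (C : cCDGA k) (V : DGVec k) :
    ((cCDGA.forget k).obj C ⟶ V) ≃ (C ⟶ cofree V) :=
  (Equiv.ofBijective (fun g : C ⟶ cofree V => g.hom ≫ cofreeπ V)
    (Function.bijective_iff_existsUnique _ |>.2 fun f => cofree_existsUnique f)).symm

lemma cofreeEquiv_symm_naturality {C D : cCDGA k} {V : DGVec k} (f : C ⟶ D) (g : D ⟶ cofree V) :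
    (cofreeEquiv C V).symm (f ≫ g) = f.hom ≫ (cofreeEquiv D V).symm g :=
  Category.assoc f.hom g.hom (cofreeπ V)

/-- The adjunction between the forgetful functor and cofree coalgebras. -/
def cofreeAdj : cCDGA.forget k ⊣ Adjunction.rightAdjointOfEquiv (F := cCDGA.forget k)
    (G_obj := cofree (k := k)) cofreeEquiv (fun C D V f g => by
      refine (cofreeEquiv C V).symm.injective ?_
      rw [Equiv.symm_apply_apply, cofreeEquiv_symm_naturality, Equiv.symm_apply_apply]
      rfl) :=
  Adjunction.adjunctionOfEquivRight _ _

end Cofree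

end

/-! ### Measurings and their defects. -/

noncomputable section

section Closed

variable {𝒱 : Type w} [Category.{v} 𝒱] [MonoidalCategory 𝒱]

lemma MonoidalClosed.curry_zero [Preadditive 𝒱] [MonoidalPreadditive 𝒱] [MonoidalClosed 𝒱]
    (X Y Z : 𝒱) : MonoidalClosed.curry (0 : X ⊗ Y ⟶ Z) = 0 := by
  apply MonoidalClosed.uncurry_injective
  rw [MonoidalClosed.uncurry_curry, MonoidalClosed.uncurry_eq, MonoidalPreadditive.whiskerLeft_zero,
    Limits.zero_comp]

/-- The coherence computation behind composing measurings. By `tensor_associativity` the interchange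
for C ⊗ D splits into the one for D followed by the one for C, so the two comultiplications can be
applied in succession. -/
lemma tensorComul_whiskerRight_tensorμ [SymmetricCategory 𝒱] {C D : 𝒱} (Δ : C ⟶ C ⊗ C)
    (Δ' : D ⟶ D ⊗ D) {X Y L : 𝒱} (m : D ⊗ X ⟶ L) (n : C ⊗ L ⟶ Y) :
    tensorComul Δ Δ' ▷ (X ⊗ X) ≫ tensorμ (C ⊗ D) (C ⊗ D) X X ≫
        (((α_ C D X).hom ≫ C ◁ m ≫ n) ⊗ₘ ((α_ C D X).hom ≫ C ◁ m ≫ n)) =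
      (α_ C D (X ⊗ X)).hom ≫ C ◁ (Δ' ▷ (X ⊗ X) ≫ tensorμ D D X X ≫ (m ⊗ₘ m)) ≫
        Δ ▷ (L ⊗ L) ≫ tensorμ C C L L ≫ (n ⊗ₘ n) := by
  have h₁ := tensor_associativity C C D D X X
  have h₂ : (C ⊗ C) ◁ (m ⊗ₘ m) ≫ tensorμ C C L L = tensorμ C C (D ⊗ X) (D ⊗ X) ≫
      (C ◁ m ⊗ₘ C ◁ m) := by
    have := tensorμ_natural (𝟙 C) (𝟙 C) m m
    simpa using this
  have h₃ : (Δ ⊗ₘ Δ') ▷ (X ⊗ X) ≫ (α_ (C ⊗ C) (D ⊗ D) (X ⊗ X)).hom =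
      (α_ C D (X ⊗ X)).hom ≫ (Δ ⊗ₘ (Δ' ▷ (X ⊗ X))) := by
    rw [← tensorHom_id, associator_naturality, tensorHom_id]
  rw [tensorComul, comp_whiskerRight, ← tensorHom_comp_tensorHom, ← tensorHom_comp_tensorHom]
  simp only [Category.assoc]
  rw [reassoc_of% h₁, reassoc_of% h₃, whisker_exchange_assoc, MonoidalCategory.whiskerLeft_comp,
    MonoidalCategory.whiskerLeft_comp]
  simp only [Category.assoc]
  rw [reassoc_of% h₂, MonoidalCategory.tensorHom_def]
  simp only [Category.assoc]

end Closed

variable {k : Type u} [Field k]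

/-- Measurings `C ⊗ g ⟶ h`: dg linear maps compatible with the brackets through the
comultiplication of `C`. -/
def IsMeasuring (C : cCDGA k) (g h : DGLA k) (m : C.X ⊗ g.X ⟶ h.X) : Prop :=
  C.X ◁ g.bracket ≫ m =
    C.comul ▷ (g.X ⊗ g.X) ≫ tensorμ C.X C.X g.X g.X ≫ (m ⊗ₘ m) ≫ h.bracket

/-- The difference of the two sides of the measuring condition. -/
def measuringDefect (C : cCDGA k) (g h : DGLA k) (m : C.X ⊗ g.X ⟶ h.X) :
    C.X ⊗ (g.X ⊗ g.X) ⟶ h.X :=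
  C.X ◁ g.bracket ≫ m -
    C.comul ▷ (g.X ⊗ g.X) ≫ tensorμ C.X C.X g.X g.X ≫ (m ⊗ₘ m) ≫ h.bracket

section Measuring

variable {C D : cCDGA k} {g g' h h' : DGLA k}

lemma isMeasuring_iff_defect {m : C.X ⊗ g.X ⟶ h.X} :
    IsMeasuring C g h m ↔ measuringDefect C g h m = 0 :=
  sub_eq_zero.symm

/-- Although the defect is quadratic in m, a Lie morphism φ turns the condition on m ≫ φ into a
linear one on φ: it must kill the image of a fixed map. So a quotient can impose it. -/
lemma measuringDefect_comp (m : C.X ⊗ g.X ⟶ h.X) (φ : h ⟶ h') :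
    measuringDefect C g h' (m ≫ φ.hom) = measuringDefect C g h m ≫ φ.hom := by
  rw [measuringDefect, measuringDefect, Preadditive.sub_comp]
  simp only [Category.assoc]
  rw [φ.bracket_hom, tensorHom_comp_tensorHom_assoc]

/-- The dual reduction: with φ the identity, the condition on a coalgebra morphism f becomes linear,
so a subcoalgebra can impose it. -/
lemma measuringDefect_pre (f : C ⟶ D) (φ : g ⟶ g') (m : D.X ⊗ g'.X ⟶ h.X) :
    measuringDefect C g h ((f.hom ⊗ₘ φ.hom) ≫ m) =
      (f.hom ⊗ₘ (φ.hom ⊗ₘ φ.hom)) ≫ measuringDefect D g' h m := by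
  have h₁ := tensorμ_natural f.hom f.hom φ.hom φ.hom
  rw [measuringDefect, measuringDefect, Preadditive.comp_sub]
  congr 1
  · rw [← id_tensorHom, ← id_tensorHom, tensorHom_comp_tensorHom_assoc,
      tensorHom_comp_tensorHom_assoc, φ.bracket_hom, Category.id_comp, Category.comp_id]
  · rw [← tensorHom_comp_tensorHom, Category.assoc, ← reassoc_of% h₁, ← tensorHom_id,
      ← tensorHom_id, tensorHom_comp_tensorHom_assoc, tensorHom_comp_tensorHom_assoc, f.hom_comul,
      Category.id_comp, Category.comp_id]

lemma IsMeasuring.comp {m : C.X ⊗ g.X ⟶ h.X} (hm : IsMeasuring C g h m) (φ : h ⟶ h') :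
    IsMeasuring C g h' (m ≫ φ.hom) := by
  rw [isMeasuring_iff_defect] at hm ⊢
  rw [measuringDefect_comp, hm, Limits.zero_comp]

lemma IsMeasuring.pre {m : D.X ⊗ g'.X ⟶ h.X} (hm : IsMeasuring D g' h m) (f : C ⟶ D)
    (φ : g ⟶ g') : IsMeasuring C g h ((f.hom ⊗ₘ φ.hom) ≫ m) := by
  rw [isMeasuring_iff_defect] at hm ⊢
  rw [measuringDefect_pre, hm, Limits.comp_zero]

/-- The right side of the measuring condition is the uncurried form of the convolution bracket
applied to f ⊗ f. -/
lemma isMeasuring_uncurry_iff (f : g.X ⟶ (convAlg C h).X) :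
    IsMeasuring C g h (MonoidalClosed.uncurry f) ↔
      g.bracket ≫ f = (f ⊗ₘ f) ≫ (convAlg C h).bracket := by
  rw [← MonoidalClosed.uncurry_injective.eq_iff, MonoidalClosed.uncurry_natural_left,
    ← Category.assoc, MonoidalClosed.uncurry_natural_right, uncurry_tensorHom_convPairing]
  simp only [Category.assoc]
  rfl

lemma isMeasuring_uncurry (f : g ⟶ convAlg C h) :
    IsMeasuring C g h (MonoidalClosed.uncurry f.hom) :=
  (isMeasuring_uncurry_iff f.hom).2 f.bracket_hom

/-- The morphism into the convolution Lie algebra given by a measuring. -/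
def IsMeasuring.curry {m : C.X ⊗ g.X ⟶ h.X} (hm : IsMeasuring C g h m) : g ⟶ convAlg C h where
  hom := MonoidalClosed.curry m
  bracket_hom := by
    rw [← isMeasuring_uncurry_iff, MonoidalClosed.uncurry_curry]
    exact hm

lemma IsMeasuring.curry_hom {m : C.X ⊗ g.X ⟶ h.X} (hm : IsMeasuring C g h m) :
    hm.curry.hom = MonoidalClosed.curry m := rfl

lemma isMeasuring_ev (C : cCDGA k) (h : DGLA k) :
    IsMeasuring C (convAlg C h) h ((ihom.ev C.X).app h.X) := by
  rw [← MonoidalClosed.uncurry_id_eq_ev]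
  exact isMeasuring_uncurry (𝟙 (convAlg C h))

/-- As n respects brackets, the only failure left is that of m, pushed forward along n. If m is a
measuring this composes measurings; with n the evaluation it gives the converse. -/
lemma measuringDefect_tensor {n : C.X ⊗ g'.X ⟶ h.X} (hn : IsMeasuring C g' h n)
    (m : D.X ⊗ g.X ⟶ g'.X) :
    measuringDefect (cCDGA.tensorObj C D) g h ((α_ C.X D.X g.X).hom ≫ C.X ◁ m ≫ n) =
      (α_ C.X D.X (g.X ⊗ g.X)).hom ≫ C.X ◁ measuringDefect D g g' m ≫ n := by
  have h₁ := tensorComul_whiskerRight_tensorμ C.comul D.comul (X := g.X) m n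
  have h₀ : ∀ {U W : DGVec k} (a b : U ⟶ W), C.X ◁ (a - b) = C.X ◁ a - C.X ◁ b :=
    fun a b => (tensorLeft C.X).map_sub
  rw [measuringDefect, measuringDefect, h₀, Preadditive.sub_comp,
    Preadditive.comp_sub]
  congr 1
  · rw [associator_naturality_right_assoc, MonoidalCategory.whiskerLeft_comp_assoc]
  · rw [reassoc_of% h₁]
    have h₂ := hn
    rw [IsMeasuring] at h₂
    rw [← h₂]
    simp only [MonoidalCategory.whiskerLeft_comp, Category.assoc]

lemma IsMeasuring.tensor {n : C.X ⊗ g'.X ⟶ h.X} (hn : IsMeasuring C g' h n)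
    {m : D.X ⊗ g.X ⟶ g'.X} (hm : IsMeasuring D g g' m) :
    IsMeasuring (cCDGA.tensorObj C D) g h ((α_ C.X D.X g.X).hom ≫ C.X ◁ m ≫ n) := by
  rw [isMeasuring_iff_defect] at hm ⊢
  rw [measuringDefect_tensor hn, hm, MonoidalPreadditive.whiskerLeft_zero, Limits.zero_comp,
    Limits.comp_zero]

/-- A measuring out of a tensor product of coalgebras gives a measuring into the convolution Lie
algebra. -/
lemma IsMeasuring.curry_tensor {m : (C.X ⊗ D.X) ⊗ g.X ⟶ h.X}
    (hm : IsMeasuring (cCDGA.tensorObj C D) g h m) :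
    IsMeasuring D g (convAlg C h) (MonoidalClosed.curry ((α_ C.X D.X g.X).inv ≫ m)) := by
  have h₁ : (α_ C.X D.X g.X).hom ≫ C.X ◁ MonoidalClosed.curry ((α_ C.X D.X g.X).inv ≫ m) ≫
      (ihom.ev C.X).app h.X = m := by
    rw [← MonoidalClosed.uncurry_eq, MonoidalClosed.uncurry_curry, Iso.hom_inv_id_assoc]
  -- With the evaluation as outer measuring, the right side becomes the uncurried defect of the
  -- curried map, up to the associator; uncurrying is injective, so that defect vanishes.
  have h₂ := measuringDefect_tensor (isMeasuring_ev C h)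
    (MonoidalClosed.curry ((α_ C.X D.X g.X).inv ≫ m))
  rw [h₁, isMeasuring_iff_defect.1 hm] at h₂
  rw [isMeasuring_iff_defect]
  apply MonoidalClosed.uncurry_injective
  rw [MonoidalClosed.uncurry_eq, MonoidalClosed.uncurry_eq, MonoidalPreadditive.whiskerLeft_zero,
    Limits.zero_comp, ← cancel_epi (α_ C.X D.X (g.X ⊗ g.X)).hom, Limits.comp_zero]
  exact h₂.symm

end Measuring

/-! ### Universal and couniversal measurings. -/

section Representing

open DGVec

/-- A dg map out of C ⊗ g is a Lie morphism out of the free Lie algebra on it; being a measuring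
means killing the image of the defect of the generators, by `measuringDefect_comp`. -/
lemma exists_universal_measuring (C : cCDGA k) (g : DGLA k) :
    ∃ (Q : DGLA k) (u : C.X ⊗ g.X ⟶ Q.X), IsMeasuring C g Q u ∧
      ∀ (h : DGLA k) (m : C.X ⊗ g.X ⟶ h.X), IsMeasuring C g h m → ∃! φ : Q ⟶ h, u ≫ φ.hom = m := by
  obtain ⟨Q, π, hπ, hπ₀, hQ⟩ := DGLA.exists_quotient (freeLie (C.X ⊗ g.X))
    (Set.range (measuringDefect C g _ (freeLieι (C.X ⊗ g.X))).lin)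
  refine ⟨Q, freeLieι (C.X ⊗ g.X) ≫ π.hom, ?_, fun h m hm => ?_⟩
  · rw [isMeasuring_iff_defect, measuringDefect_comp]
    exact DGVec.hom_ext (LinearMap.ext fun t => hπ₀ _ ⟨t, rfl⟩)
  · obtain ⟨f, hf, hf'⟩ := freeLie_existsUnique m
    obtain ⟨φ, hφ⟩ := hQ h f (by
      rintro _ ⟨t, rfl⟩
      have h₁ := measuringDefect_comp (freeLieι (C.X ⊗ g.X)) f
      rw [hf, isMeasuring_iff_defect.1 hm] at h₁
      exact (LinearMap.congr_fun (congrArg Hom.lin h₁) t).symm)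
    refine ⟨φ, ?_, fun ψ hψ => LieObj.hom_ext (cancel_surjective hπ ?_)⟩
    · change (_ ≫ _) ≫ _ = m
      rw [Category.assoc, ← LieObj.comp_hom, hφ]
      exact hf
    · rw [← LieObj.comp_hom, ← LieObj.comp_hom, hφ, hf' (π ≫ ψ)
        ((Category.assoc _ _ _).symm.trans hψ)]

/-- A dg map C ⊗ g ⟶ h is a coalgebra morphism from C to the cofree coalgebra F on [g, h]; being a
measuring means that its composite with the curried defect r vanishes, so `cCDGA.exists_largest_sub`
applies. -/
lemma exists_couniversal_measuring (g h : DGLA k) :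
    ∃ (E : cCDGA k) (e : E.X ⊗ g.X ⟶ h.X), IsMeasuring E g h e ∧
      ∀ (C : cCDGA k) (m : C.X ⊗ g.X ⟶ h.X), IsMeasuring C g h m →
        ∃! φ : C ⟶ E, φ.hom ▷ g.X ≫ e = m := by
  set F := cofree ((ihom g.X).obj h.X) with hF
  -- Uncurrying puts g on the left, whereas measurings have the coalgebra on the left; hence the
  -- braiding.
  let m₀ : F.X ⊗ g.X ⟶ h.X := (β_ _ _).hom ≫ MonoidalClosed.uncurry (cofreeπ ((ihom g.X).obj h.X))
  have hm₀ : ∀ {C : cCDGA k} (f : C ⟶ F), f.hom ▷ g.X ≫ m₀ =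
      (β_ _ _).hom ≫ MonoidalClosed.uncurry (f.hom ≫ cofreeπ ((ihom g.X).obj h.X)) := fun f => by
    rw [MonoidalClosed.uncurry_natural_left, ← BraidedCategory.braiding_naturality_left_assoc]
  -- Currying away g ⊗ g makes the measuring condition a linear condition on elements of F.
  let r : F.X ⟶ (ihom (g.X ⊗ g.X)).obj h.X :=
    MonoidalClosed.curry ((β_ _ _).hom ≫ measuringDefect F g h m₀)
  have hr : ∀ {C : cCDGA k} (f : C ⟶ F), f.hom ≫ r = 0 ↔ IsMeasuring C g h (f.hom ▷ g.X ≫ m₀) := by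
    intro C f
    have h₁ := measuringDefect_pre f (𝟙 g) m₀
    rw [LieObj.id_hom, tensorHom_id, id_tensorHom_id, tensorHom_id] at h₁
    rw [isMeasuring_iff_defect, h₁, ← MonoidalClosed.curry_natural_left,
      BraidedCategory.braiding_naturality_right_assoc, ← MonoidalClosed.curry_zero,
      MonoidalClosed.curry_injective.eq_iff, ← cancel_epi (β_ (g.X ⊗ g.X) C.X).hom,
      Limits.comp_zero]
  obtain ⟨E, i, hi, hi₀, hE⟩ := F.exists_largest_sub r
  refine ⟨E, i.hom ▷ g.X ≫ m₀, (hr i).1 hi₀, fun C m hm => ?_⟩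
  obtain ⟨f, hf, hf'⟩ := cofree_existsUnique (MonoidalClosed.curry ((β_ g.X C.X).hom ≫ m))
  have hfm : f.hom ▷ g.X ≫ m₀ = m := by
    rw [hm₀, hf, MonoidalClosed.uncurry_curry, SymmetricCategory.symmetry_assoc]
  obtain ⟨φ, hφ⟩ := hE C f ((hr f).2 (by rwa [hfm]))
  refine ⟨φ, ?_, fun ψ hψ => cCDGA.hom_ext (cancel_injective hi ?_)⟩
  · change _ ≫ _ ≫ _ = m
    rw [← comp_whiskerRight_assoc, ← cCDGA.comp_hom, hφ, hfm]
  · rw [← cCDGA.comp_hom, ← cCDGA.comp_hom, hφ, hf' (ψ ≫ i) ?_]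
    apply MonoidalClosed.uncurry_injective
    rw [MonoidalClosed.uncurry_curry, ← cancel_epi (β_ C.X g.X).hom, ← hm₀,
      SymmetricCategory.symmetry_assoc, cCDGA.comp_hom, comp_whiskerRight_assoc]
    exact hψ

end Representing

end

noncomputable section

open Opposite

variable {k : Type u} [Field k]

/-! ### The tensoring C ▷ g, its adjunction with convolution, and associativity. -/

section Tensor

/-- The tensoring `C ▷ g` of dg Lie algebras over coalgebras: it represents measurings out of
`C ⊗ g`. -/
def lieTensor (C : cCDGA k) (g : DGLA k) : DGLA k := (exists_universal_measuring C g).choose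

/-- The universal measuring out of `C ⊗ g`. -/
def lieTensorU (C : cCDGA k) (g : DGLA k) : C.X ⊗ g.X ⟶ (lieTensor C g).X :=
  (exists_universal_measuring C g).choose_spec.choose

lemma isMeasuring_lieTensorU (C : cCDGA k) (g : DGLA k) :
    IsMeasuring C g (lieTensor C g) (lieTensorU C g) :=
  (exists_universal_measuring C g).choose_spec.choose_spec.1

variable {C C' D : cCDGA k} {g g' h h' : DGLA k}

/-- The morphism out of `C ▷ g` induced by a measuring. -/
def IsMeasuring.desc {m : C.X ⊗ g.X ⟶ h.X} (hm : IsMeasuring C g h m) : lieTensor C g ⟶ h :=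
  ((exists_universal_measuring C g).choose_spec.choose_spec.2 h m hm).choose

lemma lieTensorU_desc {m : C.X ⊗ g.X ⟶ h.X} (hm : IsMeasuring C g h m) :
    lieTensorU C g ≫ hm.desc.hom = m :=
  ((exists_universal_measuring C g).choose_spec.choose_spec.2 h m hm).choose_spec.1

lemma lieTensor_hom_ext {f f' : lieTensor C g ⟶ h}
    (w : lieTensorU C g ≫ f.hom = lieTensorU C g ≫ f'.hom) : f = f' :=
  ((exists_universal_measuring C g).choose_spec.choose_spec.2 h _
    ((isMeasuring_lieTensorU C g).comp f')).unique w rfl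

/-- Functoriality of `C ▷ g`. -/
def lieTensorMap (f : C ⟶ C') (φ : g ⟶ g') : lieTensor C g ⟶ lieTensor C' g' :=
  ((isMeasuring_lieTensorU C' g').pre f φ).desc

lemma lieTensorU_map (f : C ⟶ C') (φ : g ⟶ g') :
    lieTensorU C g ≫ (lieTensorMap f φ).hom = (f.hom ⊗ₘ φ.hom) ≫ lieTensorU C' g' :=
  lieTensorU_desc _

lemma lieTensorMap_id (C : cCDGA k) (g : DGLA k) : lieTensorMap (𝟙 C) (𝟙 g) = 𝟙 (lieTensor C g) :=
  lieTensor_hom_ext (by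
    rw [lieTensorU_map, cCDGA.id_hom, LieObj.id_hom, LieObj.id_hom, id_tensorHom_id,
      Category.id_comp, Category.comp_id])

lemma lieTensorMap_comp {C'' : cCDGA k} {g'' : DGLA k} (f : C ⟶ C') (f' : C' ⟶ C'') (φ : g ⟶ g')
    (φ' : g' ⟶ g'') :
    lieTensorMap f φ ≫ lieTensorMap f' φ' = lieTensorMap (f ≫ f') (φ ≫ φ') :=
  lieTensor_hom_ext (by
    rw [LieObj.comp_hom, ← Category.assoc, lieTensorU_map, Category.assoc, lieTensorU_map,
      lieTensorU_map, tensorHom_comp_tensorHom_assoc, cCDGA.comp_hom, LieObj.comp_hom])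

variable (k) in
/-- The tensoring as a bifunctor. -/
def lieTensorFunctor : cCDGA k ⥤ DGLA k ⥤ DGLA k where
  obj C :=
    { obj := fun g => lieTensor C g
      map := fun φ => lieTensorMap (𝟙 C) φ
      map_id := fun g => lieTensorMap_id C g
      map_comp := fun φ ψ => by rw [lieTensorMap_comp, Category.comp_id] }
  map f :=
    { app := fun g => lieTensorMap f (𝟙 g)
      naturality := fun g g' φ => by
        simp only [lieTensorMap_comp, Category.comp_id, Category.id_comp] }
  map_id C := NatTrans.ext (funext fun g => lieTensorMap_id C g)
  map_comp f f' := NatTrans.ext (funext fun g => by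
    simp only [NatTrans.comp_app, lieTensorMap_comp, Category.comp_id])

/-- The bijection between morphisms out of `C ▷ g` and morphisms into the convolution Lie algebra. -/
def lieTensorEquiv (C : cCDGA k) (g h : DGLA k) : (lieTensor C g ⟶ h) ≃ (g ⟶ convAlg C h) where
  toFun f := ((isMeasuring_lieTensorU C g).comp f).curry
  invFun f := (isMeasuring_uncurry f).desc
  left_inv f := lieTensor_hom_ext (by
    rw [lieTensorU_desc, IsMeasuring.curry_hom, MonoidalClosed.uncurry_curry])
  right_inv f := LieObj.hom_ext (by
    rw [IsMeasuring.curry_hom, lieTensorU_desc, MonoidalClosed.curry_uncurry])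

lemma lieTensorEquiv_hom (f : lieTensor C g ⟶ h) :
    (lieTensorEquiv C g h f).hom = MonoidalClosed.curry (lieTensorU C g ≫ f.hom) := rfl

/-- Naturality in C and g at once; taking f or φ to be an identity gives the adjunction for fixed C
and its compatibility with change of C. -/
lemma lieTensorEquiv_map (f : C ⟶ C') (φ : g ⟶ g') (ψ : lieTensor C' g' ⟶ h) :
    lieTensorEquiv C g h (lieTensorMap f φ ≫ ψ) =
      φ ≫ lieTensorEquiv C' g' h ψ ≫ convPre f h := LieObj.hom_ext (by
  have h₁ : (convPre f h).hom = (MonoidalClosed.pre f.hom).app h.X := rfl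
  apply MonoidalClosed.uncurry_injective
  rw [lieTensorEquiv_hom, MonoidalClosed.uncurry_curry, LieObj.comp_hom, LieObj.comp_hom,
    LieObj.comp_hom, lieTensorEquiv_hom, h₁, MonoidalClosed.uncurry_natural_left,
    ← Category.assoc, lieTensorU_map, MonoidalClosed.curry_pre_app, MonoidalClosed.uncurry_curry,
    MonoidalCategory.tensorHom_def', Category.assoc, Category.assoc])

lemma convPre_id (C : cCDGA k) (h : DGLA k) : convPre (𝟙 C) h = 𝟙 (convAlg C h) :=
  NatTrans.congr_app ((convFunctor k).map_id (op C)) h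

lemma lieTensorEquiv_symm_comp (φ : g ⟶ g') (ψ : g' ⟶ convAlg C h) :
    (lieTensorEquiv C g h).symm (φ ≫ ψ) =
      lieTensorMap (𝟙 C) φ ≫ (lieTensorEquiv C g' h).symm ψ := by
  rw [Equiv.symm_apply_eq, lieTensorEquiv_map, convPre_id, Category.comp_id,
    Equiv.apply_symm_apply]

lemma lieTensorEquiv_comp (f : lieTensor C g ⟶ h) (φ : h ⟶ h') :
    lieTensorEquiv C g h' (f ≫ φ) = lieTensorEquiv C g h f ≫ convMap C φ := LieObj.hom_ext (by
  change MonoidalClosed.curry (_ ≫ _ ≫ _) = MonoidalClosed.curry _ ≫ (ihom C.X).map φ.hom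
  rw [← MonoidalClosed.curry_natural_right, Category.assoc])

/-- The adjunction between tensoring with `C` and the convolution Lie algebra. -/
def lieTensorAdj (C : cCDGA k) :
    (lieTensorFunctor k).obj C ⊣ (convFunctor k).obj (op C) :=
  Adjunction.mkOfHomEquiv
    { homEquiv := lieTensorEquiv C
      homEquiv_naturality_left_symm := fun φ ψ => lieTensorEquiv_symm_comp φ ψ
      homEquiv_naturality_right := fun f φ => lieTensorEquiv_comp f φ }

variable (k) in
/-- Tensoring and convolution form a parametrized adjunction. -/
def lieTensorAdj₂ : lieTensorFunctor k ⊣₂ convFunctor k :=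
  ParametrizedAdjunction.mk' lieTensorAdj fun {C C'} f {g h} ψ => by
    simp only [lieTensorAdj, Adjunction.mkOfHomEquiv_homEquiv]
    exact (lieTensorEquiv_map f (𝟙 g) ψ).trans (Category.id_comp _)

lemma lieTensorAdj₂_unit (C : cCDGA k) (g : DGLA k) :
    MonoidalClosed.uncurry ((((lieTensorAdj₂ k).adj C).unit.app g).hom) = lieTensorU C g := by
  have h₁ : (lieTensorEquiv C g _ (𝟙 (lieTensor C g))).hom =
      MonoidalClosed.curry (lieTensorU C g) := by
    rw [lieTensorEquiv_hom, LieObj.id_hom, Category.comp_id]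
  exact (congrArg MonoidalClosed.uncurry h₁).trans (MonoidalClosed.uncurry_curry _)

/-- Composing measurings: `(C ⊗ D) ▷ g ⟶ C ▷ (D ▷ g)`. -/
def lieTensorAssocHom (C D : cCDGA k) (g : DGLA k) :
    lieTensor (cCDGA.tensorObj C D) g ⟶ lieTensor C (lieTensor D g) :=
  ((isMeasuring_lieTensorU C (lieTensor D g)).tensor (isMeasuring_lieTensorU D g)).desc

lemma lieTensorU_assocHom (C D : cCDGA k) (g : DGLA k) :
    lieTensorU (cCDGA.tensorObj C D) g ≫ (lieTensorAssocHom C D g).hom =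
      (α_ C.X D.X g.X).hom ≫ C.X ◁ lieTensorU D g ≫ lieTensorU C (lieTensor D g) :=
  lieTensorU_desc _

/-- Transposing moves C to the target {C, h}, leaving morphisms out of D ▷ g, which are determined
on D ⊗ g. -/
lemma lieTensor_hom_ext₂ {f f' : lieTensor C (lieTensor D g) ⟶ h}
    (w : C.X ◁ lieTensorU D g ≫ lieTensorU C (lieTensor D g) ≫ f.hom =
      C.X ◁ lieTensorU D g ≫ lieTensorU C (lieTensor D g) ≫ f'.hom) : f = f' := by
  refine (lieTensorEquiv C _ h).injective (lieTensor_hom_ext ?_)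
  rw [lieTensorEquiv_hom, lieTensorEquiv_hom, ← MonoidalClosed.curry_natural_left,
    ← MonoidalClosed.curry_natural_left, w]

/-- The associativity isomorphism `(C ⊗ D) ▷ g ≅ C ▷ (D ▷ g)`. -/
def lieTensorAssoc (C D : cCDGA k) (g : DGLA k) :
    lieTensor (cCDGA.tensorObj C D) g ≅ lieTensor C (lieTensor D g) :=
  -- The inverse comes from currying the universal measuring of C ⊗ D into one by D with values in a
  -- convolution algebra, then descending to D ▷ g and transposing. On C ⊗ (D ⊗ g) it is the inverse
  -- associator followed by the universal measuring.
  have key : C.X ◁ lieTensorU D g ≫ lieTensorU C (lieTensor D g) ≫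
      LieObj.Hom.hom ((lieTensorEquiv C (lieTensor D g) _).symm
        (isMeasuring_lieTensorU (cCDGA.tensorObj C D) g).curry_tensor.desc) =
        (α_ C.X D.X g.X).inv ≫ lieTensorU (cCDGA.tensorObj C D) g := by
    apply MonoidalClosed.curry_injective
    rw [MonoidalClosed.curry_natural_left, ← lieTensorEquiv_hom, Equiv.apply_symm_apply,
      lieTensorU_desc]
  { hom := lieTensorAssocHom C D g
    inv := (lieTensorEquiv C (lieTensor D g) _).symm
      (isMeasuring_lieTensorU (cCDGA.tensorObj C D) g).curry_tensor.desc
    hom_inv_id := lieTensor_hom_ext (by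
      rw [LieObj.comp_hom, ← Category.assoc, lieTensorU_assocHom, Category.assoc, Category.assoc,
        key, Iso.hom_inv_id_assoc, LieObj.id_hom]
      exact (Category.comp_id _).symm)
    inv_hom_id := lieTensor_hom_ext₂ (by
      rw [LieObj.comp_hom, reassoc_of% key, lieTensorU_assocHom, Iso.inv_hom_id_assoc,
        LieObj.id_hom, Category.comp_id]) }

lemma lieTensorAssocHom_natural {D' : cCDGA k} (f : C ⟶ C') (f' : D ⟶ D') (φ : g ⟶ g') :
    lieTensorMap (cCDGA.tensorMap f f') φ ≫ lieTensorAssocHom C' D' g' =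
      lieTensorAssocHom C D g ≫ lieTensorMap f (lieTensorMap f' φ) := by
  refine lieTensor_hom_ext ?_
  rw [LieObj.comp_hom, ← Category.assoc, lieTensorU_map, Category.assoc, lieTensorU_assocHom,
    LieObj.comp_hom, ← Category.assoc (lieTensorU _ _), lieTensorU_assocHom, Category.assoc,
    Category.assoc, lieTensorU_map, cCDGA.tensorMap_hom, associator_naturality_assoc,
    ← id_tensorHom, ← id_tensorHom, tensorHom_comp_tensorHom_assoc, tensorHom_comp_tensorHom_assoc,
    lieTensorU_map, Category.id_comp, Category.comp_id]

/-- Restricted along the universal measuring, each side is a composite of associators followed by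
the three nested universal measurings, so the pentagon for dg vector spaces decides. -/
lemma lieTensorAssocHom_pentagon (X Y Z : cCDGA k) (A : DGLA k) :
    lieTensorMap (cCDGA.assoc X Y Z).hom (𝟙 A) ≫ lieTensorAssocHom X (cCDGA.tensorObj Y Z) A ≫
        lieTensorMap (𝟙 X) (lieTensorAssocHom Y Z A) =
      lieTensorAssocHom (cCDGA.tensorObj X Y) Z A ≫ lieTensorAssocHom X Y (lieTensor Z A) := by
  refine lieTensor_hom_ext ?_
  simp only [LieObj.comp_hom]
  rw [← Category.assoc, lieTensorU_map, Category.assoc, ← Category.assoc (lieTensorU _ _),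
    lieTensorU_assocHom, Category.assoc, Category.assoc, lieTensorU_map,
    ← Category.assoc (lieTensorU _ _), lieTensorU_assocHom, Category.assoc, Category.assoc,
    lieTensorU_assocHom, cCDGA.id_hom, id_tensorHom, ← whiskerLeft_comp_assoc X.X (lieTensorU _ _),
    lieTensorU_assocHom, cCDGA.assoc_hom_hom, LieObj.id_hom, tensorHom_id,
    MonoidalCategory.whiskerLeft_comp, MonoidalCategory.whiskerLeft_comp, Category.assoc,
    Category.assoc, pentagon_assoc, associator_naturality_right_assoc]

variable (k) in
/-- Dg Lie algebras form a semi-module category over conilpotent cocommutative coalgebras. -/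
def lieSemiModule : SemiModule (cCDGA k) (DGLA k) where
  act := lieTensorFunctor k
  assoc := NatIso.ofComponents (fun C => NatIso.ofComponents (fun D => NatIso.ofComponents
    (fun g => lieTensorAssoc C D g)
      (fun {g g'} φ => by
        have := lieTensorAssocHom_natural (𝟙 C) (𝟙 D) φ
        rwa [cCDGA.tensorMap_id] at this))
      (fun {D D'} f => NatTrans.ext (funext fun g => lieTensorAssocHom_natural (𝟙 C) f (𝟙 g))))
      (fun {C C'} f => NatTrans.ext (funext fun D => NatTrans.ext (funext fun g => by
        have := lieTensorAssocHom_natural f (𝟙 D) (𝟙 g)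
        rwa [lieTensorMap_id] at this)))
  pentagon X Y Z A := lieTensorAssocHom_pentagon X Y Z A

end Tensor

/-! ### The enrichment and its adjunction with the tensoring. -/

section Enrichment

/-- The enrichment of dg Lie algebras in coalgebras: it represents measurings from `g` to `h`. -/
def lieEnr (g h : DGLA k) : cCDGA k := (exists_couniversal_measuring g h).choose

/-- The couniversal measuring from `g` to `h`. -/
def lieEnrEv (g h : DGLA k) : (lieEnr g h).X ⊗ g.X ⟶ h.X :=
  (exists_couniversal_measuring g h).choose_spec.choose

lemma isMeasuring_lieEnrEv (g h : DGLA k) : IsMeasuring (lieEnr g h) g h (lieEnrEv g h) :=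
  (exists_couniversal_measuring g h).choose_spec.choose_spec.1

variable {C D : cCDGA k} {g g' h h' : DGLA k}

/-- The coalgebra morphism induced by a measuring. -/
def IsMeasuring.lift {m : C.X ⊗ g.X ⟶ h.X} (hm : IsMeasuring C g h m) : C ⟶ lieEnr g h :=
  ((exists_couniversal_measuring g h).choose_spec.choose_spec.2 C m hm).choose

lemma lift_lieEnrEv {m : C.X ⊗ g.X ⟶ h.X} (hm : IsMeasuring C g h m) :
    hm.lift.hom ▷ g.X ≫ lieEnrEv g h = m :=
  ((exists_couniversal_measuring g h).choose_spec.choose_spec.2 C m hm).choose_spec.1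

lemma isMeasuring_whiskerRight_lieEnrEv (f : C ⟶ lieEnr g h) :
    IsMeasuring C g h (f.hom ▷ g.X ≫ lieEnrEv g h) := by
  have := (isMeasuring_lieEnrEv g h).pre f (𝟙 g)
  rwa [LieObj.id_hom, tensorHom_id] at this

lemma lieEnr_hom_ext {f f' : C ⟶ lieEnr g h}
    (w : f.hom ▷ g.X ≫ lieEnrEv g h = f'.hom ▷ g.X ≫ lieEnrEv g h) : f = f' :=
  ((exists_couniversal_measuring g h).choose_spec.choose_spec.2 C _
    (isMeasuring_whiskerRight_lieEnrEv f')).unique w rfl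

/-- Functoriality of the enrichment. -/
def lieEnrMap (φ : g' ⟶ g) (ψ : h ⟶ h') : lieEnr g h ⟶ lieEnr g' h' :=
  (((isMeasuring_lieEnrEv g h).pre (𝟙 _) φ).comp ψ).lift

lemma lieEnrMap_ev (φ : g' ⟶ g) (ψ : h ⟶ h') :
    (lieEnrMap φ ψ).hom ▷ g'.X ≫ lieEnrEv g' h' =
      (lieEnr g h).X ◁ φ.hom ≫ lieEnrEv g h ≫ ψ.hom := by
  refine (lift_lieEnrEv _).trans ?_
  rw [cCDGA.id_hom, id_tensorHom, Category.assoc]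

lemma whiskerRight_lieEnrMap_ev {V : DGVec k} (f : V ⟶ (lieEnr g h).X) (φ : g' ⟶ g) (ψ : h ⟶ h') :
    (f ≫ (lieEnrMap φ ψ).hom) ▷ g'.X ≫ lieEnrEv g' h' =
      V ◁ φ.hom ≫ (f ▷ g.X ≫ lieEnrEv g h) ≫ ψ.hom := by
  rw [comp_whiskerRight, Category.assoc, lieEnrMap_ev, Category.assoc, whisker_exchange_assoc]

lemma lieEnrMap_id (g h : DGLA k) : lieEnrMap (𝟙 g) (𝟙 h) = 𝟙 (lieEnr g h) :=
  lieEnr_hom_ext (by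
    rw [lieEnrMap_ev, LieObj.id_hom, LieObj.id_hom, cCDGA.id_hom, MonoidalCategory.whiskerLeft_id,
      id_whiskerRight, Category.comp_id])

lemma lieEnrMap_comp {g'' h'' : DGLA k} (φ : g' ⟶ g) (φ' : g'' ⟶ g') (ψ : h ⟶ h') (ψ' : h' ⟶ h'') :
    lieEnrMap φ ψ ≫ lieEnrMap φ' ψ' = lieEnrMap (φ' ≫ φ) (ψ ≫ ψ') :=
  lieEnr_hom_ext (by
    rw [cCDGA.comp_hom, whiskerRight_lieEnrMap_ev, lieEnrMap_ev, lieEnrMap_ev, LieObj.comp_hom,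
      LieObj.comp_hom, MonoidalCategory.whiskerLeft_comp]
    simp only [Category.assoc])

variable (k) in
/-- The enrichment as a bifunctor. -/
def lieEnrFunctor : (DGLA k)ᵒᵖ ⥤ DGLA k ⥤ cCDGA k where
  obj g :=
    { obj := fun h => lieEnr g.unop h
      map := fun ψ => lieEnrMap (𝟙 g.unop) ψ
      map_id := fun h => lieEnrMap_id g.unop h
      map_comp := fun ψ ψ' => by rw [lieEnrMap_comp, Category.comp_id] }
  map φ :=
    { app := fun h => lieEnrMap φ.unop (𝟙 h)
      naturality := fun h h' ψ => by
        simp only [lieEnrMap_comp, Category.comp_id, Category.id_comp] }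
  map_id g := NatTrans.ext (funext fun h => lieEnrMap_id g.unop h)
  map_comp φ φ' := NatTrans.ext (funext fun h => by
    simp only [NatTrans.comp_app, lieEnrMap_comp, Category.comp_id, unop_comp])

/-- The bijection between morphisms out of `C ▷ g` and morphisms into the enrichment. -/
def lieEnrEquiv (g : DGLA k) (C : cCDGA k) (h : DGLA k) : (lieTensor C g ⟶ h) ≃ (C ⟶ lieEnr g h) where
  toFun f := ((isMeasuring_lieTensorU C g).comp f).lift
  invFun f := (isMeasuring_whiskerRight_lieEnrEv f).desc
  left_inv f := lieTensor_hom_ext (by rw [lieTensorU_desc, lift_lieEnrEv])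
  right_inv f := lieEnr_hom_ext (by rw [lift_lieEnrEv, lieTensorU_desc])

lemma lieEnrEquiv_ev (f : lieTensor C g ⟶ h) :
    (lieEnrEquiv g C h f).hom ▷ g.X ≫ lieEnrEv g h = lieTensorU C g ≫ f.hom :=
  lift_lieEnrEv ((isMeasuring_lieTensorU C g).comp f)

lemma lieTensorU_lieEnrEquiv_symm (f : C ⟶ lieEnr g h) :
    lieTensorU C g ≫ ((lieEnrEquiv g C h).symm f).hom = f.hom ▷ g.X ≫ lieEnrEv g h :=
  lieTensorU_desc (isMeasuring_whiskerRight_lieEnrEv f)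

/-- Naturality in all three variables together; the following lemmas specialise it by identities. -/
lemma lieEnrEquiv_map (f : C ⟶ D) (φ : g' ⟶ g) (ψ : h ⟶ h') (F : lieTensor D g ⟶ h) :
    lieEnrEquiv g' C h' (lieTensorMap f φ ≫ F ≫ ψ) =
      f ≫ lieEnrEquiv g D h F ≫ lieEnrMap φ ψ :=
  lieEnr_hom_ext (by
    rw [lieEnrEquiv_ev, cCDGA.comp_hom, cCDGA.comp_hom, ← Category.assoc f.hom,
      whiskerRight_lieEnrMap_ev, comp_whiskerRight_assoc, lieEnrEquiv_ev, LieObj.comp_hom,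
      ← Category.assoc, lieTensorU_map, LieObj.comp_hom, MonoidalCategory.tensorHom_def']
    simp only [Category.assoc])

lemma lieEnrEquiv_symm_comp (f : C ⟶ D) (F : D ⟶ lieEnr g h) :
    (lieEnrEquiv g C h).symm (f ≫ F) = lieTensorMap f (𝟙 g) ≫ (lieEnrEquiv g D h).symm F := by
  have h₁ := lieEnrEquiv_map f (𝟙 g) (𝟙 h) ((lieEnrEquiv g D h).symm F)
  rw [Category.comp_id, lieEnrMap_id, Category.comp_id, Equiv.apply_symm_apply] at h₁
  rw [Equiv.symm_apply_eq, h₁]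

lemma lieEnrEquiv_comp (F : lieTensor C g ⟶ h) (ψ : h ⟶ h') :
    lieEnrEquiv g C h' (F ≫ ψ) = lieEnrEquiv g C h F ≫ lieEnrMap (𝟙 g) ψ := by
  have h₁ := lieEnrEquiv_map (𝟙 C) (𝟙 g) ψ F
  rwa [lieTensorMap_id, Category.id_comp, Category.id_comp] at h₁

lemma lieEnrEquiv_pre (φ : g' ⟶ g) (F : lieTensor C g ⟶ h) :
    lieEnrEquiv g' C h (lieTensorMap (𝟙 C) φ ≫ F) = lieEnrEquiv g C h F ≫ lieEnrMap φ (𝟙 h) := by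
  have h₁ := lieEnrEquiv_map (𝟙 C) φ (𝟙 h) F
  rwa [Category.comp_id, Category.id_comp] at h₁

/-- The adjunction between tensoring with `g` and the enrichment. -/
def lieEnrAdj (g : DGLA k) : (lieTensorFunctor k).flip.obj g ⊣ (lieEnrFunctor k).obj (op g) :=
  Adjunction.mkOfHomEquiv
    { homEquiv := lieEnrEquiv g
      homEquiv_naturality_left_symm := fun f F => lieEnrEquiv_symm_comp f F
      homEquiv_naturality_right := fun F ψ => lieEnrEquiv_comp F ψ }

variable (k) in
/-- Tensoring and the enrichment form a parametrized adjunction. -/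
def lieEnrAdj₂ : (lieTensorFunctor k).flip ⊣₂ lieEnrFunctor k :=
  ParametrizedAdjunction.mk' lieEnrAdj fun {g g'} φ {C h} F => by
    simp only [lieEnrAdj, Adjunction.mkOfHomEquiv_homEquiv]
    exact lieEnrEquiv_pre φ F

variable (k) in
/-- The semi-module category of dg Lie algebras is closed. -/
def lieClosed : (lieSemiModule k).Closed (lieEnrFunctor k) (convFunctor k) where
  cotAdj := lieTensorAdj₂ k
  enrAdj := lieEnrAdj₂ k

end Enrichment

end

/-! ### Comparison maps on free Lie algebras. -/

noncomputable section

open Opposite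

variable {k : Type u} [Field k]

lemma universalMeasuring_lieClosed (C : cCDGA k) (g : DGLA k) :
    universalMeasuring (lieClosed k) C g = lieTensorU C g :=
  lieTensorAdj₂_unit C g

/-- The counit is the transpose of the identity of enr(g, h), so preceding it by the universal
measuring gives back the couniversal one. -/
lemma evalMeasuring_lieClosed (g h : DGLA k) :
    evalMeasuring (lieClosed k) g h = lieEnrEv g h := by
  have h₁ : lieTensorU (lieEnr g h) g ≫
      ((lieEnrEquiv g (lieEnr g h) h).symm (𝟙 (lieEnr g h))).hom = lieEnrEv g h := by
    rw [lieTensorU_lieEnrEquiv_symm, cCDGA.id_hom, id_whiskerRight, Category.id_comp]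
  have h₂ := universalMeasuring_lieClosed (lieEnr g h) g
  refine Eq.trans ?_ h₁
  rw [← h₂]
  rfl

section Free

variable {T : DGVec k ⥤ DGLA k} (adjT : T ⊣ LieObj.forget (DGVec k))

lemma uncurry_homEquiv_lieTensorEquiv {C : cCDGA k} {V : DGVec k} {h : DGLA k}
    (f : lieTensor C (T.obj V) ⟶ h) :
    MonoidalClosed.uncurry (adjT.homEquiv V _ (lieTensorEquiv C (T.obj V) h f)) =
      C.X ◁ adjT.unit.app V ≫ lieTensorU C (T.obj V) ≫ f.hom := by
  rw [Adjunction.homEquiv_unit]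
  exact (MonoidalClosed.uncurry_natural_left _ _).trans
    (congrArg (C.X ◁ adjT.unit.app V ≫ ·) (MonoidalClosed.uncurry_curry _))

/-- A chain of adjunctions: Lie morphisms out of C ▷ TV, Lie morphisms TV ⟶ {C, h}, dg maps V ⟶ [C,
h], dg maps C ⊗ V ⟶ h. Both comparison theorems are read off from it. -/
lemma bijective_uncurry_homEquiv_lieTensorEquiv (C : cCDGA k) (V : DGVec k) (h : DGLA k) :
    Function.Bijective fun f : lieTensor C (T.obj V) ⟶ h =>
      C.X ◁ adjT.unit.app V ≫ lieTensorU C (T.obj V) ≫ f.hom := by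
  have h₁ : Function.Bijective fun f : lieTensor C (T.obj V) ⟶ h => (MonoidalClosed.uncurry
      (adjT.homEquiv V _ (lieTensorEquiv C (T.obj V) h f)) : C.X ⊗ V ⟶ h.X) :=
    (((ihom.adjunction C.X).homEquiv V h.X).symm.bijective.comp
      (adjT.homEquiv V (convAlg C h)).bijective).comp (lieTensorEquiv C (T.obj V) h).bijective
  simpa only [uncurry_homEquiv_lieTensorEquiv] using h₁

/-- Yoneda in h: precomposition with the comparison, transposed along the free adjunction, is the
bijection above. -/
lemma isIso_tensorFreeComparison (C : cCDGA k) (V : DGVec k) :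
    IsIso (tensorFreeComparison (lieClosed k) adjT C V) := by
  refine isIso_of_coyoneda_map_bijective _ fun h => ?_
  rw [← Equiv.comp_bijective _ (adjT.homEquiv _ _)]
  refine (congrArg Function.Bijective (funext fun f => ?_)).mpr
    (bijective_uncurry_homEquiv_lieTensorEquiv adjT C V h)
  change adjT.homEquiv _ _ (tensorFreeComparison (lieClosed k) adjT C V ≫ f) = _
  rw [Adjunction.homEquiv_naturality_right, tensorFreeComparison, Equiv.apply_symm_apply,
    universalMeasuring_lieClosed]
  exact Category.assoc _ _ _

/-- Yoneda in the coalgebra C: morphisms C ⟶ enr(TV, h) are dg maps C ⊗ V ⟶ h by the same bijection,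
hence dg maps C ⟶ [V, h], hence morphisms from C to the cofree coalgebra. -/
lemma isIso_enrFreeComparison {S : DGVec k ⥤ cCDGA k} (adjS : cCDGA.forget k ⊣ S) (V : DGVec k)
    (h : DGLA k) : IsIso (enrFreeComparison (lieClosed k) adjT adjS V h) := by
  refine isIso_of_yoneda_map_bijective _ fun C => ?_
  rw [← Equiv.comp_bijective _ (adjS.homEquiv _ _).symm]
  have h₀ : ∀ f : C ⟶ lieEnr (T.obj V) h, C.X ◁ adjT.unit.app V ≫ lieTensorU C (T.obj V) ≫
      ((lieEnrEquiv (T.obj V) C h).symm f).hom =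
        C.X ◁ adjT.unit.app V ≫ f.hom ▷ (T.obj V).X ≫ lieEnrEv (T.obj V) h :=
    fun f => congrArg (C.X ◁ adjT.unit.app V ≫ ·) (lieTensorU_lieEnrEquiv_symm f)
  have h₁ : Function.Bijective fun f : C ⟶ lieEnr (T.obj V) h =>
      (MonoidalClosed.curry ((β_ V C.X).hom ≫ C.X ◁ adjT.unit.app V ≫
        lieTensorU C (T.obj V) ≫ ((lieEnrEquiv (T.obj V) C h).symm f).hom) :
          C.X ⟶ (ihom V).obj h.X) :=
    ((((ihom.adjunction V).homEquiv C.X h.X).bijective.comp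
      ((β_ V C.X).symm.homFromEquiv (Z := h.X)).bijective).comp
        (bijective_uncurry_homEquiv_lieTensorEquiv adjT C V h)).comp
          (lieEnrEquiv (T.obj V) C h).symm.bijective
  refine (congrArg Function.Bijective (funext fun f => ?_)).mpr h₁
  change (adjS.homEquiv _ _).symm (f ≫ enrFreeComparison (lieClosed k) adjT adjS V h) = _
  rw [Adjunction.homEquiv_naturality_left_symm, enrFreeComparison, Equiv.symm_apply_apply,
    evalMeasuring_lieClosed]
  refine (MonoidalClosed.curry_natural_left _ _).symm.trans (congrArg MonoidalClosed.curry ?_)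
  refine (BraidedCategory.braiding_naturality_right_assoc V f.hom _).trans
    (congrArg ((β_ V C.X).hom ≫ ·) ?_)
  exact (whisker_exchange_assoc f.hom (adjT.unit.app V) (lieEnrEv (T.obj V) h)).symm.trans
    (h₀ f).symm

end Free

/-! ### The canonical coequaliser presentation and its images. -/

section Presentations

open Limits

variable {T : DGVec k ⥤ DGLA k} (adjT : T ⊣ LieObj.forget (DGVec k))

lemma unit_freeCounit (g : DGLA k) : adjT.unit.app g.X ≫ (freeCounit adjT g).hom = 𝟙 g.X :=
  adjT.right_triangle_components g

lemma freeCounit_surjective (g : DGLA k) : Function.Surjective (freeCounit adjT g).hom.lin :=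
  fun x => ⟨(adjT.unit.app g.X).lin x,
    LinearMap.congr_fun (congrArg DGVec.Hom.lin (unit_freeCounit adjT g)) x⟩

/-- On dg vector spaces the units split the fork, so the factorisation must be f restricted to g
along the unit. It preserves brackets because f does and the counit is surjective. -/
lemma existsUnique_freeCounit_desc {g h : DGLA k} (f : T.obj g.X ⟶ h)
    (w : freeCounit adjT (T.obj g.X) ≫ f = T.map (freeCounit adjT g).hom ≫ f) :
    ∃! l : g ⟶ h, freeCounit adjT g ≫ l = f := by
  have hε := freeCounit_surjective adjT g
  let η (V : DGVec k) : V ⟶ (T.obj V).X := adjT.unit.app V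
  have h₁ : (freeCounit adjT g).hom ≫ η g.X ≫ f.hom = f.hom := by
    have h₂ : η (T.obj g.X).X ≫ (T.map (freeCounit adjT g).hom).hom =
        (freeCounit adjT g).hom ≫ η g.X := adjT.unit_naturality (freeCounit adjT g).hom
    have h₃ : (freeCounit adjT (T.obj g.X)).hom ≫ f.hom =
        (T.map (freeCounit adjT g).hom).hom ≫ f.hom := congrArg LieObj.Hom.hom w
    have h₄ : η (T.obj g.X).X ≫ (freeCounit adjT (T.obj g.X)).hom = 𝟙 _ := unit_freeCounit adjT _
    rw [← reassoc_of% h₂, ← h₃, reassoc_of% h₄]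
  refine ⟨⟨η g.X ≫ f.hom, ?_⟩, LieObj.hom_ext h₁, fun m hm => LieObj.hom_ext ?_⟩
  · refine DGVec.cancel_surjective (DGVec.tensorHom_surjective hε hε) ?_
    rw [tensorHom_comp_tensorHom_assoc, h₁, ← reassoc_of% (freeCounit adjT g).bracket_hom, h₁,
      f.bracket_hom]
  · refine DGVec.cancel_surjective hε ?_
    rw [h₁]
    exact congrArg LieObj.Hom.hom hm

/-- Every dg Lie algebra is the coequalizer of its canonical presentation by free ones. -/
def isColimitFreeCounit (g : DGLA k) :
    IsColimit (Cofork.ofπ (freeCounit adjT g) (freeCounit_condition adjT g)) :=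
  Cofork.IsColimit.ofExistsUnique fun s => existsUnique_freeCounit_desc adjT s.π s.condition

/-- Tensoring preserves the canonical presentation. -/
def isColimitTensorPresentation (C : cCDGA k) (g : DGLA k) :
    IsColimit (tensorPresentation (lieSemiModule k) adjT C g) :=
  have : PreservesColimitsOfSize.{0, 0} ((lieSemiModule k).act.obj C) :=
    (lieTensorAdj C).leftAdjoint_preservesColimits
  isColimitCoforkMapOfIsColimit ((lieSemiModule k).act.obj C) (freeCounit_condition adjT g)
    (isColimitFreeCounit adjT g)

lemma existsUnique_lieTensor_freeCounit_desc {C : cCDGA k} {g h : DGLA k}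
    (F : lieTensor C (T.obj g.X) ⟶ h)
    (w : lieTensorMap (𝟙 C) (freeCounit adjT (T.obj g.X)) ≫ F =
      lieTensorMap (𝟙 C) (T.map (freeCounit adjT g).hom) ≫ F) :
    ∃! l : lieTensor C g ⟶ h, lieTensorMap (𝟙 C) (freeCounit adjT g) ≫ l = F :=
  Cofork.IsColimit.existsUnique (isColimitTensorPresentation adjT C g) F w

/-- Transposing through `lieEnrEquiv` turns a cone with vertex C into a cocone under C ▷ T²g ⇉ C ▷
Tg, which the coequaliser factors uniquely. -/
lemma existsUnique_lieEnr_freeCounit_lift {C : cCDGA k} {g h : DGLA k}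
    (f : C ⟶ lieEnr (T.obj g.X) h)
    (w : f ≫ lieEnrMap (freeCounit adjT (T.obj g.X)) (𝟙 h) =
      f ≫ lieEnrMap (T.map (freeCounit adjT g).hom) (𝟙 h)) :
    ∃! l : C ⟶ lieEnr g h, l ≫ lieEnrMap (freeCounit adjT g) (𝟙 h) = f := by
  obtain ⟨F, rfl⟩ := (lieEnrEquiv _ _ _).surjective f
  rw [← lieEnrEquiv_pre, ← lieEnrEquiv_pre, (lieEnrEquiv _ _ _).injective.eq_iff] at w
  obtain ⟨G, hG, hG'⟩ := existsUnique_lieTensor_freeCounit_desc adjT F w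
  refine ⟨lieEnrEquiv g C h G, (lieEnrEquiv_pre _ _).symm.trans (congrArg _ hG), fun l hl => ?_⟩
  obtain ⟨L, rfl⟩ := (lieEnrEquiv _ _ _).surjective l
  rw [hG' L ((lieEnrEquiv _ _ _).injective ((lieEnrEquiv_pre _ _).trans hl))]

/-- The enrichment turns the canonical presentation into an equalizer. -/
def isLimitEnrPresentation (g h : DGLA k) :
    IsLimit (enrPresentation (lieEnrFunctor k) adjT g h) :=
  Fork.IsLimit.ofExistsUnique fun s => existsUnique_lieEnr_freeCounit_lift adjT s.ι s.condition

end Presentations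

end

theorem mainTheorem9 (k : Type u) [Field k] [CharZero k] :
    ∃ (T : DGVec k ⥤ DGLA k) (adjT : T ⊣ LieObj.forget (DGVec k))
      (S : DGVec k ⥤ cCDGA k) (adjS : cCDGA.forget k ⊣ S)
      (M : SemiModule (cCDGA k) (DGLA k)) (enr : (DGLA k)ᵒᵖ ⥤ DGLA k ⥤ cCDGA k)
      (cl : M.Closed enr (convFunctor k)),
      (∀ (C : cCDGA k) (V : DGVec k), IsIso (tensorFreeComparison cl adjT C V)) ∧
      (∀ (V : DGVec k) (h : DGLA k), IsIso (enrFreeComparison cl adjT adjS V h)) ∧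
      (∀ (C : cCDGA k) (g : DGLA k),
        Nonempty (Limits.IsColimit (tensorPresentation M adjT C g))) ∧
      (∀ g h : DGLA k, Nonempty (Limits.IsLimit (enrPresentation enr adjT g h))) ∧
      (∀ (C D : cCDGA k) (g : DGLA k),
        universalMeasuring cl (cCDGA.tensorObj C D) g ≫
            LieObj.Hom.hom (((M.assoc.hom.app C).app D).app g) =
          (α_ C.X D.X g.X).hom ≫ C.X ◁ universalMeasuring cl D g ≫
            universalMeasuring cl C ((M.act.obj D).obj g)) := by
  refine ⟨_, freeLieAdj, _, cofreeAdj, lieSemiModule k, lieEnrFunctor k, lieClosed k,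
    isIso_tensorFreeComparison freeLieAdj, isIso_enrFreeComparison freeLieAdj cofreeAdj,
    fun C g => ⟨isColimitTensorPresentation freeLieAdj C g⟩,
    fun g h => ⟨isLimitEnrPresentation freeLieAdj g h⟩, fun C D g => ?_⟩
  -- The abstract universal measurings are the representing ones, and for these the compatibility is
  -- the defining property of α.
  rw [universalMeasuring_lieClosed, universalMeasuring_lieClosed, universalMeasuring_lieClosed]
  exact lieTensorU_assocHom C D g
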